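/- Let $\theta_3$ be the graph with two vertices $a,b$ and three edges $e_0,e_1,e_2$ directed from $a$ to $b$, let $I=[0,1]$ and $X=\theta_3\times I$. The points of $X$ near which $X$ is a surface form the interior of $X$; the points near which $X$ is a union of at least three half-planes ("branches") with a common boundary line, lying on that line, form the ridge of $X$. An oriented knot in $X$ is an oriented closed curve contained in the interior and the ridge of $X$, which has finitely many multiple points, all of them double transversal crossings in the interior, and which at each ridge point passes transversally from one branch to a different branch; moreover, at each crossing one of the two pairs of opposite areas adjacent to it is marked with dots. The sign of a crossing is $+1$ if the dots lie in the area between the two outgoing half-branches and in the area between the two incoming ones, and $-1$ otherwise. Two knots are isotopic if they are related by ambient isotopies in $X$, the dotted Reidemeister moves $M_1^\pm,M_2,M_3$ in discs in the interior, the moves $M_4$ (an arc in one branch is pushed across the ridge into an adjacent branch), $M_5^{\pm}$ (a crossing is pushed across the ridge into an adjacent branch), $M_6$ (an arc passing from a branch to a second one is pushed so as to pass through a third adjacent branch in between), $M_7$ (an arc in a disc formed by the cone over a circle in the link of a singular point is replaced by another arc with the same end points missing that point), and the inverse moves. Let $\Pi$ be the set of free homotopy classes of loops in $X$, let $1\in\Pi$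 be the class of contractible loops, and let $\mathbb Z\Pi$ be the free abelian group with basis $\Pi$. For an oriented knot $K$ with underlying class $k\in\Pi$ set $$\operatorname{co}(K)=\sum_c \operatorname{sign}(c)\,\bigl(k_1^c\otimes k_2^c+k_2^c\otimes k_1^c-k\otimes 1-1\otimes k\bigr)\in\mathbb Z\Pi\otimes_{\mathbb Z}\mathbb Z\Pi ,$$ where $c$ runs over all crossings of $K$ and $k_1^c,k_2^c\in\Pi$ are the classes of the two loops obtained by the oriented smoothing of $K$ at $c$. For an integer $n\ge 0$, let $K_n$ be any oriented knot in $X$ formed by four embedded arcs: an arc from $(a,1/3)$ to $(b,2/3)$ in $e_0\times I$, an arc from $(b,2/3)$ to $(a,2/3)$ in $e_1\times I$, an arc from $(a,2/3)$ to $(b,1/3)$ in $e_0\times I$, and an arc from $(b,1/3)$ to $(a,1/3)$ in $e_2\times I$, where the two arcs in $e_0\times I$ cross each other transversally in $2n+1$ points and the dots are such that all these crossings have sign $+1$. Such knots exist for every $n\geq 0$. The group $\pi_1(X)$ is a free group on two generators $u,v$ represented respectively by the loops $e_0e_1^{-1}$ and $e_0e_2^{-1}$, and $$\operatorname{co}(K_n)=(2n+1)\,(u\otimes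 v+v\otimes u-k_n\otimes 1-1\otimes k_n),$$ where $k_n\in\Pi$ is the free homotopy class of the underlying loop of $K_n$, and $u,v$ also denote the corresponding elements of $\Pi$. Hence $K_n$ is not isotopic to any knot with fewer than $2n+1$ crossings, and $K_n$, $K_m$ are not isotopic for $n\neq m$. Both statements also hold when orientations of knots are disregarded. -/

import Mathlib

open Set Filter Topology
open scoped unitInterval TensorProduct

noncomputable section

/-! ### Finite graphs, cylinders and cones -/

/-- A finite graph: finitely many vertices and edges; loops and multiple edges are allowed.
Each edge is directed from its source to its target. -/
structure FinGraph where
  nV : ℕ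
  nE : ℕ
  src : Fin nE → Fin nV
  tgt : Fin nE → Fin nV

namespace FinGraph

/-- The gluing of the end points of the edges `{e} × [0,1]` to the vertices. -/
inductive Glue (G : FinGraph) : Fin G.nV ⊕ Fin G.nE × I → Fin G.nV ⊕ Fin G.nE × I → Prop
  | src (e : Fin G.nE) : Glue G (Sum.inr (e, 0)) (Sum.inl (G.src e))
  | tgt (e : Fin G.nE) : Glue G (Sum.inr (e, 1)) (Sum.inl (G.tgt e))

/-- The underlying topological space of a finite graph. -/
def Space (G : FinGraph) : Type := Quot G.Glue

instance (G : FinGraph) : TopologicalSpace G.Space :=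
  inferInstanceAs (TopologicalSpace (Quot G.Glue))

/-- A vertex as a point of the underlying space. -/
def vertex (G : FinGraph) (v : Fin G.nV) : G.Space := Quot.mk _ (Sum.inl v)

/-- The point of the edge `e` with parameter `x`; the edge runs from its source (`x = 0`)
to its target (`x = 1`). -/
def edgePt (G : FinGraph) (e : Fin G.nE) (x : I) : G.Space := Quot.mk _ (Sum.inr (e, x))

end FinGraph

/-- The graph `θ_n`: two vertices `a = 0`, `b = 1` and `n` edges, all directed from `a` to `b`. -/
def theta (n : ℕ) : FinGraph where
  nV := 2
  nE := n
  src := fun _ => 0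
  tgt := fun _ => 1

/-- The 2-complex `θ₃ × I`. -/
abbrev ThetaCyl : Type := (theta 3).Space × I

/-- The gluing that contracts `Γ × {0}` to a point. -/
inductive ConeGlue (Γ : Type) : Γ × I → Γ × I → Prop
  | apex (x y : Γ) : ConeGlue Γ (x, 0) (y, 0)

/-- The cone over `Γ`. -/
def Cone (Γ : Type) : Type := Quot (ConeGlue Γ)

instance (Γ : Type) [TopologicalSpace Γ] : TopologicalSpace (Cone Γ) :=
  inferInstanceAs (TopologicalSpace (Quot (ConeGlue Γ)))

/-- The point of the cone represented by `(x, r)`; it is the cone point if `r = 0`. -/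
def Cone.pt {Γ : Type} (x : Γ) (r : I) : Cone Γ := Quot.mk _ (x, r)

/-! ### Types of points of a 2-complex -/

/-- The union of `n` half-planes with a common boundary line: the half-plane number `i` consists
of the pairs `(y, w)` such that `0 ≤ w i` and all other coordinates of `w` are zero. -/
def Book (n : ℕ) : Type :=
  {p : ℝ × (Fin n → ℝ) // (∀ i, 0 ≤ p.2 i) ∧ ∀ i j, i ≠ j → p.2 i = 0 ∨ p.2 j = 0}

instance (n : ℕ) : TopologicalSpace (Book n) :=
  inferInstanceAs (TopologicalSpace
    {p : ℝ × (Fin n → ℝ) // (∀ i, 0 ≤ p.2 i) ∧ ∀ i j, i ≠ j → p.2 i = 0 ∨ p.2 j = 0})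

/-- The common boundary line of the half-planes. -/
def Book.spine (n : ℕ) : Set (Book n) := {p | p.1.2 = 0}

/-- The open half-plane number `i`. -/
def Book.page {n : ℕ} (i : Fin n) : Set (Book n) := {p | 0 < p.1.2 i}

/-- The origin on the common boundary line. -/
def Book.origin (n : ℕ) : Book n := ⟨(0, 0), fun _ => le_rfl, fun _ _ _ => Or.inl rfl⟩

/-- The closed bounded region around the origin in the union of the closed half-planes with
numbers in `S`: a disc if `S` has two elements, three half-discs with a common diameter if `S` has
three elements. -/
def Book.region {n : ℕ} (S : Set (Fin n)) : Set (Book n) :=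
  {p | |p.1.1| ≤ 1 ∧ ∀ i, p.1.2 i ≤ 1 ∧ (i ∉ S → p.1.2 i = 0)}

section Points

variable {X : Type*} [TopologicalSpace X]

/-- Generic points: `X` is a surface near `x`. They form the interior of `X`. -/
def IsGenericPt (x : X) : Prop :=
  ∃ φ : ℝ × ℝ → X, IsOpenEmbedding φ ∧ φ 0 = x

/-- Boundary points: `X` is a half-plane near `x`, with `x` on the boundary line. -/
def IsBoundaryPt (x : X) : Prop :=
  ∃ φ : {p : ℝ × ℝ // 0 ≤ p.2} → X, IsOpenEmbedding φ ∧ φ ⟨0, le_rfl⟩ = x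

/-- Ridge points: `X` is a union of at least three half-planes with a common boundary line near
`x`, with `x` on that line. -/
def IsRidgePt (x : X) : Prop :=
  ∃ n : ℕ, 3 ≤ n ∧ ∃ φ : Book n → X, IsOpenEmbedding φ ∧ φ (Book.origin n) = x

/-- Singular points are all the other points. -/
def IsSingularPt (x : X) : Prop :=
  ¬ IsGenericPt x ∧ ¬ IsBoundaryPt x ∧ ¬ IsRidgePt x

/-! ### Generic closed curves, knots -/

/-- The branches of the curve `γ` at the parameters `s` and `t` cross transversally in a generic
point of `X`: in some local coordinates they lie on the two coordinate axes. -/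
def TransverseAt (γ : ℝ → X) (s t : ℝ) : Prop :=
  ∃ φ : ℝ × ℝ → X, IsOpenEmbedding φ ∧ φ 0 = γ s ∧ φ 0 = γ t ∧
    (∀ᶠ r in 𝓝 s, γ r ∈ φ '' {p | p.2 = 0}) ∧ (∀ᶠ r in 𝓝 t, γ r ∈ φ '' {p | p.1 = 0})

/-- The curve `γ` meets the ridge at the parameter `t` and passes there transversally from one
branch of `X` to a different one. -/
def CrossesRidgeAt (γ : ℝ → X) (t : ℝ) : Prop :=
  ∃ n : ℕ, 3 ≤ n ∧ ∃ φ : Book n → X, IsOpenEmbedding φ ∧ φ (Book.origin n) = γ t ∧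
    ∃ i j : Fin n, i ≠ j ∧ (∀ᶠ r in 𝓝[<] t, γ r ∈ φ '' Book.page i) ∧
      (∀ᶠ r in 𝓝[>] t, γ r ∈ φ '' Book.page j)

end Points

/-- Near a crossing of an oriented curve there are four areas. One pair of opposite areas consists
of the area between the two outgoing half-branches and the area between the two incoming ones
(`along`). Each area of the other pair lies between an incoming and an outgoing half-branch
(`across`). The dots at a crossing select one of these two pairs. Reversing the orientation of the
whole curve does not change the names of the pairs. -/
inductive DotPair
  | along
  | across

/-- An oriented knot in `X`, parametrized by a map `ℝ → X` of period one: a generic closed curve in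
which every crossing is provided with dots. Only the values of `dots` at the crossing points matter
(every notion below reads them, up to isotopy, only there). -/
structure Knot (X : Type*) [TopologicalSpace X] where
  toFun : ℝ → X
  continuous_toFun : Continuous toFun
  periodic : ∀ t, toFun (t + 1) = toFun t
  finite_crossings :
    {p : ℝ × ℝ | 0 ≤ p.1 ∧ p.1 < p.2 ∧ p.2 < 1 ∧ toFun p.1 = toFun p.2}.Finite
  double : ∀ r ∈ Ico (0 : ℝ) 1, ∀ s ∈ Ico (0 : ℝ) 1, ∀ t ∈ Ico (0 : ℝ) 1,
    toFun r = toFun s → toFun s = toFun t → r = s ∨ s = t ∨ r = t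
  transverse : ∀ s ∈ Ico (0 : ℝ) 1, ∀ t ∈ Ico (0 : ℝ) 1, s ≠ t → toFun s = toFun t →
    TransverseAt toFun s t
  generic_or_ridge : ∀ t, IsGenericPt (toFun t) ∨ CrossesRidgeAt toFun t
  dots : X → DotPair

namespace Knot

variable {X : Type*} [TopologicalSpace X]

instance : CoeFun (Knot X) (fun _ => ℝ → X) := ⟨Knot.toFun⟩

/-- The crossings of `K`, each recorded by the two parameters at which `K` passes through it. -/
def crossings (K : Knot X) : Set (ℝ × ℝ) :=
  {p | 0 ≤ p.1 ∧ p.1 < p.2 ∧ p.2 < 1 ∧ K p.1 = K p.2}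

/-- The number of crossings. -/
def cro (K : Knot X) : ℕ := K.crossings.ncard

/-- The crossings of `K` at which both parameters lie in `J`. -/
def crossingsIn (K : Knot X) (J : Set ℝ) : Set (ℝ × ℝ) :=
  {p ∈ K.crossings | p.1 ∈ J ∧ p.2 ∈ J}

/-- The dots at the crossing with parameters `p`. -/
def dotsAt (K : Knot X) (p : ℝ × ℝ) : DotPair := K.dots (K p.1)

/-- The sign of a crossing: `+1` if the dots lie between the two outgoing half-branches and between
the two incoming ones, and `-1` otherwise. (In the oriented plane, with the dots in the two areas
swept by the overpassing line when it rotates counterclockwise, this is the classical sign.) -/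
def sign (K : Knot X) (p : ℝ × ℝ) : ℤ :=
  match K.dotsAt p with
  | DotPair.along => 1
  | DotPair.across => -1

end Knot

/-! ### Isotopy -/

namespace Knot

variable {X : Type*} [TopologicalSpace X]

/-- `K'` is `K` with another parametrization of the same oriented curve. -/
def IsReparam (K K' : Knot X) : Prop :=
  ∃ h : ℝ ≃o ℝ, (∀ t, h (t + 1) = h t + 1) ∧ (∀ t, K' t = K (h t)) ∧
    ∀ p ∈ K'.crossings, K'.dotsAt p = K.dots (K' p.1)

/-- `K'` is `K` with the opposite orientation and the same dots. -/
def IsReverse (K K' : Knot X) : Prop :=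
  (∀ t, K' t = K (-t)) ∧ ∀ p ∈ K'.crossings, K'.dotsAt p = K.dots (K' p.1)

/-- `K'` is the image of `K`, together with its dots, under an ambient isotopy of `X`. -/
def IsAmbient (K K' : Knot X) : Prop :=
  ∃ H : I → X ≃ₜ X, Continuous (fun q : I × X => H q.1 q.2) ∧ H 0 = Homeomorph.refl X ∧
    (∀ t, K' t = H 1 (K t)) ∧ ∀ p ∈ K.crossings, K'.dotsAt p = K.dotsAt p

/-- `K` and `K'` coincide, dots included, outside the set `D`, and the parts of `K` and `K'` in `D`
are precisely those with parameters in `J`. -/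
structure SameOff (K K' : Knot X) (D : Set X) (J : Set ℝ) : Prop where
  subset : J ⊆ Ioo 0 1
  mem_iff : ∀ t ∈ Ico (0 : ℝ) 1, K t ∈ D ↔ t ∈ J
  mem_iff' : ∀ t ∈ Ico (0 : ℝ) 1, K' t ∈ D ↔ t ∈ J
  eq_off : ∀ t ∈ Ico (0 : ℝ) 1, t ∉ J → K' t = K t
  dots_off : ∀ x, x ∉ D → K'.dots x = K.dots x

/-- A closed disc in the interior of `X`: the image of a square in a coordinate plane. -/
def IsInteriorDisc (D : Set X) : Prop :=
  ∃ φ : ℝ × ℝ → X, IsOpenEmbedding φ ∧ D = φ '' Metric.closedBall 0 1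

/-- `D` is a neighbourhood of an arc `R` of the ridge in the union of `m` branches
adjacent to it. -/
def IsRidgeRegion (m : ℕ) (D R : Set X) : Prop :=
  ∃ n : ℕ, 3 ≤ n ∧ ∃ φ : Book n → X, IsOpenEmbedding φ ∧ ∃ S : Set (Fin n), S.ncard = m ∧
    D = φ '' Book.region S ∧ R = φ '' (Book.region S ∩ Book.spine n)

/-- The moves `M₁⁺` and `M₁⁻`: in a disc, an embedded arc is replaced by an arc with the same
end points and with one crossing, which bounds a loop in the disc. The dots at the new crossing are
arbitrary. -/
def MoveM1 (K K' : Knot X) : Prop :=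
  ∃ D : Set X, IsInteriorDisc D ∧ ∃ p q : ℝ, p < q ∧ SameOff K K' D (Icc p q) ∧
    K.crossingsIn (Icc p q) = ∅ ∧ ∃ c, K'.crossingsIn (Icc p q) = {c}

/-- The move `M₂`: in a disc, two disjoint embedded arcs are replaced by two embedded arcs with the
same end points which cross twice and form a bigon. Exactly one of the two crossings has a dot
inside the bigon; in other words, the dots at the two crossings lie in pairs of areas of different
types. -/
def MoveM2 (K K' : Knot X) : Prop :=
  ∃ D : Set X, IsInteriorDisc D ∧ ∃ p₁ q₁ p₂ q₂ : ℝ, p₁ < q₁ ∧ q₁ < p₂ ∧ p₂ < q₂ ∧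
    SameOff K K' D (Icc p₁ q₁ ∪ Icc p₂ q₂) ∧
    K.crossingsIn (Icc p₁ q₁ ∪ Icc p₂ q₂) = ∅ ∧
    ∃ s₁ ∈ Icc p₁ q₁, ∃ s₂ ∈ Icc p₁ q₁, ∃ t₁ ∈ Icc p₂ q₂, ∃ t₂ ∈ Icc p₂ q₂,
      s₁ ≠ s₂ ∧ K'.crossingsIn (Icc p₁ q₁ ∪ Icc p₂ q₂) = {(s₁, t₁), (s₂, t₂)} ∧
      K'.dotsAt (s₁, t₁) ≠ K'.dotsAt (s₂, t₂)

/-- The move `M₃`: in a disc, three embedded arcs which cross pairwise once and form a triangle are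
replaced by three such arcs with the same end points, so that along each arc the order of its two
crossings is reversed. The arc `i` meets the arc `j` at the parameter `a i j` before the move
and `b i j` after the move. The dots at corresponding crossings lie in areas of the same type.
The corner of the triangle at the crossing of the arcs `i`, `j` carries a dot if and only if
`corner i j k` holds, where `k` is the third arc; the number of dots in the triangle must be one or
two (this means that the three arcs lie at three different heights). -/
def MoveM3 (K K' : Knot X) : Prop :=
  ∃ D : Set X, IsInteriorDisc D ∧ ∃ p q : Fin 3 → ℝ, (∀ i, p i < q i) ∧ q 0 < p 1 ∧ q 1 < p 2 ∧
    SameOff K K' D (⋃ i, Icc (p i) (q i)) ∧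
    ∃ a b : Fin 3 → Fin 3 → ℝ,
      (∀ i j, i ≠ j → a i j ∈ Icc (p i) (q i) ∧ b i j ∈ Icc (p i) (q i)) ∧
      K.crossingsIn (⋃ i, Icc (p i) (q i)) = {(a 0 1, a 1 0), (a 0 2, a 2 0), (a 1 2, a 2 1)} ∧
      K'.crossingsIn (⋃ i, Icc (p i) (q i)) = {(b 0 1, b 1 0), (b 0 2, b 2 0), (b 1 2, b 2 1)} ∧
      (∀ i j k, i ≠ j → i ≠ k → j ≠ k → (a i j < a i k ↔ b i k < b i j)) ∧
      (∀ i j, i < j → K'.dotsAt (b i j, b j i) = K.dotsAt (a i j, a j i)) ∧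
      let corner : Fin 3 → Fin 3 → Fin 3 → Prop := fun i j k =>
        (K.dotsAt (a i j, a j i) = DotPair.along ↔ (a i j < a i k ↔ a j i < a j k))
      (corner 0 1 2 ∨ corner 0 2 1 ∨ corner 1 2 0) ∧ ¬ (corner 0 1 2 ∧ corner 0 2 1 ∧ corner 1 2 0)

/-- The move `M₄`: in the union of two adjacent branches, an embedded arc not meeting the ridge is
pushed across the ridge and becomes an embedded arc meeting the ridge twice. -/
def MoveM4 (K K' : Knot X) : Prop :=
  ∃ D R : Set X, IsRidgeRegion 2 D R ∧ ∃ p q : ℝ, p < q ∧ SameOff K K' D (Icc p q) ∧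
    K.crossingsIn (Icc p q) = ∅ ∧ K'.crossingsIn (Icc p q) = ∅ ∧
    {t ∈ Icc p q | K t ∈ R} = ∅ ∧ {t ∈ Icc p q | K' t ∈ R}.ncard = 2

/-- The moves `M₅⁺` and `M₅⁻`: in the union of two adjacent branches, two embedded arcs which cross
each other once and which both pass once from one branch to the other are replaced by two such arcs
with the same end points, so that the crossing, with its dots, moves from one branch to the
other. -/
def MoveM5 (K K' : Knot X) : Prop :=
  ∃ n : ℕ, 3 ≤ n ∧ ∃ φ : Book n → X, IsOpenEmbedding φ ∧ ∃ i j : Fin n, i ≠ j ∧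
    ∃ p₁ q₁ p₂ q₂ : ℝ, p₁ < q₁ ∧ q₁ < p₂ ∧ p₂ < q₂ ∧
    SameOff K K' (φ '' Book.region {i, j}) (Icc p₁ q₁ ∪ Icc p₂ q₂) ∧
    (∀ t ∈ ({p₁, q₁, p₂, q₂} : Set ℝ), K t ∉ φ '' Book.spine n) ∧
    (∃! t, t ∈ Icc p₁ q₁ ∧ K t ∈ φ '' Book.spine n) ∧
    (∃! t, t ∈ Icc p₂ q₂ ∧ K t ∈ φ '' Book.spine n) ∧
    (∃! t, t ∈ Icc p₁ q₁ ∧ K' t ∈ φ '' Book.spine n) ∧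
    (∃! t, t ∈ Icc p₂ q₂ ∧ K' t ∈ φ '' Book.spine n) ∧
    ∃ s ∈ Icc p₁ q₁, ∃ t ∈ Icc p₂ q₂, ∃ s' ∈ Icc p₁ q₁, ∃ t' ∈ Icc p₂ q₂,
      K.crossingsIn (Icc p₁ q₁ ∪ Icc p₂ q₂) = {(s, t)} ∧
      K'.crossingsIn (Icc p₁ q₁ ∪ Icc p₂ q₂) = {(s', t')} ∧
      K s ∈ φ '' Book.page i ∧ K' s' ∈ φ '' Book.page j ∧
      K'.dotsAt (s', t') = K.dotsAt (s, t)

/-- The move `M₆`: in the union of three adjacent branches, an embedded arc passing from the first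
branch directly to the second is replaced by an embedded arc with the same end points passing from
the first branch to the third and then to the second. -/
def MoveM6 (K K' : Knot X) : Prop :=
  ∃ D R : Set X, IsRidgeRegion 3 D R ∧ ∃ p q : ℝ, p < q ∧ SameOff K K' D (Icc p q) ∧
    K.crossingsIn (Icc p q) = ∅ ∧ K'.crossingsIn (Icc p q) = ∅ ∧
    K p ∉ R ∧ K q ∉ R ∧
    {t ∈ Icc p q | K t ∈ R}.ncard = 1 ∧ {t ∈ Icc p q | K' t ∈ R}.ncard = 2

/-- The move `M₇`: let `x` be a singular point with a neighbourhood identified with the cone over a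
finite graph, and let `D` be the disc centered at `x` formed by the cone over a circle `s` embedded
in the graph. If the knot meets `D` along an embedded arc with end points on the boundary circle of
`D`, then this arc is replaced by another embedded arc in `D` with the same end points, which
misses `x`. -/
def MoveM7 (K K' : Knot X) : Prop :=
  ∃ x : X, IsSingularPt x ∧ ∃ (G : FinGraph) (ψ : Cone G.Space → X) (s : AddCircle (1 : ℝ) → G.Space),
    IsEmbedding ψ ∧ range ψ ∈ 𝓝 x ∧ Continuous s ∧ Function.Injective s ∧
    (∀ z, ψ (Cone.pt (s z) 0) = x) ∧ ∃ p q : ℝ, p < q ∧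
    SameOff K K' {y | ∃ z r, y = ψ (Cone.pt (s z) r)} (Icc p q) ∧
    K.crossingsIn (Icc p q) = ∅ ∧ K'.crossingsIn (Icc p q) = ∅ ∧
    (∃ z, K p = ψ (Cone.pt (s z) 1)) ∧ (∃ z, K q = ψ (Cone.pt (s z) 1)) ∧
    ∀ t ∈ Icc p q, K t ≠ x ∧ K' t ≠ x

/-- A change of parametrization, an ambient isotopy or a basic move. All of these preserve the
orientation of the knot. -/
def IsotopyStep (K K' : Knot X) : Prop :=
  IsReparam K K' ∨ IsAmbient K K' ∨ MoveM1 K K' ∨ MoveM2 K K' ∨ MoveM3 K K' ∨ MoveM4 K K' ∨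
    MoveM5 K K' ∨ MoveM6 K K' ∨ MoveM7 K K'

/-- Isotopy of oriented knots: knots are related by ambient isotopies, basic moves and their
inverses. -/
def OrientedIsotopic : Knot X → Knot X → Prop := Relation.EqvGen IsotopyStep

/-- Isotopy of the underlying unoriented knots: the orientation may also be reversed. -/
def Isotopic : Knot X → Knot X → Prop :=
  Relation.EqvGen (fun K K' => IsotopyStep K K' ∨ IsReverse K K')

end Knot

/-! ### Free homotopy classes and the colinking class -/

/-- The set `Π` of free homotopy classes of loops in `X`. -/
def FreeLoopClass (X : Type*) [TopologicalSpace X] : Type _ :=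
  Quotient (⟨ContinuousMap.Homotopic, ContinuousMap.Homotopic.equivalence⟩ :
    Setoid C(AddCircle (1 : ℝ), X))

section Loops

variable {X : Type*} [TopologicalSpace X]

/-- A closed path, seen as a map from the circle. -/
def loopToCircle {x : X} (γ : Path x x) : C(AddCircle (1 : ℝ), X) where
  toFun := AddCircle.liftIco 1 0 γ.extend
  continuous_toFun := AddCircle.liftIco_zero_continuous (by simp) γ.continuous_extend.continuousOn

/-- The free homotopy class of a closed path. -/
def freeClass {x : X} (γ : Path x x) : FreeLoopClass X := Quotient.mk _ (loopToCircle γ)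

/-- The class `1` of contractible loops, given as the class of the constant loop at a base
point. -/
def trivialClass (x : X) : FreeLoopClass X := freeClass (Path.refl x)

/-- The basis element of the free abelian group `ℤΠ` given by a free homotopy class. -/
def basisElt (k : FreeLoopClass X) : FreeLoopClass X →₀ ℤ := Finsupp.single k 1

end Loops

namespace Knot

variable {X : Type*} [TopologicalSpace X]

/-- The part of `K` from the parameter `s` to the parameter `t`. -/
def arc (K : Knot X) (s t : ℝ) : Path (K s) (K t) where
  toFun r := K (s + r * (t - s))
  continuous_toFun := K.continuous_toFun.comp (by fun_prop)
  source' := by simp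
  target' := by simp

/-- The free homotopy class of the underlying loop of `K`. -/
def homotopyClass (K : Knot X) : FreeLoopClass X :=
  freeClass ((K.arc 0 (0 + 1)).cast rfl (K.periodic 0).symm)

/-- The smoothing of `K` at a crossing has two components. This is the class of the first one,
which runs from the first passage of `K` through the crossing to the second. -/
def smooth₁ (K : Knot X) (c : K.crossings) : FreeLoopClass X :=
  freeClass ((K.arc c.1.1 c.1.2).cast rfl c.2.2.2.2)

/-- The class of the second component of the smoothing, which runs from the second passage of `K`
through the crossing to the next passage. -/
def smooth₂ (K : Knot X) (c : K.crossings) : FreeLoopClass X :=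
  freeClass ((K.arc c.1.2 (c.1.1 + 1)).cast rfl (c.2.2.2.2.symm.trans (K.periodic c.1.1).symm))

/-- The colinking class of an oriented knot, with values in `ℤΠ ⊗ ℤΠ`. The sum has finitely many
terms. -/
def co (K : Knot X) : (FreeLoopClass X →₀ ℤ) ⊗[ℤ] (FreeLoopClass X →₀ ℤ) :=
  ∑ᶠ c : K.crossings, K.sign c.1 •
    (basisElt (K.smooth₁ c) ⊗ₜ[ℤ] basisElt (K.smooth₂ c)
      + basisElt (K.smooth₂ c) ⊗ₜ[ℤ] basisElt (K.smooth₁ c)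
      - basisElt K.homotopyClass ⊗ₜ[ℤ] basisElt (trivialClass (K 0))
      - basisElt (trivialClass (K 0)) ⊗ₜ[ℤ] basisElt K.homotopyClass)

end Knot

/-! ### The knots `K_n` in `θ₃ × I` -/

namespace ThetaCyl

/-- The heights `1/3` and `2/3`. -/
def third : I := ⟨1 / 3, by norm_num, by norm_num⟩

/-- The heights `1/3` and `2/3`. -/
def twoThirds : I := ⟨2 / 3, by norm_num, by norm_num⟩

/-- The point `(a, h)`. -/
def ptA (h : I) : ThetaCyl := ((theta 3).vertex (0 : Fin 2), h)

/-- The point `(b, h)`. -/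
def ptB (h : I) : ThetaCyl := ((theta 3).vertex (1 : Fin 2), h)

/-- The square `e × I` without the two sides over the vertices `a`, `b`. -/
def openSquare (e : Fin 3) : Set ThetaCyl :=
  {z | ∃ x : I, 0 < x ∧ x < 1 ∧ z.1 = (theta 3).edgePt e x}

/-- The edge `e`, directed from `a` to `b`, at the height `h`. -/
def edgePath (e : Fin 3) (h : I) : Path (ptA h) (ptB h) where
  toFun x := ((theta 3).edgePt e x, h)
  continuous_toFun := by
    refine Continuous.prodMk ?_ continuous_const
    exact continuous_quot_mk.comp (by fun_prop)
  source' := Prod.ext (Quot.sound (FinGraph.Glue.src (G := theta 3) e)) rfl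
  target' := Prod.ext (Quot.sound (FinGraph.Glue.tgt (G := theta 3) e)) rfl

/-- The loop `e₀ e₁⁻¹` at the height `h`. -/
def loopU (h : I) : Path (ptA h) (ptA h) := (edgePath 0 h).trans (edgePath 1 h).symm

/-- The loop `e₀ e₂⁻¹` at the height `h`. -/
def loopV (h : I) : Path (ptA h) (ptA h) := (edgePath 0 h).trans (edgePath 2 h).symm

/-- The homotopy class of a loop as an element of the fundamental group. -/
def piClass {x : ThetaCyl} (γ : Path x x) : FundamentalGroup ThetaCyl x :=
  FundamentalGroup.fromPath (Path.Homotopic.Quotient.mk γ)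

/-- `K` is a knot `K_n`: it is formed by an embedded arc from `(a, 1/3)` to `(b, 2/3)` in `e₀ × I`,
an embedded arc from `(b, 2/3)` to `(a, 2/3)` in `e₁ × I`, an embedded arc from `(a, 2/3)` to
`(b, 1/3)` in `e₀ × I` and an embedded arc from `(b, 1/3)` to `(a, 1/3)` in `e₂ × I`; the two arcs
in `e₀ × I` cross each other in `2n+1` points, and all these crossings have sign `+1`. -/
def IsK (n : ℕ) (K : Knot ThetaCyl) : Prop :=
  (∃ t₀ t₁ t₂ t₃ : ℝ, t₀ < t₁ ∧ t₁ < t₂ ∧ t₂ < t₃ ∧ t₃ < t₀ + 1 ∧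
    K t₀ = ptA third ∧ K t₁ = ptB twoThirds ∧ K t₂ = ptA twoThirds ∧ K t₃ = ptB third ∧
    (∀ t ∈ Ioo t₀ t₁, K t ∈ openSquare 0) ∧ (∀ t ∈ Ioo t₁ t₂, K t ∈ openSquare 1) ∧
    (∀ t ∈ Ioo t₂ t₃, K t ∈ openSquare 0) ∧ (∀ t ∈ Ioo t₃ (t₀ + 1), K t ∈ openSquare 2) ∧
    InjOn K (Icc t₀ t₁) ∧ InjOn K (Icc t₁ t₂) ∧ InjOn K (Icc t₂ t₃) ∧ InjOn K (Icc t₃ (t₀ + 1))) ∧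
  K.cro = 2 * n + 1 ∧ ∀ c ∈ K.crossings, K.sign c = 1

end ThetaCyl

end

noncomputable section

/-! ### Real lifts of maps to the circle -/

/-! The isotopy statements are proved with an integer shadow of the colinking class. Fix a map f
from X to the circle. Each component of a smoothing then has a degree, and `splitCount f K` adds the
signs of the crossings whose two components have degrees with product 1. It is half the value on `co
K` of the homomorphism that sends a ⊗ b to 1 if deg a · deg b = 1 and to 0 otherwise. The correction
terms k ⊗ 1 and 1 ⊗ k contribute nothing, since 1 has degree 0.

Degrees are increments of a real lift of f ∘ K. Every basic move takes place in a set D inside a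
contractible chart (a plane, a book or a cone), on which f itself has a real lift F. Therefore the
degrees at crossings outside D do not change, and the degrees at a crossing inside D depend only on
the arcs that meet there. This is `SameOff.splitCount_sub`. It follows that a crossing created by M₁
has a component of degree 0, that the two crossings created by M₂ cancel, and that in M₃ and M₅ the
crossings correspond with equal contributions. Ambient isotopies are handled by lifting the whole
track of the knot. Reversal negates both degrees and keeps their product, so the invariant does not
see the orientation.

On θ₃ × I, let f wind e₀ once around the circle and collapse e₁ and e₂. Both u and v have degree 1.
Each crossing of K_n lies on the two arcs over e₀, and its smoothing consists of a loop in the class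
u and a loop in the class v (`IsK.exists_isRoundTrip`, `IsRoundTrip.freeClass_eq`). This gives `co`,
and it gives `splitCount` the value 2n+1. Since |`splitCount`| ≤ `cro`, both isotopy statements
follow.

Freeness of π₁ has two halves. For injectivity, a covering with fibre the free group is glued from
the two vertex stars, and its monodromy is left multiplication. For surjectivity, a loop is
subdivided subordinately to the stars, and each passage between stars is corrected by a loop e₀e⁻¹.
Existence of K_n comes from an explicit curve: the arcs over e₀ are the graphs of 1/2 ∓
cos((2n+1)πx)/6. -/

/-- A continuous function with integer values is constant on a preconnected set. Comparisons of
degrees below apply this to differences of lifts. -/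
theorem IsPreconnected.eq_of_coe_addCircle_eq_zero {Y : Type*} [TopologicalSpace Y] {S : Set Y}
    (hS : IsPreconnected S) {E : Y → ℝ} (hE : ContinuousOn E S)
    (h : ∀ x ∈ S, (E x : AddCircle (1 : ℝ)) = 0) {x y : Y} (hx : x ∈ S) (hy : y ∈ S) :
    E x = E y :=
  (AddCircle.isCoveringMap_coe (1 : ℝ)).constOn_of_comp hS hE
    (fun a ha b hb => (h a ha).trans (h b hb).symm) hx hy

theorem contractibleSpace_of_contraction {Y : Type*} [TopologicalSpace Y] (y₀ : Y)
    (H : C(I × Y, Y)) (h0 : ∀ y, H (0, y) = y₀) (h1 : ∀ y, H (1, y) = y) :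
    ContractibleSpace Y := by
  rw [contractible_iff_id_nullhomotopic]
  exact ⟨y₀, ⟨(⟨H, fun y => h0 y, fun y => h1 y⟩ :
    ContinuousMap.Homotopy (ContinuousMap.const Y y₀) (ContinuousMap.id Y)).symm⟩⟩

/-- The contraction, reversed, is a homotopy from a constant map to f. The constant map lifts, and
homotopy lifting carries the lift to f. No local condition on Y is needed. -/
theorem exists_real_lift {Y : Type*} [TopologicalSpace Y] [ContractibleSpace Y]
    (f : C(Y, AddCircle (1 : ℝ))) : ∃ F : C(Y, ℝ), ∀ y, (F y : AddCircle (1 : ℝ)) = f y := by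
  obtain ⟨y₀, ⟨H⟩⟩ := id_nullhomotopic Y
  obtain ⟨r, hr⟩ := QuotientAddGroup.mk_surjective (f y₀)
  let G : C(I × Y, AddCircle (1 : ℝ)) := f.comp H.symm.toContinuousMap
  have cov := AddCircle.isCoveringMap_coe (1 : ℝ)
  have h0 : ∀ a, G (0, a) = ((ContinuousMap.const Y r a : ℝ) : AddCircle (1 : ℝ)) := fun a => by
    have : H.symm (0, a) = y₀ := by simp
    change f (H.symm (0, a)) = _
    rw [this]; exact hr.symm
  refine ⟨(cov.liftHomotopy G (ContinuousMap.const Y r) h0).comp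
    ((ContinuousMap.const Y 1).prodMk (ContinuousMap.id Y)), fun y => ?_⟩
  have := congr_fun (cov.liftHomotopy_lifts G (ContinuousMap.const Y r) h0) (1, y)
  refine this.trans ?_
  have : H.symm (1, y) = y := by simp
  change f (H.symm (1, y)) = _
  rw [this]

section Lifts

variable {X : Type*}

/-- `L` is a real lift of the composition of `γ` with a map to the circle. -/
def IsRealLift (f : X → AddCircle (1 : ℝ)) (γ : ℝ → X) (L : ℝ → ℝ) : Prop :=
  Continuous L ∧ ∀ t, (L t : AddCircle (1 : ℝ)) = f (γ t)

theorem IsRealLift.sub_eq_sub {f : X → AddCircle (1 : ℝ)} {γ : ℝ → X} {L L' : ℝ → ℝ}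
    (h : IsRealLift f γ L) (h' : IsRealLift f γ L') (s t : ℝ) : L' t - L' s = L t - L s := by
  have := isPreconnected_univ.eq_of_coe_addCircle_eq_zero (E := fun t => L t - L' t)
    (h.1.sub h'.1).continuousOn (fun x _ => by rw [AddCircle.coe_sub, h.2, h'.2, sub_self])
    (mem_univ s) (mem_univ t)
  linarith

/-- The increment over one period is the degree of the closed curve, so it does not depend on the
starting parameter. -/
theorem IsRealLift.add_one_sub {f : X → AddCircle (1 : ℝ)} {γ : ℝ → X} {L : ℝ → ℝ}
    (h : IsRealLift f γ L) (hγ : ∀ t, γ (t + 1) = γ t) (s t : ℝ) :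
    L (t + 1) - L t = L (s + 1) - L s := by
  have h' : IsRealLift f γ (fun t => L (t + 1)) :=
    ⟨h.1.comp (continuous_add_const 1), fun t => by rw [h.2, hγ]⟩
  have := h.sub_eq_sub h' s t
  linarith

variable [TopologicalSpace X]

theorem exists_isRealLift (f : C(X, AddCircle (1 : ℝ))) {γ : ℝ → X} (hγ : Continuous γ) :
    ∃ L, IsRealLift f γ L := by
  obtain ⟨F, hF⟩ := exists_real_lift (f.comp ⟨γ, hγ⟩)
  exact ⟨F, F.continuous, hF⟩

/-- On `D` the map `f` to the circle has a continuous real lift. -/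
def HasRealLiftOn (f : X → AddCircle (1 : ℝ)) (D : Set X) : Prop :=
  ∃ F : X → ℝ, ContinuousOn F D ∧ ∀ x ∈ D, (F x : AddCircle (1 : ℝ)) = f x

theorem hasRealLiftOn_of_isEmbedding {Y : Type*} [TopologicalSpace Y] [ContractibleSpace Y]
    (f : C(X, AddCircle (1 : ℝ))) {φ : Y → X} (hφ : IsEmbedding φ) {D : Set X}
    (hD : D ⊆ range φ) : HasRealLiftOn f D := by
  obtain ⟨G, hG⟩ := exists_real_lift (f.comp ⟨φ, hφ.continuous⟩)
  -- The value 0 outside the range of φ is arbitrary: continuity and the lifting property are only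
  -- claimed on D.
  refine ⟨Function.extend φ G 0, ContinuousOn.mono ?_ hD, fun x hx => ?_⟩
  · rw [continuousOn_iff_continuous_domRestrict]
    convert G.continuous.comp hφ.toHomeomorph.symm.continuous using 1
    ext ⟨x, y, rfl⟩
    have : hφ.toHomeomorph.symm ⟨φ y, y, rfl⟩ = y := by
      rw [Homeomorph.symm_apply_eq]; rfl
    simp [this, hφ.injective.extend_apply]
  · obtain ⟨y, rfl⟩ := hD hx
    rw [hφ.injective.extend_apply]; exact hG y

/-- The change of a real lift along an arc that lies in a set with a lift. -/
theorem IsRealLift.sub_eq_of_mapsTo {f : X → AddCircle (1 : ℝ)} {γ : ℝ → X} {L : ℝ → ℝ}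
    (h : IsRealLift f γ L) (hγ : Continuous γ) {D : Set X} {F : X → ℝ} (hF : ContinuousOn F D)
    (hFf : ∀ x ∈ D, (F x : AddCircle (1 : ℝ)) = f x) {p q s t : ℝ} (hD : MapsTo γ (Icc p q) D)
    (hs : s ∈ Icc p q) (ht : t ∈ Icc p q) : L t - L s = F (γ t) - F (γ s) := by
  have := isPreconnected_Icc.eq_of_coe_addCircle_eq_zero (E := fun t => L t - F (γ t))
    (h.1.continuousOn.sub (hF.comp hγ.continuousOn hD))
    (fun x hx => by rw [AddCircle.coe_sub, h.2, hFf _ (hD hx), sub_self]) hs ht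
  linarith

end Lifts

/-! ### Contractibility of books and cones -/

instance (n : ℕ) : ContractibleSpace (Book n) := by
  let H : I × Book n → Book n := fun q => ⟨((q.1 : ℝ) * q.2.1.1, fun i => (q.1 : ℝ) * q.2.1.2 i),
    fun i => mul_nonneg q.1.2.1 (q.2.2.1 i), fun i j hij => by
      rcases q.2.2.2 i j hij with h | h
      · left; simp [h]
      · right; simp [h]⟩
  have hH : Continuous H := by
    refine Continuous.subtype_mk (Continuous.prodMk ?_ (continuous_pi fun i => ?_)) _
    · exact (continuous_subtype_val.comp continuous_fst).mul
        (continuous_fst.comp (continuous_subtype_val.comp continuous_snd))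
    · exact (continuous_subtype_val.comp continuous_fst).mul
        ((continuous_apply i).comp (continuous_snd.comp
          (continuous_subtype_val.comp continuous_snd)))
  refine contractibleSpace_of_contraction (Book.origin n) ⟨H, hH⟩ (fun y => ?_) (fun y => ?_)
  · apply Subtype.ext
    change (((0 : I) : ℝ) * y.1.1, fun i => ((0 : I) : ℝ) * y.1.2 i) = (0, 0)
    simp; rfl
  · apply Subtype.ext
    change (((1 : I) : ℝ) * y.1.1, fun i => ((1 : I) : ℝ) * y.1.2 i) = y.1
    simp

instance (Γ : Type) [TopologicalSpace Γ] [Nonempty Γ] : ContractibleSpace (Cone Γ) := by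
  let x₀ : Γ := Classical.arbitrary Γ
  let H : I × Cone Γ → Cone Γ := fun q => Quot.map (fun z : Γ × I => (z.1, q.1 * z.2))
    (fun a b h => by cases h with | apex x y => simpa using ConeGlue.apex x y) q.2
  have hH : Continuous H := by
    -- Since `I` is locally compact, continuity on its product with the quotient can be tested
    -- before passing to the quotient.
    refine IsQuotientMap.continuous_lift_prod_right (f := Quot.mk (ConeGlue Γ))
      isQuotientMap_quot_mk ?_
    exact continuous_quot_mk.comp (by fun_prop : Continuous fun p : I × (Γ × I) =>
      (p.2.1, p.1 * p.2.2))
  refine contractibleSpace_of_contraction (Cone.pt x₀ 0) ⟨H, hH⟩ (fun y => ?_) (fun y => ?_)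
  · obtain ⟨⟨x, r⟩, rfl⟩ := Quot.exists_rep y
    change Quot.mk _ (x, 0 * r) = _
    rw [zero_mul]; exact Quot.sound (ConeGlue.apex _ _)
  · obtain ⟨⟨x, r⟩, rfl⟩ := Quot.exists_rep y
    change Quot.mk _ (x, 1 * r) = _
    rw [one_mul]

/-! ### The number of crossings that split a knot into two curves of degree one -/

namespace Knot

section Count

variable {X : Type*} [TopologicalSpace X]

/-- The contribution of a crossing to `Knot.splitCount`: its sign if the two components of the
smoothing have equal degrees `1` or `-1`, where `L` is a real lift of the knot. -/
def splitTerm (K : Knot X) (L : ℝ → ℝ) (p : ℝ × ℝ) : ℤ :=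
  open Classical in if (L p.2 - L p.1) * (L (p.1 + 1) - L p.2) = 1 then K.sign p else 0

/-- The number of crossings, counted with signs, at which the smoothing consists of two curves
both of degree `1` or both of degree `-1` under `f`. -/
def splitCount (f : C(X, AddCircle (1 : ℝ))) (K : Knot X) : ℤ :=
  ∑ᶠ p ∈ K.crossings, K.splitTerm (exists_isRealLift f K.continuous_toFun).choose p

variable {f : C(X, AddCircle (1 : ℝ))}

theorem crossings_finite (K : Knot X) : K.crossings.Finite := K.finite_crossings

theorem splitTerm_congr {K K' : Knot X} {L L' : ℝ → ℝ} {p p' : ℝ × ℝ}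
    (hd : K'.dotsAt p' = K.dotsAt p)
    (h : (L' p'.2 - L' p'.1) * (L' (p'.1 + 1) - L' p'.2) =
      (L p.2 - L p.1) * (L (p.1 + 1) - L p.2)) :
    K'.splitTerm L' p' = K.splitTerm L p := by
  simp only [splitTerm, h, sign, hd]

/-- All real lifts have the same increments, so the chosen lift in `splitCount` may be replaced by
whichever lift is convenient. -/
theorem splitCount_eq {K : Knot X} {L : ℝ → ℝ} (hL : IsRealLift f K L) :
    splitCount f K = ∑ᶠ p ∈ K.crossings, K.splitTerm L p := by
  have h := (exists_isRealLift f K.continuous_toFun).choose_spec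
  refine finsum_mem_congr rfl fun p _ => splitTerm_congr rfl ?_
  rw [h.sub_eq_sub hL, h.sub_eq_sub hL]

theorem abs_splitTerm_le (K : Knot X) (L : ℝ → ℝ) (p : ℝ × ℝ) : |K.splitTerm L p| ≤ 1 := by
  unfold splitTerm sign
  split_ifs
  · cases K.dotsAt p <;> simp
  · simp

/-- Each crossing contributes 1, −1 or 0. This is how the invariant bounds the number of crossings
from below. -/
theorem abs_splitCount_le (f : C(X, AddCircle (1 : ℝ))) (K : Knot X) :
    |splitCount f K| ≤ K.cro := by
  rw [splitCount, finsum_mem_eq_finite_toFinset_sum _ K.crossings_finite, cro,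
    Set.ncard_eq_toFinset_card _ K.crossings_finite]
  refine (Finset.abs_sum_le_sum_abs _ _).trans ?_
  refine (Finset.sum_le_card_nsmul _ _ 1 fun p _ => abs_splitTerm_le _ _ _).trans ?_
  simp

theorem splitCount_eq_of_bijOn {K K' : Knot X} {L L' : ℝ → ℝ} (hL : IsRealLift f K L)
    (hL' : IsRealLift f K' L') (e : ℝ × ℝ → ℝ × ℝ) (he : BijOn e K'.crossings K.crossings)
    (h : ∀ p ∈ K'.crossings, K'.splitTerm L' p = K.splitTerm L (e p)) :
    splitCount f K' = splitCount f K := by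
  rw [splitCount_eq hL, splitCount_eq hL']
  exact finsum_mem_eq_of_bijOn e he h

/-! ### Change of the parameter and of the orientation -/

/-- Two parameters modulo one, in increasing order. -/
def sortFract (p : ℝ × ℝ) : ℝ × ℝ :=
  (min (Int.fract p.1) (Int.fract p.2), max (Int.fract p.1) (Int.fract p.2))

theorem sortFract_eq_self {p : ℝ × ℝ} (h0 : 0 ≤ p.1) (h : p.1 < p.2) (h1 : p.2 < 1) :
    sortFract p = p := by
  have e1 : Int.fract p.1 = p.1 := Int.fract_eq_self.2 ⟨h0, h.trans h1⟩
  have e2 : Int.fract p.2 = p.2 := Int.fract_eq_self.2 ⟨h0.trans h.le, h1⟩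
  simp [sortFract, e1, e2, h.le]

theorem apply_add_int (K : Knot X) (t : ℝ) (n : ℤ) : K (t + n) = K t := by
  have : Function.Periodic K.toFun 1 := K.periodic
  simpa using this.int_mul n t

theorem apply_fract (K : Knot X) (t : ℝ) : K (Int.fract t) = K t := by
  conv_rhs => rw [← Int.fract_add_floor t]
  exact (K.apply_add_int _ _).symm

theorem sortFract_mem_crossings {K : Knot X} {s t : ℝ} (hK : K s = K t)
    (hst : Int.fract s ≠ Int.fract t) : sortFract (s, t) ∈ K.crossings := by
  refine ⟨le_min (Int.fract_nonneg _) (Int.fract_nonneg _), min_lt_max.2 hst,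
    max_lt (Int.fract_lt_one _) (Int.fract_lt_one _), ?_⟩
  have : K (Int.fract s) = K (Int.fract t) := by rw [K.apply_fract, K.apply_fract, hK]
  rcases le_total (Int.fract s) (Int.fract t) with h | h <;> simp [sortFract, h, this]

theorem apply_sortFract_fst {K : Knot X} {s t : ℝ} (hK : K s = K t) :
    K (sortFract (s, t)).1 = K s := by
  rcases le_total (Int.fract s) (Int.fract t) with h | h <;> simp [sortFract, h, K.apply_fract, hK]

/-- The condition `hg` says that g descends to the circle; minimum and maximum absorb a possible
exchange of the two parameters. -/
theorem sortFract_map_sortFract {g : ℝ → ℝ} (hg : ∀ t, Int.fract (g (Int.fract t)) = Int.fract (g t))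
    (s t : ℝ) : sortFract (g (sortFract (s, t)).1, g (sortFract (s, t)).2) =
      sortFract (g s, g t) := by
  rcases le_total (Int.fract s) (Int.fract t) with h | h
  · simp [sortFract, h, hg]
  · simp [sortFract, h, hg, min_comm, max_comm]

theorem fract_ne_of_mem_crossings {K : Knot X} {p : ℝ × ℝ} (hp : p ∈ K.crossings) {h h' : ℝ → ℝ}
    (hh' : ∀ t, h' (h t) = t)
    (hf' : ∀ t, Int.fract (h' (Int.fract t)) = Int.fract (h' t)) :
    Int.fract (h p.1) ≠ Int.fract (h p.2) := by
  intro e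
  have := congrArg (fun x => Int.fract (h' x)) e
  simp only [hf', hh'] at this
  rw [Int.fract_eq_self.2 ⟨hp.1, hp.2.1.trans hp.2.2.1⟩,
    Int.fract_eq_self.2 ⟨hp.1.trans hp.2.1.le, hp.2.2.1⟩] at this
  exact hp.2.1.ne this

/-- Crossings are recorded by increasing pairs in [0, 1), and a change of parameter may move a
passage across 0 or exchange the two passages; `sortFract` restores the normal form. Only inverse
maps of the circle are required, so the lemma serves both reparametrization and reversal. -/
theorem bijOn_sortFract_comp {K K' : Knot X} {h h' : ℝ → ℝ} (hK : ∀ t, K' t = K (h t))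
    (hh' : ∀ t, h' (h t) = t) (h'h : ∀ t, h (h' t) = t)
    (hf : ∀ t, Int.fract (h (Int.fract t)) = Int.fract (h t))
    (hf' : ∀ t, Int.fract (h' (Int.fract t)) = Int.fract (h' t)) :
    BijOn (fun p => sortFract (h p.1, h p.2)) K'.crossings K.crossings := by
  have key : ∀ p : ℝ × ℝ, ∀ g g' : ℝ → ℝ, (∀ t, g' (g t) = t) →
      (∀ t, Int.fract (g' (Int.fract t)) = Int.fract (g' t)) →
      0 ≤ p.1 → p.1 < p.2 → p.2 < 1 →
      sortFract (g' (sortFract (g p.1, g p.2)).1, g' (sortFract (g p.1, g p.2)).2) = p := by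
    intro p g g' hg hg' h0 h1 h2
    rw [sortFract_map_sortFract hg', hg, hg]
    exact sortFract_eq_self h0 h1 h2
  refine InvOn.bijOn (f' := fun p => sortFract (h' p.1, h' p.2)) ⟨?_, ?_⟩ ?_ ?_
  · exact fun p hp => key p h h' hh' hf' hp.1 hp.2.1 hp.2.2.1
  · exact fun p hp => key p h' h h'h hf hp.1 hp.2.1 hp.2.2.1
  · intro p hp
    exact sortFract_mem_crossings (by rw [← hK, ← hK, hp.2.2.2])
      (fract_ne_of_mem_crossings hp hh' hf')
  · intro p hp
    exact sortFract_mem_crossings (by rw [hK, hK, h'h, h'h, hp.2.2.2])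
      (fract_ne_of_mem_crossings hp h'h hf)

theorem apply_add_int_of_apply_add_one {L : ℝ → ℝ} {d : ℝ} (hL : ∀ t, L (t + 1) = L t + d)
    (x : ℝ) (n : ℤ) : L (x + n) = L x + n * d := by
  have hn : ∀ (x : ℝ) (n : ℕ), L (x + n) = L x + n * d := by
    intro x n
    induction n with
    | zero => simp
    | succ n ih => push_cast; rw [← add_assoc, hL, ih]; ring
  obtain ⟨n, rfl | rfl⟩ := n.eq_nat_or_neg
  · exact_mod_cast hn x n
  · have := hn (x + ((-(n : ℤ) : ℤ) : ℝ)) n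
    push_cast at this ⊢
    rw [neg_add_cancel_right] at this; linarith

/-- The product of the degrees of the two components of a smoothing can be computed from any pair
of parameters less than one apart. -/
theorem lift_sortFract {L : ℝ → ℝ} {d : ℝ} (hL : ∀ t, L (t + 1) = L t + d) {s t : ℝ}
    (hst : s < t) (hts : t < s + 1) :
    (L (sortFract (s, t)).2 - L (sortFract (s, t)).1) *
      (L ((sortFract (s, t)).1 + 1) - L (sortFract (s, t)).2) =
    (L t - L s) * (L (s + 1) - L t) := by
  have hz := apply_add_int_of_apply_add_one hL
  have hs := hz (Int.fract s) ⌊s⌋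
  have ht := hz (Int.fract t) ⌊t⌋
  rw [Int.fract_add_floor] at hs ht
  have e1 := Int.fract_add_floor s
  have e2 := Int.fract_add_floor t
  have a1 := Int.fract_nonneg s
  have a2 := Int.fract_nonneg t
  have b1 := Int.fract_lt_one s
  have b2 := Int.fract_lt_one t
  rcases le_or_gt (Int.fract s) (Int.fract t) with h | h
  · have : ⌊t⌋ = ⌊s⌋ := by
      have h1 : (⌊t⌋ : ℝ) < ⌊s⌋ + 1 := by linarith
      have h2 : (⌊s⌋ : ℝ) - 1 < ⌊t⌋ := by linarith
      norm_cast at h1 h2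
      have h1' : ⌊t⌋ < ⌊s⌋ + 1 := by exact_mod_cast h1
      have h2' : ⌊s⌋ - 1 < ⌊t⌋ := by exact_mod_cast h2
      omega
    rw [this] at ht
    simp only [sortFract, min_eq_left h, max_eq_right h, hL, hs, ht]; ring
  -- Here t lies in the period after that of s. Reduction modulo one reverses the order of the pair,
  -- and the two factors of the product trade places.
  · have : ⌊t⌋ = ⌊s⌋ + 1 := by
      have h1 : (⌊t⌋ : ℝ) < ⌊s⌋ + 2 := by linarith
      have h2 : (⌊s⌋ : ℝ) < ⌊t⌋ := by linarith
      have h1' : ⌊t⌋ < ⌊s⌋ + 2 := by exact_mod_cast h1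
      have h2' : ⌊s⌋ < ⌊t⌋ := by exact_mod_cast h2
      omega
    rw [this] at ht
    push_cast at ht
    simp only [sortFract, min_eq_right h.le, max_eq_left h.le, hL, hs, ht]; ring

theorem sortFract_swap (s t : ℝ) : sortFract (s, t) = sortFract (t, s) := by
  simp [sortFract, min_comm, max_comm]

theorem IsReparam.splitCount_eq {K K' : Knot X} (h : IsReparam K K') :
    splitCount f K' = splitCount f K := by
  obtain ⟨h, h1, hK, hd⟩ := h
  obtain ⟨L, hL⟩ := exists_isRealLift f K.continuous_toFun
  have hL' : IsRealLift f K' (fun t => L (h t)) := ⟨hL.1.comp h.continuous, fun t => by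
    rw [hL.2]; exact congrArg f (hK t).symm⟩
  have hper : ∀ t, L (t + 1) = L t + (L (0 + 1) - L 0) := fun t => by
    linarith [hL.add_one_sub K.periodic 0 t]
  -- A map that commutes with translation by 1 descends to the circle.
  have hn : ∀ g : ℝ → ℝ, (∀ t, g (t + 1) = g t + 1) → ∀ t,
      Int.fract (g (Int.fract t)) = Int.fract (g t) := by
    intro g hg t
    have hp : Function.Periodic (fun t => Int.fract (g t)) 1 := fun t => by simp [hg]
    have := hp.int_mul ⌊t⌋ (Int.fract t)
    simp only [mul_one, Int.fract_add_floor] at this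
    exact this.symm
  have h1' : ∀ t, h.symm (t + 1) = h.symm t + 1 := fun t => by
    rw [OrderIso.symm_apply_eq, h1, h.apply_symm_apply]
  refine splitCount_eq_of_bijOn hL hL' _ (bijOn_sortFract_comp hK h.symm_apply_apply
    h.apply_symm_apply (hn h h1) (hn h.symm h1')) fun p hp => ?_
  have hKp : K (h p.1) = K (h p.2) := by rw [← hK, ← hK]; exact hp.2.2.2
  refine splitTerm_congr ?_ ?_
  · rw [hd p hp, dotsAt, apply_sortFract_fst hKp, hK]
  · rw [lift_sortFract hper (h.strictMono hp.2.1), h1]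
    rw [← h1]
    exact h.strictMono (by linarith [hp.1, hp.2.2.1])

/-- Reversal changes the sign of both degrees and fixes their product, while the dots keep their
type. For this reason `splitTerm` tests the product and not the degrees themselves. -/
theorem IsReverse.splitCount_eq {K K' : Knot X} (h : IsReverse K K') :
    splitCount f K' = splitCount f K := by
  obtain ⟨hK, hd⟩ := h
  obtain ⟨L, hL⟩ := exists_isRealLift f K.continuous_toFun
  have hL' : IsRealLift f K' (fun t => L (-t)) := ⟨hL.1.comp continuous_neg, fun t => by
    rw [hL.2]; exact congrArg f (hK t).symm⟩
  have hper : ∀ t, L (t + 1) = L t + (L (0 + 1) - L 0) := fun t => by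
    linarith [hL.add_one_sub K.periodic 0 t]
  have hn : ∀ t : ℝ, Int.fract (-(Int.fract t)) = Int.fract (-t) := by
    intro t
    rw [Int.fract_eq_fract]
    exact ⟨⌊t⌋, by linarith [Int.fract_add_floor t]⟩
  refine splitCount_eq_of_bijOn hL hL' _ (bijOn_sortFract_comp (h := fun t => -t)
    (h' := fun t => -t) hK neg_neg neg_neg hn hn) fun p hp => ?_
  have hKp : K (-p.1) = K (-p.2) := by rw [← hK, ← hK]; exact hp.2.2.2
  refine splitTerm_congr ?_ ?_
  · rw [hd p hp, dotsAt, apply_sortFract_fst hKp, hK]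
  · have h0 : L (-p.1) = L (-(p.1 + 1)) + (L (0 + 1) - L 0) := by
      rw [← hper]; congr 1; ring
    rw [sortFract_swap, lift_sortFract hper (by linarith [hp.2.1]) (by linarith [hp.1, hp.2.2.1]),
      hper (-p.2)]
    rw [h0]; ring

/-- The track of the knot is a map of the plane to X, so its composition with f has one real lift G.
At a double point the increment of G between the two passages is an integer at every time, hence the
same before and after the isotopy. -/
theorem IsAmbient.splitCount_eq {K K' : Knot X} (h : IsAmbient K K') :
    splitCount f K' = splitCount f K := by
  obtain ⟨H, hH, H0, hK, hd⟩ := h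
  -- Extending the time of the isotopy to the whole line makes the domain of the track a
  -- contractible plane.
  have hpr : Continuous (projIcc (0 : ℝ) 1 zero_le_one) := continuous_projIcc
  have hc : Continuous fun q : ℝ × ℝ => H (projIcc (0 : ℝ) 1 zero_le_one q.1) (K q.2) :=
    hH.comp ((hpr.comp continuous_fst).prodMk
      (K.continuous_toFun.comp continuous_snd))
  obtain ⟨G, hG⟩ := exists_real_lift (f.comp ⟨_, hc⟩)
  have hL : IsRealLift f K (fun t => G (0, t)) := ⟨by fun_prop, fun t => by
    rw [hG]; simp [H0]⟩
  have hL' : IsRealLift f K' (fun t => G (1, t)) := ⟨by fun_prop, fun t => by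
    rw [hG, hK t]; simp⟩
  have key : ∀ s t, K s = K t → G (1, t) - G (1, s) = G (0, t) - G (0, s) := fun s t hst =>
    isPreconnected_univ.eq_of_coe_addCircle_eq_zero (E := fun r : ℝ => G (r, t) - G (r, s))
      (by fun_prop) (fun r _ => by rw [AddCircle.coe_sub, hG, hG]; simp [hst]) (mem_univ _)
      (mem_univ _)
  have hc : K'.crossings = K.crossings := by
    ext p; simp only [crossings, mem_ofPred_eq, hK, (H 1).injective.eq_iff]
  refine splitCount_eq_of_bijOn hL hL' id (by rw [hc]; exact bijOn_id _) fun p hp => ?_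
  rw [hc] at hp
  refine splitTerm_congr (hd p hp) ?_
  simp only [id]
  rw [key _ _ hp.2.2.2, key p.2 (p.1 + 1) (by rw [K.periodic, hp.2.2.2])]

end Count

end Knot

namespace Knot

/-! ### Invariance under the basic moves -/

section Moves

variable {X : Type*} [TopologicalSpace X] {f : C(X, AddCircle (1 : ℝ))}

/-- The two degrees of a smoothing add up to the degree of the knot. If the total degrees agree, it
is enough to compare the first components. -/
theorem splitTerm_eq_of_sub_eq {K K' : Knot X} {L L' : ℝ → ℝ} (hL : IsRealLift f K L)
    (hL' : IsRealLift f K' L') (h1 : L' 1 - L' 0 = L 1 - L 0) {p p' : ℝ × ℝ}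
    (hd : K'.dotsAt p' = K.dotsAt p) (h : L' p'.2 - L' p'.1 = L p.2 - L p.1) :
    K'.splitTerm L' p' = K.splitTerm L p := by
  refine splitTerm_congr hd ?_
  have e := hL.add_one_sub K.periodic 0 p.1
  have e' := hL'.add_one_sub K'.periodic 0 p'.1
  rw [zero_add] at e e'
  rw [h, show L' (p'.1 + 1) - L' p'.2 = L (p.1 + 1) - L p.2 by linarith]

/-! ### Comparison of two knots that differ only inside a set with a real lift -/

namespace SameOff

variable {K K' : Knot X} {D : Set X} {J : Set ℝ}

theorem symm (h : SameOff K K' D J) : SameOff K' K D J where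
  subset := h.subset
  mem_iff := h.mem_iff'
  mem_iff' := h.mem_iff
  eq_off t ht htJ := (h.eq_off t ht htJ).symm
  dots_off x hx := (h.dots_off x hx).symm

theorem mapsTo (h : SameOff K K' D J) : MapsTo K J D := fun _ ht =>
  (h.mem_iff _ (Ioo_subset_Ico_self (h.subset ht))).2 ht

/-- The set J consists of the parameters in one period at which the knot is in D. The two passages
through a crossing are at the same point, so both parameters belong to J or neither does. -/
theorem crossings_diff_subset (h : SameOff K K' D J) :
    K.crossings \ K.crossingsIn J ⊆ K'.crossings \ K'.crossingsIn J := by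
  rintro p ⟨hp, hpJ⟩
  have m1 : p.1 ∈ Ico (0 : ℝ) 1 := ⟨hp.1, hp.2.1.trans hp.2.2.1⟩
  have m2 : p.2 ∈ Ico (0 : ℝ) 1 := ⟨hp.1.trans hp.2.1.le, hp.2.2.1⟩
  have hiff : p.1 ∈ J ↔ p.2 ∈ J := by
    rw [← h.mem_iff _ m1, ← h.mem_iff _ m2, hp.2.2.2]
  have h1 : p.1 ∉ J := fun h1 => hpJ ⟨hp, h1, hiff.1 h1⟩
  have h2 : p.2 ∉ J := fun h2 => h1 (hiff.2 h2)
  exact ⟨⟨hp.1, hp.2.1, hp.2.2.1, by rw [h.eq_off _ m1 h1, h.eq_off _ m2 h2, hp.2.2.2]⟩,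
    fun hc => h1 hc.2.1⟩

theorem crossings_diff_eq (h : SameOff K K' D J) :
    K'.crossings \ K'.crossingsIn J = K.crossings \ K.crossingsIn J :=
  h.symm.crossings_diff_subset.antisymm h.crossings_diff_subset

theorem not_mem_of_mem_crossings_diff (h : SameOff K K' D J) {p : ℝ × ℝ}
    (hp : p ∈ K.crossings \ K.crossingsIn J) : p.1 ∉ J ∧ p.2 ∉ J := by
  obtain ⟨hp, hpJ⟩ := hp
  have m1 : p.1 ∈ Ico (0 : ℝ) 1 := ⟨hp.1, hp.2.1.trans hp.2.2.1⟩
  have m2 : p.2 ∈ Ico (0 : ℝ) 1 := ⟨hp.1.trans hp.2.1.le, hp.2.2.1⟩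
  have hiff : p.1 ∈ J ↔ p.2 ∈ J := by
    rw [← h.mem_iff _ m1, ← h.mem_iff _ m2, hp.2.2.2]
  have h1 : p.1 ∉ J := fun h1 => hpJ ⟨hp, h1, hiff.1 h1⟩
  exact ⟨h1, fun h2 => h1 (hiff.2 h2)⟩

theorem zero_not_mem (h : SameOff K K' D J) : (0 : ℝ) ∉ J := fun h0 => (h.subset h0).1.ne rfl

theorem apply_eq_of_mem_Icc (h : SameOff K K' D J) {t : ℝ} (ht : t ∈ Icc (0 : ℝ) 1)
    (htJ : t ∉ J) : K' t = K t := by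
  rcases ht.2.lt_or_eq with h1 | rfl
  · exact h.eq_off t ⟨ht.1, h1⟩ htJ
  · have e := K.periodic 0
    have e' := K'.periodic 0
    rw [zero_add] at e e'
    rw [e, e', h.eq_off 0 ⟨le_rfl, one_pos⟩ h.zero_not_mem]

/-- Such a parameter is a limit of parameters outside J, where the two curves agree. These can be
taken in (0, 1) because J lies in this open interval; the Hausdorff property passes the equality to
the limit. -/
theorem apply_eq_of_mem_frontier [T2Space X] (h : SameOff K K' D J) {t : ℝ}
    (ht : t ∈ frontier J) (htJ : t ∈ J) : K' t = K t := by
  have hcl : t ∈ closure (Ioo 0 1 ∩ Jᶜ) := by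
    have h1 : t ∈ closure Jᶜ := frontier_subset_closure (by rwa [frontier_compl])
    exact isOpen_Ioo.inter_closure ⟨h.subset htJ, h1⟩
  have hs : IsClosed {t | K' t = K t} := isClosed_eq K'.continuous_toFun K.continuous_toFun
  refine closure_minimal (fun x hx => ?_) hs hcl
  exact h.eq_off x (Ioo_subset_Ico_self hx.1) hx.2

/-- Two lifts that agree at 0 can differ only as the lift F on D dictates: on J by F(K' t) − F(K t),
elsewhere not at all. This correction is continuous because the curves agree on the frontier of J,
and subtracting it leaves a continuous integer-valued function that vanishes at 0. -/
theorem exists_lifts [T2Space X] (h : SameOff K K' D J) (hJ : IsClosed J) {F : X → ℝ}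
    (hF : ContinuousOn F D) (hFf : ∀ x ∈ D, (F x : AddCircle (1 : ℝ)) = f x) :
    ∃ L L', IsRealLift f K L ∧ IsRealLift f K' L' ∧
      (∀ t ∈ Icc (0 : ℝ) 1, t ∉ J → L' t = L t) ∧
      ∀ t ∈ J, L' t - F (K' t) = L t - F (K t) := by
  obtain ⟨L, hL⟩ := exists_isRealLift f K.continuous_toFun
  obtain ⟨L₁, hL₁⟩ := exists_isRealLift f K'.continuous_toFun
  have h0 : K' 0 = K 0 := h.eq_off 0 ⟨le_rfl, one_pos⟩ h.zero_not_mem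
  -- The lift of K' is shifted by a constant to agree with L at 0, which is outside J.
  have hL' : IsRealLift f K' (fun t => L₁ t - L₁ 0 + L 0) :=
    ⟨by have := hL₁.1; fun_prop, fun t => by
      rw [AddCircle.coe_add, AddCircle.coe_sub, hL₁.2, hL₁.2, hL.2, h0, sub_add_cancel]⟩
  classical
  let g : ℝ → ℝ := fun t => if t ∈ J then F (K' t) - F (K t) else 0
  have hg : Continuous g := by
    refine continuous_if (fun t ht => ?_) ?_ continuousOn_const
    · have htJ : t ∈ J := hJ.frontier_subset ht
      rw [h.apply_eq_of_mem_frontier ht htJ, sub_self]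
    · rw [show closure {t | t ∈ J} = J from hJ.closure_eq]
      exact (hF.comp K'.continuous_toFun.continuousOn h.symm.mapsTo).sub
        (hF.comp K.continuous_toFun.continuousOn h.mapsTo)
  have key : ∀ t ∈ Icc (0 : ℝ) 1, (L₁ t - L₁ 0 + L 0) - L t - g t = 0 := by
    intro t ht
    have := isPreconnected_Icc.eq_of_coe_addCircle_eq_zero
      (E := fun t => (L₁ t - L₁ 0 + L 0) - L t - g t)
      ((hL'.1.sub hL.1).sub hg).continuousOn (fun x hx => ?_) ht
      (left_mem_Icc.2 (zero_le_one' ℝ))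
    · rw [this]; simp [g, h.zero_not_mem]
    · rw [AddCircle.coe_sub, AddCircle.coe_sub, hL'.2, hL.2]
      by_cases hx' : x ∈ J
      · simp only [g, if_pos hx']
        rw [AddCircle.coe_sub, hFf _ (h.mapsTo hx'), hFf _ (h.symm.mapsTo hx'), sub_self]
      · simp only [g, if_neg hx']
        rw [h.apply_eq_of_mem_Icc hx hx']; simp
  refine ⟨L, _, hL, hL', fun t ht htJ => ?_, fun t htJ => ?_⟩
  · have := key t ht
    simp only [g, if_neg htJ] at this; linarith
  · have := key t (Ioo_subset_Icc_self (h.subset htJ))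
    simp only [g, if_pos htJ] at this; linarith

/-- The main tool for the moves. Along an arc in D the increment of a lift equals that of F, and at
a crossing F has one value for both arcs. Hence the degree at a crossing depends only on the pair of
arcs: the first implication compares a crossing of K' with a crossing of K on the same arcs, the
second compares two crossings of K'. Crossings outside D keep their degrees and dots, so the change
of the count is a sum over crossings inside D. -/
theorem splitCount_sub [T2Space X] (h : SameOff K K' D J) (hJ : IsClosed J)
    (hD : HasRealLiftOn f D) :
    ∃ L L', IsRealLift f K L ∧ IsRealLift f K' L' ∧ L' 1 - L' 0 = L 1 - L 0 ∧
      (∀ p q p₂ q₂, Icc p q ⊆ J → Icc p₂ q₂ ⊆ J → ∀ s ∈ Icc p q, ∀ s' ∈ Icc p q,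
        ∀ t ∈ Icc p₂ q₂, ∀ t' ∈ Icc p₂ q₂, K' s' = K' t' →
        (K s = K t → L' t' - L' s' = L t - L s) ∧ (K' s = K' t → L' t' - L' s' = L' t - L' s)) ∧
      splitCount f K' - splitCount f K =
        ∑ᶠ p ∈ K'.crossingsIn J, K'.splitTerm L' p - ∑ᶠ p ∈ K.crossingsIn J, K.splitTerm L p := by
  obtain ⟨F, hF, hFf⟩ := hD
  obtain ⟨L, L', hL, hL', hoff, hon⟩ := h.exists_lifts hJ hF hFf
  have h01 : L' 1 - L' 0 = L 1 - L 0 := by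
    rw [hoff 0 (by simp) h.zero_not_mem, hoff 1 (by simp) fun h1 => (h.subset h1).2.ne rfl]
  refine ⟨L, L', hL, hL', h01, ?_, ?_⟩
  · intro p q p₂ q₂ hpq hpq₂ s hs s' hs' t ht t' ht' hK'
    have a1 := hL'.sub_eq_of_mapsTo K'.continuous_toFun hF hFf (h.symm.mapsTo.mono_left hpq) hs hs'
    have a2 := hL'.sub_eq_of_mapsTo K'.continuous_toFun hF hFf (h.symm.mapsTo.mono_left hpq₂) ht ht'
    rw [hK'] at a1
    refine ⟨fun hK => ?_, fun hK => ?_⟩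
    · have b1 := hon s (hpq hs)
      have b2 := hon t (hpq₂ ht)
      rw [hK] at b1
      linarith
    · rw [hK] at a1
      linarith
  · have e : ∀ (K : Knot X) (L : ℝ → ℝ), IsRealLift f K L → splitCount f K =
        ∑ᶠ p ∈ K.crossingsIn J, K.splitTerm L p +
          ∑ᶠ p ∈ K.crossings \ K.crossingsIn J, K.splitTerm L p := fun K L hL => by
      rw [splitCount_eq hL, finsum_mem_add_sdiff (fun p hp => hp.1) K.crossings_finite]
    rw [e K L hL, e K' L' hL', h.crossings_diff_eq]
    have : ∑ᶠ p ∈ K.crossings \ K.crossingsIn J, K'.splitTerm L' p =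
        ∑ᶠ p ∈ K.crossings \ K.crossingsIn J, K.splitTerm L p := by
      refine finsum_mem_congr rfl fun p hp => ?_
      obtain ⟨h1, h2⟩ := h.not_mem_of_mem_crossings_diff hp
      have m1 : p.1 ∈ Ico (0 : ℝ) 1 := ⟨hp.1.1, hp.1.2.1.trans hp.1.2.2.1⟩
      have m2 : p.2 ∈ Ico (0 : ℝ) 1 := ⟨hp.1.1.trans hp.1.2.1.le, hp.1.2.2.1⟩
      refine splitTerm_eq_of_sub_eq hL hL' h01 ?_ ?_
      · rw [dotsAt, dotsAt, h.eq_off _ m1 h1, h.dots_off _ fun hD => h1 ((h.mem_iff _ m1).1 hD)]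
      · rw [hoff _ (Ico_subset_Icc_self m1) h1, hoff _ (Ico_subset_Icc_self m2) h2]
    rw [this]; ring

theorem splitCount_eq_of_crossingsIn_eq_empty [T2Space X] (h : SameOff K K' D J)
    (hJ : IsClosed J) (hD : HasRealLiftOn f D) (hK : K.crossingsIn J = ∅)
    (hK' : K'.crossingsIn J = ∅) : splitCount f K' = splitCount f K := by
  obtain ⟨L, L', -, -, -, -, e⟩ := h.splitCount_sub hJ hD
  rw [hK, hK', finsum_mem_empty, finsum_mem_empty, sub_zero] at e
  exact sub_eq_zero.1 e

end SameOff

/-! ### Invariance of the count under each move -/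

theorem IsInteriorDisc.hasRealLiftOn {D : Set X} (h : IsInteriorDisc D) : HasRealLiftOn f D := by
  obtain ⟨φ, hφ, rfl⟩ := h
  exact hasRealLiftOn_of_isEmbedding f hφ.isEmbedding (image_subset_range _ _)

theorem IsRidgeRegion.hasRealLiftOn {m : ℕ} {D R : Set X} (h : IsRidgeRegion m D R) :
    HasRealLiftOn f D := by
  obtain ⟨n, -, φ, hφ, S, -, rfl, -⟩ := h
  exact hasRealLiftOn_of_isEmbedding f hφ.isEmbedding (image_subset_range _ _)

variable {K K' : Knot X}

theorem OrientedIsotopic.isotopic (h : OrientedIsotopic K K') : Isotopic K K' :=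
  Relation.EqvGen.mono (fun _ _ => Or.inl) _ _ h

variable [T2Space X]

/-- The loop cut off at the new crossing stays in the disc, so it has degree 0 and the product of
the degrees cannot be 1. -/
theorem MoveM1.splitCount_eq (h : MoveM1 K K') : splitCount f K' = splitCount f K := by
  obtain ⟨D, hD, p, q, hpq, hS, hK, c, hc⟩ := h
  obtain ⟨L, L', hL, hL', h01, hw, e⟩ := hS.splitCount_sub isClosed_Icc (hD.hasRealLiftOn (f := f))
  have hcm : c ∈ K'.crossingsIn (Icc p q) := by rw [hc]; rfl
  have hp : p ∈ Icc p q := left_mem_Icc.2 hpq.le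
  -- The new crossing is compared with the trivial coincidence K p = K p, whose increment is 0.
  have := (hw p q p q subset_rfl subset_rfl p hp c.1 hcm.2.1 p hp c.2 hcm.2.2
    hcm.1.2.2.2).1 rfl
  rw [hK, hc, finsum_mem_empty, finsum_mem_singleton, sub_zero, splitTerm, if_neg] at e
  · exact sub_eq_zero.1 e
  · rw [this]; simp

/-- The two new crossings lie on the same pair of arcs, so they have the same degrees. Their dots
are of different types, so their signs cancel. -/
theorem MoveM2.splitCount_eq (h : MoveM2 K K') : splitCount f K' = splitCount f K := by
  obtain ⟨D, hD, p₁, q₁, p₂, q₂, h1, h12, h2, hS, hK, s₁, hs₁, s₂, hs₂, t₁, ht₁, t₂, ht₂, hne, hc,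
    hd⟩ := h
  obtain ⟨L, L', hL, hL', h01, hw, e⟩ := hS.splitCount_sub (isClosed_Icc.union isClosed_Icc)
    (hD.hasRealLiftOn (f := f))
  have m1 : (s₁, t₁) ∈ K'.crossingsIn (Icc p₁ q₁ ∪ Icc p₂ q₂) := by rw [hc]; simp
  have m2 : (s₂, t₂) ∈ K'.crossingsIn (Icc p₁ q₁ ∪ Icc p₂ q₂) := by rw [hc]; simp
  have hsub := (hw p₁ q₁ p₂ q₂ subset_union_left subset_union_right s₂ hs₂ s₁ hs₁ t₂ ht₂ t₁ ht₁
    m1.1.2.2.2).2 m2.1.2.2.2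
  rw [hK, hc, finsum_mem_empty, sub_zero,
    finsum_mem_pair (fun h => hne (congrArg Prod.fst h))] at e
  refine sub_eq_zero.1 (e.trans ?_)
  have a1 := hL'.add_one_sub K'.periodic 0 s₁
  have a2 := hL'.add_one_sub K'.periodic 0 s₂
  have hsub' : L' (s₁ + 1) - L' t₁ = L' (s₂ + 1) - L' t₂ := by linarith
  simp only [splitTerm, hsub, hsub', sign]
  split_ifs
  · revert hd
    cases K'.dotsAt (s₁, t₁) <;> cases K'.dotsAt (s₂, t₂) <;> simp
  · rfl

/-- The crossing of the arcs i and j before the move corresponds to the crossing of the same arcs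
after it, with the same degrees and the same dots. -/
theorem MoveM3.splitCount_eq (h : MoveM3 K K') : splitCount f K' = splitCount f K := by
  obtain ⟨D, hD, p, q, hpq, h01, h12, hS, a, b, hab, hK, hK', -, hd, -⟩ := h
  obtain ⟨L, L', hL, hL', h1, hw, e⟩ := hS.splitCount_sub
    (isClosed_iUnion_of_finite fun i => isClosed_Icc) (hD.hasRealLiftOn (f := f))
  -- The arcs occupy disjoint parameter intervals, so the three listed pairs are distinct and the
  -- sum has exactly three terms.
  have dis : ∀ c : Fin 3 → Fin 3 → ℝ, (∀ i j, i ≠ j → c i j ∈ Icc (p i) (q i)) → ∀ g : ℝ × ℝ → ℤ,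
      ∑ᶠ x ∈ ({(c 0 1, c 1 0), (c 0 2, c 2 0), (c 1 2, c 2 1)} : Set (ℝ × ℝ)), g x =
        g (c 0 1, c 1 0) + (g (c 0 2, c 2 0) + g (c 1 2, c 2 1)) := by
    intro c hc g
    have i01 := hc 0 1 (by decide)
    have i02 := hc 0 2 (by decide)
    have i10 := hc 1 0 (by decide)
    have i12 := hc 1 2 (by decide)
    have i20 := hc 2 0 (by decide)
    rw [finsum_mem_insert _ _ (toFinite _), finsum_mem_pair]
    · intro h
      have := congrArg Prod.fst h
      simp only at this
      linarith [i02.2, i12.1]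
    · rintro (h | h)
      · have := congrArg Prod.snd h
        simp only at this
        linarith [i10.2, i20.1]
      · have := congrArg Prod.fst h
        simp only at this
        linarith [i01.2, i12.1]
  rw [hK, hK', dis a fun i j hij => (hab i j hij).1, dis b fun i j hij => (hab i j hij).2] at e
  have key : ∀ i j, i < j → (a i j, a j i) ∈ K.crossings → (b i j, b j i) ∈ K'.crossings →
      K'.splitTerm L' (b i j, b j i) = K.splitTerm L (a i j, a j i) := by
    intro i j hij hca hcb
    refine splitTerm_eq_of_sub_eq hL hL' h1 (hd i j hij) ?_
    exact (hw (p i) (q i) (p j) (q j) (subset_iUnion (fun i => Icc (p i) (q i)) i)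
      (subset_iUnion (fun i => Icc (p i) (q i)) j) _ (hab i j hij.ne).1 _ (hab i j hij.ne).2
      _ (hab j i hij.ne').1 _ (hab j i hij.ne').2 hcb.2.2.2).1 hca.2.2.2
  have ma : ∀ x ∈ ({(a 0 1, a 1 0), (a 0 2, a 2 0), (a 1 2, a 2 1)} : Set (ℝ × ℝ)),
      x ∈ K.crossings := fun x hx => by rw [← hK] at hx; exact hx.1
  have mb : ∀ x ∈ ({(b 0 1, b 1 0), (b 0 2, b 2 0), (b 1 2, b 2 1)} : Set (ℝ × ℝ)),
      x ∈ K'.crossings := fun x hx => by rw [← hK'] at hx; exact hx.1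
  rw [key 0 1 (by decide) (ma _ (by simp)) (mb _ (by simp)),
    key 0 2 (by decide) (ma _ (by simp)) (mb _ (by simp)),
    key 1 2 (by decide) (ma _ (by simp)) (mb _ (by simp)), sub_self] at e
  exact sub_eq_zero.1 e

theorem MoveM4.splitCount_eq (h : MoveM4 K K') : splitCount f K' = splitCount f K := by
  obtain ⟨D, R, hD, p, q, -, hS, hK, hK', -⟩ := h
  exact hS.splitCount_eq_of_crossingsIn_eq_empty isClosed_Icc hD.hasRealLiftOn hK hK'

theorem MoveM5.splitCount_eq (h : MoveM5 K K') : splitCount f K' = splitCount f K := by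
  obtain ⟨n, -, φ, hφ, i, j, -, p₁, q₁, p₂, q₂, h1, h12, h2, hS, -, -, -, -, -, s, hs, t, ht, s', hs',
    t', ht', hK, hK', -, -, hd⟩ := h
  obtain ⟨L, L', hL, hL', h01, hw, e⟩ := hS.splitCount_sub (isClosed_Icc.union isClosed_Icc)
    (hasRealLiftOn_of_isEmbedding f hφ.isEmbedding (image_subset_range _ _))
  have m : (s, t) ∈ K.crossingsIn (Icc p₁ q₁ ∪ Icc p₂ q₂) := by rw [hK]; rfl
  have m' : (s', t') ∈ K'.crossingsIn (Icc p₁ q₁ ∪ Icc p₂ q₂) := by rw [hK']; rfl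
  rw [hK, hK', finsum_mem_singleton, finsum_mem_singleton, splitTerm_eq_of_sub_eq hL hL' h01 hd
    ((hw p₁ q₁ p₂ q₂ subset_union_left subset_union_right s hs s' hs' t ht t' ht'
      m'.1.2.2.2).1 m.1.2.2.2), sub_self] at e
  exact sub_eq_zero.1 e

theorem MoveM6.splitCount_eq (h : MoveM6 K K') : splitCount f K' = splitCount f K := by
  obtain ⟨D, R, hD, p, q, -, hS, hK, hK', -⟩ := h
  exact hS.splitCount_eq_of_crossingsIn_eq_empty isClosed_Icc hD.hasRealLiftOn hK hK'

theorem MoveM7.splitCount_eq (h : MoveM7 K K') : splitCount f K' = splitCount f K := by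
  obtain ⟨x, -, G, ψ, s, hψ, -, -, -, -, p, q, -, hS, hK, hK', -⟩ := h
  -- A cone is contractible only over a nonempty base; a point of the circle s provides a point of
  -- the graph.
  have : Nonempty G.Space := ⟨s 0⟩
  refine hS.splitCount_eq_of_crossingsIn_eq_empty isClosed_Icc
    (hasRealLiftOn_of_isEmbedding f hψ ?_) hK hK'
  rintro _ ⟨z, r, rfl⟩
  exact ⟨_, rfl⟩

theorem IsotopyStep.splitCount_eq (h : IsotopyStep K K') : splitCount f K' = splitCount f K := by
  rcases h with h | h | h | h | h | h | h | h | h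
  exacts [h.splitCount_eq, h.splitCount_eq, h.splitCount_eq, h.splitCount_eq, h.splitCount_eq,
    h.splitCount_eq, h.splitCount_eq, h.splitCount_eq, h.splitCount_eq]

theorem Isotopic.splitCount_eq (h : Isotopic K K') : splitCount f K' = splitCount f K := by
  induction h with
  | rel K K' h => exact h.elim (fun h => h.splitCount_eq) (fun h => h.splitCount_eq)
  | refl K => rfl
  | symm K K' _ ih => exact ih.symm
  | trans K K' K'' _ _ ih ih' => exact ih'.trans ih

end Moves

end Knot

/-! ### The space of the graph `θ₃` -/

namespace Theta

/-- The point of the edge `e` with parameter `x`. -/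
def edgeParam (e : Fin 3) (x : I) : (theta 3).Space := (theta 3).edgePt e x

/-- The map on `θ₃` given by its values on the three edges. -/
def lift {Z : Type*} (g : Fin 3 → I → Z) (h0 : ∀ e e', g e 0 = g e' 0)
    (h1 : ∀ e e', g e 1 = g e' 1) : (theta 3).Space → Z :=
  Quot.lift (Sum.elim (fun v : Fin 2 => if v = 0 then g 0 0 else g 0 1)
    (fun p : Fin 3 × I => g p.1 p.2)) (fun a b h => by
      cases h with
      | src e => exact h0 e 0
      | tgt e => exact h1 e 0)

section lift

variable {Z : Type*} {g : Fin 3 → I → Z} {h0 : ∀ e e', g e 0 = g e' 0}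
  {h1 : ∀ e e', g e 1 = g e' 1}

theorem continuous_lift [TopologicalSpace Z] (hg : ∀ e, Continuous (g e)) :
    Continuous (lift g h0 h1) := by
  have h : Continuous fun p : Fin 3 × I => g p.1 p.2 := continuous_prod_of_discrete_left.2 hg
  have h' : Continuous fun v : Fin 2 => if v = 0 then g 0 0 else g 0 1 :=
    continuous_of_discreteTopology
  exact continuous_quot_lift _ (continuous_sumElim.2 ⟨h', h⟩)

end lift

theorem edgeParam_zero (e : Fin 3) : edgeParam e 0 = (theta 3).vertex (0 : Fin 2) :=
  Quot.sound (FinGraph.Glue.src (G := theta 3) e)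

theorem edgeParam_one (e : Fin 3) : edgeParam e 1 = (theta 3).vertex (1 : Fin 2) :=
  Quot.sound (FinGraph.Glue.tgt (G := theta 3) e)

theorem continuous_edgeParam (e : Fin 3) : Continuous (edgeParam e) :=
  continuous_quot_mk.comp (by fun_prop)

theorem exists_eq_edgeParam (p : (theta 3).Space) : ∃ (e : Fin 3) (x : I), p = edgeParam e x := by
  obtain ⟨v | ⟨e, x⟩, rfl⟩ := Quot.exists_rep p
  · obtain rfl | rfl : v = (0 : Fin 2) ∨ v = (1 : Fin 2) :=
      (by decide : ∀ v : Fin 2, v = 0 ∨ v = 1) v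
    · exact ⟨0, 0, (edgeParam_zero 0).symm⟩
    · exact ⟨0, 1, (edgeParam_one 0).symm⟩
  · exact ⟨e, x, rfl⟩

/-- The parameter of a point on an edge. -/
def coord : (theta 3).Space → I := lift (fun _ x => x) (fun _ _ => rfl) (fun _ _ => rfl)

@[simp] theorem coord_edgeParam (e : Fin 3) (x : I) : coord (edgeParam e x) = x := rfl

theorem continuous_coord : Continuous coord := continuous_lift fun _ => continuous_id

/-- A function which is positive in the interior of the edge `e` and vanishes elsewhere. -/
def bump (e : Fin 3) : (theta 3).Space → ℝ :=
  lift (fun e' x => if e' = e then (x : ℝ) * (1 - x) else 0) (by simp) (by simp)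

theorem bump_edgeParam (e e' : Fin 3) (x : I) :
    bump e (edgeParam e' x) = if e' = e then (x : ℝ) * (1 - x) else 0 := (rfl)

theorem continuous_bump (e : Fin 3) : Continuous (bump e) :=
  continuous_lift fun e' => by
    by_cases h : e' = e
    · simp only [h, if_true]; fun_prop
    · simp only [h, if_false]; fun_prop

theorem bump_nonneg (e : Fin 3) (p : (theta 3).Space) : 0 ≤ bump e p := by
  obtain ⟨e', x, rfl⟩ := exists_eq_edgeParam p
  rw [bump_edgeParam]
  split_ifs
  · exact mul_nonneg x.2.1 (sub_nonneg.2 x.2.2)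
  · exact le_rfl

theorem eq_edgeParam_of_bump_pos {e : Fin 3} {p : (theta 3).Space} (h : 0 < bump e p) :
    p = edgeParam e (coord p) := by
  obtain ⟨e', x, rfl⟩ := exists_eq_edgeParam p
  rw [bump_edgeParam] at h
  split_ifs at h with he
  · rw [he, coord_edgeParam]
  · exact absurd h (lt_irrefl _)

theorem bump_edgeParam_pos (e : Fin 3) {x : I} (h0 : 0 < x) (h1 : x < 1) :
    0 < bump e (edgeParam e x) := by
  rw [bump_edgeParam, if_pos rfl]
  exact mul_pos h0 (sub_pos.2 h1)

theorem coord_of_bump_pos {e : Fin 3} {p : (theta 3).Space} (h : 0 < bump e p) :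
    0 < coord p ∧ coord p < 1 := by
  obtain ⟨e', x, rfl⟩ := exists_eq_edgeParam p
  rw [bump_edgeParam] at h
  split_ifs at h
  · rw [coord_edgeParam]
    constructor
    · refine unitInterval.pos_iff_ne_zero.2 fun h0 => ?_
      simp [h0] at h
    · refine unitInterval.lt_one_iff_ne_one.2 fun h0 => ?_
      simp [h0] at h
  · exact absurd h (lt_irrefl _)

/-- Inside an edge the positive bump identifies the edge; at a vertex the coordinate alone
determines the point. These four functions embed θ₃ injectively in a Hausdorff space. -/
theorem eq_of_coord_eq_of_bump_eq {p q : (theta 3).Space} (hc : coord p = coord q)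
    (hb : ∀ e, bump e p = bump e q) : p = q := by
  obtain ⟨e, x, rfl⟩ := exists_eq_edgeParam p
  obtain ⟨e', x', rfl⟩ := exists_eq_edgeParam q
  obtain rfl : x = x' := hc
  rcases eq_or_ne x 0 with rfl | h0
  · rw [edgeParam_zero, edgeParam_zero]
  rcases eq_or_ne x 1 with rfl | h1
  · rw [edgeParam_one, edgeParam_one]
  have := bump_edgeParam_pos e (unitInterval.pos_iff_ne_zero.2 h0)
    (unitInterval.lt_one_iff_ne_one.2 h1)
  rw [hb] at this
  exact (eq_edgeParam_of_bump_pos this).symm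

instance : T2Space (theta 3).Space :=
  T2Space.of_injective_continuous (f := fun p => (coord p, fun e => bump e p))
    (fun _ _ h => eq_of_coord_eq_of_bump_eq (congrArg Prod.fst h)
      fun e => congrFun (congrArg Prod.snd h) e)
    (continuous_coord.prodMk (continuous_pi continuous_bump))

theorem isClosedEmbedding_edgeParam (e : Fin 3) : IsClosedEmbedding (edgeParam e) :=
  (continuous_edgeParam e).isClosedEmbedding fun _ _ h => congrArg coord h

theorem edgeParam_eq_edgeParam_iff {e e' : Fin 3} {x x' : I} :
    edgeParam e x = edgeParam e' x' ↔ x = x' ∧ (e = e' ∨ x = 0 ∨ x = 1) := by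
  constructor
  · intro h
    obtain rfl : x = x' := congrArg coord h
    refine ⟨rfl, ?_⟩
    by_contra! hne
    have := bump_edgeParam_pos e (unitInterval.pos_iff_ne_zero.2 hne.2.1)
      (unitInterval.lt_one_iff_ne_one.2 hne.2.2)
    rw [h, bump_edgeParam, if_neg (Ne.symm hne.1)] at this
    exact lt_irrefl _ this
  · rintro ⟨rfl, rfl | rfl | rfl⟩
    · rfl
    · rw [edgeParam_zero, edgeParam_zero]
    · rw [edgeParam_one, edgeParam_one]

/-! ### Charts of `θ₃` -/

/-- The parametrization of the interior of an edge by the real line. -/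
def edgeChart (e : Fin 3) (s : ℝ) : (theta 3).Space :=
  edgeParam e (unitInterval.sigmoid s)

theorem coe_sigmoid (s : ℝ) : (unitInterval.sigmoid s : ℝ) = Real.sigmoid s := rfl

/-- The logit inverts the sigmoid. Composed with `coord`, it is the inverse of `edgeChart` on the
open set where the bump of the edge is positive. -/
theorem log_sigmoid_div (s : ℝ) :
    Real.log (Real.sigmoid s / (1 - Real.sigmoid s)) = s := by
  rw [← Real.sigmoid_neg, ← Real.sigmoid_mul_rexp_neg, ← div_div,
    div_self (Real.sigmoid_pos s).ne', one_div, Real.log_inv, Real.log_exp, neg_neg]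

theorem isOpenEmbedding_edgeChart (e : Fin 3) : IsOpenEmbedding (edgeChart e) := by
  have hcont : Continuous (edgeChart e) :=
    (continuous_edgeParam e).comp unitInterval.continuous_sigmoid
  let ψ : OpenPartialHomeomorph ℝ (theta 3).Space :=
    { toFun := edgeChart e
      invFun := fun p => Real.log ((coord p : ℝ) / (1 - coord p))
      source := univ
      target := {p | 0 < bump e p}
      map_source' := fun s _ => bump_edgeParam_pos e (unitInterval.sigmoid_pos s)
        (unitInterval.sigmoid_lt_one s)
      map_target' := fun _ _ => mem_univ _
      left_inv' := fun s _ => log_sigmoid_div s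
      right_inv' := fun p hp => by
        obtain ⟨s, hs⟩ : coord p ∈ range unitInterval.sigmoid := by
          rw [unitInterval.range_sigmoid]; exact coord_of_bump_pos hp
        rw [← hs, coe_sigmoid, log_sigmoid_div, edgeChart, hs, ← eq_edgeParam_of_bump_pos hp]
      open_source := isOpen_univ
      open_target := isOpen_lt continuous_const (continuous_bump e)
      continuousOn_toFun := hcont.continuousOn
      continuousOn_invFun := by
        have hc : Continuous fun p => (coord p : ℝ) :=
          continuous_subtype_val.comp continuous_coord
        have h1 : ∀ p ∈ {p | 0 < bump e p}, (1 - coord p : ℝ) ≠ 0 := fun p hp =>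
          (sub_pos.2 (show (coord p : ℝ) < 1 from (coord_of_bump_pos hp).2)).ne'
        refine ContinuousOn.log (hc.continuousOn.div (continuous_const.sub hc).continuousOn h1) fun p hp => ?_
        exact div_ne_zero (show (0 : ℝ) < coord p from (coord_of_bump_pos hp).1).ne' (h1 p hp) }
  exact ψ.isOpenEmbedding rfl

/-- The union of three half-lines with a common end point. -/
def Tripod : Type := {w : Fin 3 → ℝ // (∀ i, 0 ≤ w i) ∧ ∀ i j, i ≠ j → w i = 0 ∨ w j = 0}

instance : TopologicalSpace Tripod := inferInstanceAs (TopologicalSpace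
  {w : Fin 3 → ℝ // (∀ i, 0 ≤ w i) ∧ ∀ i j, i ≠ j → w i = 0 ∨ w j = 0})

namespace Tripod

/-- The point of the tripod with the given coordinates. -/
def mk (w : Fin 3 → ℝ) (h : ∀ i, 0 ≤ w i) (h' : ∀ i j, i ≠ j → w i = 0 ∨ w j = 0) : Tripod :=
  ⟨w, h, h'⟩

theorem exists_leg (w : Tripod) : ∃ i, ∀ j, j ≠ i → w.1 j = 0 := by
  by_cases h : ∃ i, w.1 i ≠ 0
  · obtain ⟨i, hi⟩ := h
    exact ⟨i, fun j hj => (w.2.2 j i hj).resolve_right hi⟩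
  · push Not at h
    exact ⟨0, fun j _ => h j⟩

theorem continuous_coe (i : Fin 3) : Continuous fun w : Tripod => w.1 i :=
  (continuous_apply i).comp continuous_subtype_val

instance : ContractibleSpace Tripod := by
  let H : I × Tripod → Tripod := fun q => ⟨fun i => (q.1 : ℝ) * q.2.1 i,
    fun i => mul_nonneg q.1.2.1 (q.2.2.1 i), fun i j hij => by
      rcases q.2.2.2 i j hij with h | h
      · left; simp [h]
      · right; simp [h]⟩
  have hH : Continuous H := by
    refine Continuous.subtype_mk (continuous_pi fun i => ?_) _
    exact (continuous_subtype_val.comp continuous_fst).mul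
        ((continuous_coe i).comp continuous_snd)
  refine contractibleSpace_of_contraction ⟨0, fun _ => le_rfl, fun _ _ _ => Or.inl rfl⟩ ⟨H, hH⟩
    (fun y => ?_) (fun y => ?_)
  · apply Subtype.ext
    change (fun i => ((0 : I) : ℝ) * y.1 i) = 0
    simp; rfl
  · apply Subtype.ext
    change (fun i => ((1 : I) : ℝ) * y.1 i) = y.1
    simp

end Tripod

/-- The identity or the reversal of the unit interval. -/
def flip (b : Bool) (x : I) : I := if b then unitInterval.symm x else x

theorem continuous_flip (b : Bool) : Continuous (flip b) := by
  cases b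
  · exact continuous_id
  · exact unitInterval.continuous_symm

@[simp] theorem flip_flip (b : Bool) (x : I) : flip b (flip b x) = x := by
  cases b <;> simp [flip]

theorem flip_mul_one_sub (b : Bool) (x : I) :
    (flip b x : ℝ) * (1 - flip b x) = (x : ℝ) * (1 - x) := by
  cases b
  · rfl
  · simp [flip]; ring

theorem edgeParam_flip_zero (b : Bool) (e e' : Fin 3) :
    edgeParam e (flip b 0) = edgeParam e' (flip b 0) := by
  cases b
  · exact (edgeParam_zero e).trans (edgeParam_zero e').symm
  · simp only [flip, unitInterval.symm_zero, if_true]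
    exact (edgeParam_one e).trans (edgeParam_one e').symm

/-- The homeomorphism `w ↦ w / (1 + w)` from the half-line to the half-open interval. -/
def squash (s : ℝ) : I := projIcc 0 1 zero_le_one (s / (1 + s))

theorem coe_squash {s : ℝ} (hs : 0 ≤ s) : (squash s : ℝ) = s / (1 + s) := by
  have h : s / (1 + s) ∈ Icc (0 : ℝ) 1 :=
    ⟨by positivity, (div_le_one (by positivity)).2 (by linarith)⟩
  rw [squash, projIcc_of_mem _ h]

theorem squash_zero : squash 0 = 0 := Subtype.ext (by rw [coe_squash le_rfl]; simp)

theorem squash_lt_one {s : ℝ} (hs : 0 ≤ s) : squash s < 1 := by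
  change (squash s : ℝ) < 1
  rw [coe_squash hs, div_lt_one (by positivity)]; linarith

/-- The star of the vertex `a` (or of the vertex `b`, if `b = true`) parametrized by the tripod. -/
def starChart (b : Bool) (w : Tripod) : (theta 3).Space :=
  open Classical in edgeParam (if w.1 0 ≠ 0 then 0 else if w.1 1 ≠ 0 then 1 else 2)
    (flip b (squash (∑ i, w.1 i)))

/-- The edge is read off from the nonzero coordinate of w. The default choice of an edge when w = 0
is harmless, because there the three edges meet in the vertex. -/
theorem starChart_eq {b : Bool} {w : Tripod} {i : Fin 3} (h : ∀ j, j ≠ i → w.1 j = 0) :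
    starChart b w = edgeParam i (flip b (squash (w.1 i))) := by
  have hs : ∑ j, w.1 j = w.1 i := Finset.sum_eq_single i (fun j _ hj => h j hj) (by simp)
  rw [starChart, hs]
  by_cases hi : w.1 i = 0
  · rw [hi, squash_zero]; exact edgeParam_flip_zero b _ _
  · congr 1
    fin_cases i
    · simp at hi; simp [hi]
    · simp at hi; simp [hi, h 0]
    · simp [h 0, h 1]

/-- The three closed legs cover the tripod, and on each of them the chart is given by one continuous
formula. -/
theorem continuous_starChart (b : Bool) : Continuous (starChart b) := by
  refine LocallyFinite.continuous (f := fun i : Fin 3 => {w : Tripod | ∀ j, j ≠ i → w.1 j = 0})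
    (locallyFinite_of_finite _) ?_ (fun i => ?_) (fun i => ?_)
  · exact eq_univ_of_forall fun w => mem_iUnion.2 w.exists_leg
  · simp only [ofPred_forall]
    exact isClosed_iInter fun j => isClosed_iInter fun _ =>
      isClosed_eq (Tripod.continuous_coe j) continuous_const
  · refine ContinuousOn.congr (f := fun w : Tripod => edgeParam i (flip b (squash (w.1 i))))
      (Continuous.continuousOn ?_) fun w hw => starChart_eq hw
    refine (continuous_edgeParam i).comp ((continuous_flip b).comp (continuous_projIcc.comp ?_))
    exact (Tripod.continuous_coe i).div (continuous_const.add (Tripod.continuous_coe i))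
      fun w => by have := w.2.1 i; positivity

theorem coord_starChart (b : Bool) (w : Tripod) :
    coord (starChart b w) = flip b (squash (∑ i, w.1 i)) := rfl

/-- The inverse of `Theta.starChart`. -/
def starCoord (b : Bool) (p : (theta 3).Space) : Tripod :=
  -- With y = `flip b (coord p)`, the bump of the edge through p is y(1 − y). Division by (1 − y)²
  -- gives y/(1 − y), the inverse of s ↦ s/(1 + s), as a quotient of functions that are continuous
  -- on all of θ₃.
  Tripod.mk (fun e => bump e p / (1 - flip b (coord p)) ^ 2)
    (fun e => div_nonneg (bump_nonneg e p) (sq_nonneg _)) fun i j hij => by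
      obtain ⟨e, x, rfl⟩ := exists_eq_edgeParam p
      rcases eq_or_ne e i with rfl | he
      · right; rw [bump_edgeParam, if_neg hij, zero_div]
      · left; rw [bump_edgeParam, if_neg he, zero_div]

theorem starCoord_apply (b : Bool) (p : (theta 3).Space) (e : Fin 3) :
    (starCoord b p).1 e = bump e p / (1 - flip b (coord p)) ^ 2 := (rfl)

theorem starChart_starCoord {b : Bool} {p : (theta 3).Space} (hp : flip b (coord p) < 1) :
    starChart b (starCoord b p) = p := by
  obtain ⟨e, x, rfl⟩ := exists_eq_edgeParam p
  rw [starChart_eq (i := e) fun j hj => by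
    rw [starCoord_apply, bump_edgeParam, if_neg hj.symm, zero_div]]
  rw [coord_edgeParam] at hp
  congr 1
  have hp' : (flip b x : ℝ) < 1 := hp
  have h0 : (0 : ℝ) ≤ flip b x := (flip b x).2.1
  conv_rhs => rw [← flip_flip b x]
  congr 1
  apply Subtype.ext
  have h1 : (1 - flip b x : ℝ) ≠ 0 := by linarith
  rw [coe_squash ((starCoord b _).2.1 e), starCoord_apply, bump_edgeParam, if_pos rfl,
    coord_edgeParam, ← flip_mul_one_sub b x]
  field_simp
  ring

theorem starCoord_starChart (b : Bool) (w : Tripod) : starCoord b (starChart b w) = w := by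
  obtain ⟨i, hi⟩ := w.exists_leg
  apply Subtype.ext
  funext e
  rw [starCoord_apply, starChart_eq hi, coord_edgeParam, flip_flip, bump_edgeParam,
    flip_mul_one_sub]
  rcases eq_or_ne i e with rfl | he
  · have := w.2.1 i
    rw [if_pos rfl, coe_squash this]
    field_simp
    ring
  · rw [if_neg he, zero_div, hi e he.symm]

theorem flip_coord_starChart_lt_one (b : Bool) (w : Tripod) :
    flip b (coord (starChart b w)) < 1 := by
  rw [coord_starChart, flip_flip]
  exact squash_lt_one (Finset.sum_nonneg fun i _ => w.2.1 i)

theorem isOpenEmbedding_starChart (b : Bool) : IsOpenEmbedding (starChart b) := by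
  have hc : Continuous fun p => (flip b (coord p) : ℝ) :=
    continuous_subtype_val.comp ((continuous_flip b).comp continuous_coord)
  let ψ : OpenPartialHomeomorph Tripod (theta 3).Space :=
    { toFun := starChart b
      invFun := starCoord b
      source := univ
      target := {p | flip b (coord p) < 1}
      map_source' := fun w _ => flip_coord_starChart_lt_one b w
      map_target' := fun _ _ => mem_univ _
      left_inv' := fun w _ => starCoord_starChart b w
      right_inv' := fun p hp => starChart_starCoord hp
      open_source := isOpen_univ
      open_target := isOpen_lt ((continuous_flip b).comp continuous_coord) continuous_const
      continuousOn_toFun := (continuous_starChart b).continuousOn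
      continuousOn_invFun := by
        refine (IsInducing.continuousOn_iff (g := (Subtype.val : Tripod → Fin 3 → ℝ))
          IsInducing.subtypeVal).2 (continuousOn_pi.2 fun e => ?_)
        refine (continuous_bump e).continuousOn.div
          ((continuous_const.sub hc).pow 2).continuousOn fun p hp => ?_
        have hp' : (flip b (coord p) : ℝ) < 1 := hp
        have : (1 - flip b (coord p) : ℝ) ≠ 0 := by linarith
        positivity }
  exact ψ.isOpenEmbedding rfl

theorem range_starChart (b : Bool) : range (starChart b) = {p | flip b (coord p) < 1} := by
  ext p
  constructor
  · rintro ⟨w, rfl⟩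
    exact flip_coord_starChart_lt_one b w
  · exact fun hp => ⟨_, starChart_starCoord hp⟩

end Theta

/-! ### Homotopies of paths and loops -/

instance : ContractibleSpace I :=
  (convex_Icc (0 : ℝ) 1).contractibleSpace ⟨0, by simp⟩

section Homotopy

variable {X : Type*} [TopologicalSpace X]

/-- Both paths pull back along the embedding to the simply connected space Y, where they are
homotopic. Squares and stars are used below in this way. -/
theorem Path.homotopic_of_range_subset {Y : Type*} [TopologicalSpace Y] [SimplyConnectedSpace Y]
    {φ : Y → X} (hφ : IsEmbedding φ) {x y : X} (γ γ' : Path x y) (h : ∀ t, γ t ∈ range φ)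
    (h' : ∀ t, γ' t ∈ range φ) : γ.Homotopic γ' := by
  obtain ⟨x, rfl⟩ : x ∈ range φ := by simpa using h 0
  obtain ⟨y, rfl⟩ : y ∈ range φ := by simpa using h 1
  have key : ∀ γ : Path (φ x) (φ y), (∀ t, γ t ∈ range φ) →
      ∃ δ : Path x y, γ = δ.map hφ.continuous := by
    intro γ h
    have hs : ∀ z, hφ.toHomeomorph.symm z = z.2.choose := fun z => by
      rw [Homeomorph.symm_apply_eq]; exact Subtype.ext z.2.choose_spec.symm
    have hinv : ∀ z, φ (hφ.toHomeomorph.symm z) = z.1 := fun z => by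
      rw [hs]; exact z.2.choose_spec
    refine ⟨⟨⟨fun t => hφ.toHomeomorph.symm ⟨γ t, h t⟩, ?_⟩, ?_, ?_⟩, ?_⟩
    · exact hφ.toHomeomorph.symm.continuous.comp (γ.continuous.subtype_mk _)
    · exact hφ.injective (by rw [hinv]; exact γ.source)
    · exact hφ.injective (by rw [hinv]; exact γ.target)
    · ext t
      exact (hinv ⟨γ t, h t⟩).symm
  obtain ⟨δ, rfl⟩ := key γ h
  obtain ⟨δ', rfl⟩ := key γ' h'
  exact (SimplyConnectedSpace.paths_homotopic δ δ').map ⟨φ, hφ.continuous⟩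

/-- The three paths are images under g of affine paths in ℝ, and ℝ is simply connected. This cuts a
curve at a parameter without explicit reparametrizations. -/
theorem Path.homotopic_trans_of_real {g : ℝ → X} (hg : Continuous g) {x y z : X} {u v w : ℝ}
    (p : Path x y) (q : Path y z) (r : Path x z) (hp : ∀ t : I, p t = g (u + t * (v - u)))
    (hq : ∀ t : I, q t = g (v + t * (w - v))) (hr : ∀ t : I, r t = g (u + t * (w - u))) :
    r.Homotopic (p.trans q) := by
  have seg : ∀ a b : ℝ, ∃ γ : Path a b, ∀ t : I, γ t = a + t * (b - a) := fun a b =>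
    ⟨⟨⟨fun t => a + t * (b - a), by fun_prop⟩, by simp, by simp⟩, fun t => rfl⟩
  obtain ⟨P, hP⟩ := seg u v
  obtain ⟨Q, hQ⟩ := seg v w
  obtain ⟨R, hR⟩ := seg u w
  obtain rfl : g u = x := by simpa using (hp 0).symm
  obtain rfl : g v = y := by simpa using (hq 0).symm
  obtain rfl : g w = z := by simpa using (hr 1).symm
  obtain rfl : p = P.map hg := by ext t; simp [hp, hP]
  obtain rfl : q = Q.map hg := by ext t; simp [hq, hQ]
  obtain rfl : r = R.map hg := by ext t; simp [hr, hR]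
  rw [← Path.map_trans]
  exact (SimplyConnectedSpace.paths_homotopic R (P.trans Q)).map ⟨g, hg⟩

theorem loopToCircle_coe {x : X} (γ : Path x x) (t : I) :
    loopToCircle γ ((t : ℝ) : AddCircle (1 : ℝ)) = γ t := by
  change AddCircle.liftIco 1 0 γ.extend _ = _
  rcases t.2.2.lt_or_eq with h | h
  · rw [AddCircle.liftIco_zero_coe_apply ⟨t.2.1, h⟩, Path.extend_apply _ t.2]
  · have : ((t : ℝ) : AddCircle (1 : ℝ)) = ((0 : ℝ) : AddCircle (1 : ℝ)) := by
      rw [h, AddCircle.coe_period]; rfl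
    rw [this, AddCircle.liftIco_zero_coe_apply ⟨le_rfl, one_pos⟩, Path.extend_zero,
      show t = 1 from Subtype.ext h, γ.target]

theorem exists_unitInterval_coe_eq (z : AddCircle (1 : ℝ)) :
    ∃ t : I, ((t : ℝ) : AddCircle (1 : ℝ)) = z ∧ (t : ℝ) < 1 := by
  have h := (AddCircle.equivIco (1 : ℝ) 0 z).2.2
  have h' : (AddCircle.equivIco (1 : ℝ) 0 z : ℝ) < 1 := by linarith
  exact ⟨⟨_, (AddCircle.equivIco (1 : ℝ) 0 z).2.1, h'.le⟩, AddCircle.coe_equivIco, h'⟩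

/-- A homotopy through closed paths is a closed path in the space C(I, X). In this form it descends
to the circle, and evaluation turns it into a homotopy of maps of the circle. -/
theorem freeClass_eq_of_homotopy {x y : X} {γ : Path x x} {γ' : Path y y} (G : C(I × I, X))
    (h0 : ∀ t, G (0, t) = γ t) (h1 : ∀ t, G (1, t) = γ' t) (hG : ∀ r, G (r, 0) = G (r, 1)) :
    freeClass γ = freeClass γ' := by
  have hpr : Continuous (projIcc (0 : ℝ) 1 zero_le_one) := continuous_projIcc
  let C : C(I, C(I, X)) := (G.comp ContinuousMap.prodSwap).curry
  let g : ℝ → C(I, X) := fun t => C (projIcc (0 : ℝ) 1 zero_le_one t)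
  have hg : Continuous g := C.continuous.comp hpr
  have hg01 : g 0 = g 1 := by
    ext r
    simpa [g, C] using hG r
  have hl : Continuous (AddCircle.liftIco 1 0 g) :=
    AddCircle.liftIco_zero_continuous hg01 hg.continuousOn
  have hval : ∀ (r t : I), (t : ℝ) < 1 → AddCircle.liftIco 1 0 g (t : ℝ) r = G (r, t) := by
    intro r t ht
    rw [AddCircle.liftIco_zero_coe_apply ⟨t.2.1, ht⟩]
    simp [g, C]
  refine Quotient.sound ⟨⟨⟨fun q => AddCircle.liftIco 1 0 g q.2 q.1, ?_⟩, fun z => ?_, fun z => ?_⟩⟩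
  · exact (hl.comp continuous_snd).eval continuous_fst
  · obtain ⟨t, rfl, ht⟩ := exists_unitInterval_coe_eq z
    exact (hval 0 t ht).trans ((h0 t).trans (loopToCircle_coe γ t).symm)
  · obtain ⟨t, rfl, ht⟩ := exists_unitInterval_coe_eq z
    exact (hval 1 t ht).trans ((h1 t).trans (loopToCircle_coe γ' t).symm)

theorem freeClass_congr {x y : X} {γ : Path x x} {γ' : Path y y} (h : ∀ t, γ t = γ' t) :
    freeClass γ = freeClass γ' :=
  freeClass_eq_of_homotopy ⟨fun q => γ q.2, by fun_prop⟩ (fun _ => rfl) h (by simp)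

theorem Path.Homotopic.freeClass_eq {x : X} {γ γ' : Path x x} (h : γ.Homotopic γ') :
    freeClass γ = freeClass γ' := by
  obtain ⟨H⟩ := h
  exact freeClass_eq_of_homotopy H.toContinuousMap (by simp) (by simp) (by simp)

/-- Rotating the circle through half a turn exchanges the two halves of the loop; the angle r/2,
with r from 0 to 1, is the homotopy. -/
theorem freeClass_trans_comm {x y : X} (α : Path x y) (β : Path y x) :
    freeClass (α.trans β) = freeClass (β.trans α) := by
  have hc : Continuous fun r : I => (((r : ℝ) / 2 : ℝ) : AddCircle (1 : ℝ)) :=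
    (AddCircle.continuous_mk' 1).comp (by fun_prop)
  refine Quotient.sound ⟨⟨⟨fun q => loopToCircle (α.trans β) (q.2 + (((q.1 : ℝ) / 2 : ℝ))), ?_⟩,
    fun z => by simp, fun z => ?_⟩⟩
  · exact (loopToCircle (α.trans β)).continuous.comp
      (continuous_snd.add (hc.comp continuous_fst))
  · obtain ⟨t, rfl, ht⟩ := exists_unitInterval_coe_eq z
    change loopToCircle (α.trans β) _ = _
    rw [loopToCircle_coe, ← AddCircle.coe_add, Path.trans_apply]
    split_ifs with h
    · have ht' : (t : ℝ) + 1 / 2 ∈ Icc (0 : ℝ) 1 := ⟨by linarith [t.2.1], by linarith⟩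
      have e := loopToCircle_coe (α.trans β) ⟨_, ht'⟩
      have e1 : (((t : ℝ) + ((1 : I) : ℝ) / 2 : ℝ) : AddCircle (1 : ℝ)) =
          (((t : ℝ) + 1 / 2 : ℝ) : AddCircle (1 : ℝ)) := by rw [Icc.coe_one]
      rw [e1, e, Path.trans_apply]
      split_ifs with h2
      -- Both parameters lie in the first half only for t = 0; then both sides are the junction
      -- point y.
      · have h3 : (t : ℝ) = 0 := by
          have : (t : ℝ) + 1 / 2 ≤ 1 / 2 := h2
          linarith [t.2.1]
        simp [h3]
      · congr 1; apply Subtype.ext; simp; ring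
    · push Not at h
      have ht' : (t : ℝ) - 1 / 2 ∈ Icc (0 : ℝ) 1 := ⟨by linarith, by linarith [t.2.2]⟩
      have e := loopToCircle_coe (α.trans β) ⟨_, ht'⟩
      have e2 : (((t : ℝ) + ((1 : I) : ℝ) / 2 : ℝ) : AddCircle (1 : ℝ)) =
          (((t : ℝ) - 1 / 2 : ℝ) : AddCircle (1 : ℝ)) := by
        rw [show (t : ℝ) + ((1 : I) : ℝ) / 2 = ((t : ℝ) - 1 / 2) + 1 by simp; ring,
          AddCircle.coe_add, AddCircle.coe_period, add_zero]
      rw [e2, e, Path.trans_apply]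
      split_ifs with h2
      · congr 1; apply Subtype.ext; simp; ring
      · exact absurd (show (t : ℝ) - 1 / 2 ≤ 1 / 2 by linarith) h2

theorem trivialClass_eq [PathConnectedSpace X] (x y : X) : trivialClass x = trivialClass y := by
  let γ := PathConnectedSpace.somePath x y
  exact freeClass_eq_of_homotopy ⟨fun q => γ q.1, by fun_prop⟩ (by simp) (by simp) (by simp)

end Homotopy

/-! ### Squares in `θ₃ × I` -/

namespace ThetaCyl

/-- The square over the edge `e`. -/
def square (e : Fin 3) (p : I × I) : ThetaCyl := (Theta.edgeParam e p.1, p.2)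

theorem isClosedEmbedding_square (e : Fin 3) : IsClosedEmbedding (square e) :=
  (Theta.isClosedEmbedding_edgeParam e).prodMap IsClosedEmbedding.id

theorem mem_range_square {e : Fin 3} {z : ThetaCyl} :
    z ∈ range (square e) ↔ ∃ x, z.1 = Theta.edgeParam e x := by
  constructor
  · rintro ⟨p, rfl⟩; exact ⟨p.1, rfl⟩
  · rintro ⟨x, hx⟩; exact ⟨(x, z.2), Prod.ext hx.symm rfl⟩

theorem openSquare_subset (e : Fin 3) : openSquare e ⊆ range (square e) := by
  rintro z ⟨x, -, -, hz⟩
  exact mem_range_square.2 ⟨x, hz⟩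

theorem ptA_mem_range_square (e : Fin 3) (h : I) : ptA h ∈ range (square e) :=
  mem_range_square.2 ⟨0, (Theta.edgeParam_zero e).symm⟩

theorem ptB_mem_range_square (e : Fin 3) (h : I) : ptB h ∈ range (square e) :=
  mem_range_square.2 ⟨1, (Theta.edgeParam_one e).symm⟩

theorem coord_ptA (h : I) : Theta.coord (ptA h).1 = 0 := rfl

theorem coord_ptB (h : I) : Theta.coord (ptB h).1 = 1 := rfl

instance : PathConnectedSpace (theta 3).Space := by
  refine ⟨⟨(theta 3).vertex (0 : Fin 2)⟩, ?_⟩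
  have : ∀ p, Joined p ((theta 3).vertex (0 : Fin 2)) := by
    intro p
    obtain ⟨e, x, rfl⟩ := Theta.exists_eq_edgeParam p
    rw [← Theta.edgeParam_zero e]
    exact ((PathConnectedSpace.joined x 0).map (Theta.continuous_edgeParam e))
  exact fun p q => (this p).trans (this q).symm

/-- The map of the edge `e` to the circle: `e₀` is wound once around the circle, the other edges are
contracted. -/
def edgeDegree (e : Fin 3) (x : I) : AddCircle (1 : ℝ) := if e = 0 then ((x : ℝ) : AddCircle (1 : ℝ)) else 0

theorem continuous_edgeDegree (e : Fin 3) : Continuous (edgeDegree e) := by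
  unfold edgeDegree
  split_ifs
  · exact (AddCircle.continuous_mk' (1 : ℝ)).comp continuous_subtype_val
  · exact continuous_const

/-- The map of `θ₃ × I` to the circle that winds the edge `e₀` once around the circle and contracts
the other two edges. -/
def degreeMap : C(ThetaCyl, AddCircle (1 : ℝ)) where
  toFun z := Theta.lift edgeDegree (by simp [edgeDegree])
    (by simp [edgeDegree, AddCircle.coe_period]) z.1
  continuous_toFun := by
    exact (Theta.continuous_lift continuous_edgeDegree).comp continuous_fst

theorem degreeMap_square (e : Fin 3) (p : I × I) :
    degreeMap (square e p) = if e = 0 then ((p.1 : ℝ) : AddCircle (1 : ℝ)) else 0 := (rfl)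

/-- Over e₀ the coordinate along the edge is itself a real lift of the degree map, and over the
other edges the constant 0 is one. -/
theorem degreeMap_eq_coord {z : ThetaCyl} (hz : z ∈ range (square 0)) :
    ((Theta.coord z.1 : ℝ) : AddCircle (1 : ℝ)) = degreeMap z := by
  obtain ⟨p, rfl⟩ := hz
  rw [degreeMap_square, if_pos rfl]; rfl

theorem degreeMap_eq_zero {e : Fin 3} (he : e ≠ 0) {z : ThetaCyl} (hz : z ∈ range (square e)) :
    ((0 : ℝ) : AddCircle (1 : ℝ)) = degreeMap z := by
  obtain ⟨p, rfl⟩ := hz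
  rw [degreeMap_square, if_neg he]; rfl

/-- The loop `e₀ e⁻¹` at the height `h`. -/
def edgeLoop (e : Fin 3) (h : I) : Path (ptA h) (ptA h) := (edgePath 0 h).trans (edgePath e h).symm

theorem freeClass_edgeLoop (e : Fin 3) (h h' : I) :
    freeClass (edgeLoop e h) = freeClass (edgeLoop e h') := by
  let γ := PathConnectedSpace.somePath h h'
  have hval : ∀ (k : I) (t : I), edgeLoop e k t = ((edgeLoop e h t).1, k) := by
    intro k t
    simp only [edgeLoop, Path.trans_apply]
    split_ifs <;> rfl
  refine freeClass_eq_of_homotopy ⟨fun q => ((edgeLoop e h q.2).1, γ q.1), by fun_prop⟩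
    (fun t => ?_) (fun t => ?_) (by simp)
  · rw [hval h t]; exact congrArg (Prod.mk _) γ.source
  · rw [hval h' t]; exact congrArg (Prod.mk _) γ.target

/-- From the parameter `s` to the parameter `t`, the curve runs in the square over `e₀` to the line
over `b`, back to the line over `a` through the square over `e`, and then in the square over `e₀`
to its initial point. -/
structure IsRoundTrip (K : Knot ThetaCyl) (e : Fin 3) (s t : ℝ) : Prop where
  closed : K s = K t
  exists_turns : ∃ b a : ℝ, ∃ h : I, s ≤ b ∧ b ≤ a ∧ a ≤ t ∧ K b = ptB h ∧ K a = ptA h ∧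
    MapsTo K (Icc s b) (range (square 0)) ∧ MapsTo K (Icc b a) (range (square e)) ∧
    MapsTo K (Icc a t) (range (square 0))

theorem affine_mem_Icc {u v : ℝ} (h : u ≤ v) (t : I) : u + t * (v - u) ∈ Icc u v :=
  ⟨by nlinarith [t.2.1], by nlinarith [t.2.2]⟩

/-- Rotate the loop so that it begins at (a, h). Its last and first pieces, both in the square over
e₀, join to a path from (a, h) to (b, h), homotopic to e₀ within this square. The middle piece is
homotopic to e⁻¹ within the square over e. -/
theorem IsRoundTrip.freeClass_eq {K : Knot ThetaCyl} {e : Fin 3} {s t : ℝ}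
    (hK : IsRoundTrip K e s t) (h' : I) :
    freeClass ((K.arc s t).cast rfl hK.closed) = freeClass (edgeLoop e h') := by
  obtain ⟨hst, b, a, h, hsb, hba, hat, hb, ha, m1, m2, m3⟩ := hK
  rw [freeClass_edgeLoop e h' h]
  have hc := K.continuous_toFun
  let α := (K.arc s a).cast rfl ha.symm
  let α₁ := (K.arc s b).cast rfl hb.symm
  let α₂ := (K.arc b a).cast hb.symm ha.symm
  let β := (K.arc a t).cast ha.symm hst
  have e1 : ((K.arc s t).cast rfl hst).Homotopic (α.trans β) :=
    Path.homotopic_trans_of_real hc _ _ _ (fun _ => rfl) (fun _ => rfl) (fun _ => rfl)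
  have e2 : α.Homotopic (α₁.trans α₂) :=
    Path.homotopic_trans_of_real hc _ _ _ (fun _ => rfl) (fun _ => rfl) (fun _ => rfl)
  have e3 : (β.trans α₁).Homotopic (edgePath 0 h) := by
    refine Path.homotopic_of_range_subset (isClosedEmbedding_square 0).isEmbedding _ _ ?_ ?_
    · intro r
      rw [Path.trans_apply]
      split_ifs
      · exact m3 (affine_mem_Icc hat _)
      · exact m1 (affine_mem_Icc hsb _)
    · exact fun r => mem_range_square.2 ⟨r, rfl⟩
  have e4 : α₂.Homotopic (edgePath e h).symm := by
    refine Path.homotopic_of_range_subset (isClosedEmbedding_square e).isEmbedding _ _ ?_ ?_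
    · exact fun r => m2 (affine_mem_Icc hba _)
    · exact fun r => mem_range_square.2 ⟨unitInterval.symm r, rfl⟩
  rw [e1.freeClass_eq, freeClass_trans_comm]
  refine Path.Homotopic.freeClass_eq ?_
  refine ((Path.Homotopic.refl β).hcomp e2).trans ?_
  exact (Path.Homotopic.trans_assoc β α₁ α₂).symm.trans (e3.hcomp e4)

/-- The coordinate on e₀ rises from its initial value x to 1, nothing happens over e, and then the
coordinate rises from 0 back to x. The total is 1. -/
theorem IsRoundTrip.lift_sub {K : Knot ThetaCyl} {e : Fin 3} {s t : ℝ}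
    (hK : IsRoundTrip K e s t) (he : e ≠ 0) {L : ℝ → ℝ} (hL : IsRealLift degreeMap K L) :
    L t - L s = 1 := by
  obtain ⟨hst, b, a, h, hsb, hba, hat, hb, ha, m1, m2, m3⟩ := hK
  have hcoord : ContinuousOn (fun z : ThetaCyl => (Theta.coord z.1 : ℝ)) (range (square 0)) :=
    (continuous_subtype_val.comp (Theta.continuous_coord.comp continuous_fst)).continuousOn
  have a1 := hL.sub_eq_of_mapsTo K.continuous_toFun hcoord (fun x hx => degreeMap_eq_coord hx) m1
    (left_mem_Icc.2 hsb) (right_mem_Icc.2 hsb)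
  have a2 := hL.sub_eq_of_mapsTo K.continuous_toFun (F := fun _ => 0) continuousOn_const
    (fun x hx => degreeMap_eq_zero he hx) m2 (left_mem_Icc.2 hba) (right_mem_Icc.2 hba)
  have a3 := hL.sub_eq_of_mapsTo K.continuous_toFun hcoord (fun x hx => degreeMap_eq_coord hx) m3
    (left_mem_Icc.2 hat) (right_mem_Icc.2 hat)
  rw [hb, hst, coord_ptB] at a1
  rw [ha, coord_ptA] at a3
  simp only [Icc.coe_one, Icc.coe_zero] at a1 a3
  linarith

end ThetaCyl

/-! ### The crossings of the knots `K_n` -/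

namespace ThetaCyl

theorem openSquare_coord {e : Fin 3} {z : ThetaCyl} (hz : z ∈ openSquare e) :
    Theta.coord z.1 ≠ 0 ∧ Theta.coord z.1 ≠ 1 := by
  obtain ⟨x, h0, h1, hz⟩ := hz
  rw [hz]
  exact ⟨h0.ne', h1.ne⟩

theorem eq_of_mem_openSquare {e e' : Fin 3} {z : ThetaCyl} (hz : z ∈ openSquare e)
    (hz' : z ∈ openSquare e') : e = e' := by
  obtain ⟨x, h0, h1, hz⟩ := hz
  obtain ⟨x', -, -, hz'⟩ := hz'
  have := (Theta.edgeParam_eq_edgeParam_iff.1 (hz.symm.trans hz')).2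
  exact this.resolve_right (not_or.2 ⟨h0.ne', h1.ne⟩)

theorem third_ne_twoThirds : third ≠ twoThirds := fun h => by
  have : (1 / 3 : ℝ) = 2 / 3 := congrArg Subtype.val h
  norm_num at this

theorem ptA_injective : Function.Injective ptA := fun _ _ h => congrArg Prod.snd h

theorem ptB_injective : Function.Injective ptB := fun _ _ h => congrArg Prod.snd h

theorem ptA_ne_ptB (h h' : I) : ptA h ≠ ptB h' := fun e => by
  have := congrArg (fun z : ThetaCyl => Theta.coord z.1) e
  simp only [coord_ptA, coord_ptB] at this
  exact zero_ne_one this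

/-- The four end points are distinct, each arc is embedded, and different open squares are disjoint,
so a crossing lies on the two arcs over e₀. Between its passages s and t the curve runs once over
e₁, and between t and s + 1 once over e₂. The integer m and the alternative arise because the
crossing is recorded in [0, 1), while the arcs are placed in the period that starts at t₀. -/
theorem IsK.exists_isRoundTrip {n : ℕ} {K : Knot ThetaCyl} (hK : IsK n K) {c : ℝ × ℝ}
    (hc : c ∈ K.crossings) : ∃ (s t : ℝ) (m : ℤ), IsRoundTrip K 1 s t ∧ IsRoundTrip K 2 t (s + 1) ∧
      (s = c.1 + m ∧ t = c.2 + m ∨ s = c.2 + m ∧ t = c.1 + 1 + m) := by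
  obtain ⟨⟨t₀, t₁, t₂, t₃, h01, h12, h23, h34, k0, k1, k2, k3, o0, o1, o2, o3, j0, j1, j2, j3⟩,
    -, -⟩ := hK
  have vinj : ∀ x y, (x = t₀ ∨ x = t₁ ∨ x = t₂ ∨ x = t₃) → (y = t₀ ∨ y = t₁ ∨ y = t₂ ∨ y = t₃) →
      K x = K y → x = y := by
    have a := third_ne_twoThirds
    rintro x y (rfl | rfl | rfl | rfl) (rfl | rfl | rfl | rfl) h <;> first
      | rfl
      | (simp only [k0, k1, k2, k3, ptA_injective.eq_iff, ptB_injective.eq_iff, a, a.symm,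
          ptA_ne_ptB, (ptA_ne_ptB _ _).symm] at h)
  have cls : ∀ x ∈ Ico t₀ (t₀ + 1), (x = t₀ ∨ x = t₁ ∨ x = t₂ ∨ x = t₃) ∨
      (x ∈ Ioo t₀ t₁ ∨ x ∈ Ioo t₁ t₂ ∨ x ∈ Ioo t₂ t₃ ∨ x ∈ Ioo t₃ (t₀ + 1)) := by
    intro x hx
    simp only [mem_Ico, mem_Ioo] at hx ⊢
    grind
  have opn : ∀ x, (x ∈ Ioo t₀ t₁ ∨ x ∈ Ioo t₁ t₂ ∨ x ∈ Ioo t₂ t₃ ∨ x ∈ Ioo t₃ (t₀ + 1)) →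
      ∃ e, K x ∈ openSquare e := by
    rintro x (h | h | h | h)
    exacts [⟨_, o0 x h⟩, ⟨_, o1 x h⟩, ⟨_, o2 x h⟩, ⟨_, o3 x h⟩]
  have vcoord : ∀ x, (x = t₀ ∨ x = t₁ ∨ x = t₂ ∨ x = t₃) →
      Theta.coord (K x).1 = 0 ∨ Theta.coord (K x).1 = 1 := by
    rintro x (rfl | rfl | rfl | rfl)
    · left; rw [k0, coord_ptA]
    · right; rw [k1, coord_ptB]
    · left; rw [k2, coord_ptA]
    · right; rw [k3, coord_ptB]
  have main : ∀ x ∈ Ico t₀ (t₀ + 1), ∀ y ∈ Ico t₀ (t₀ + 1), x ≠ y → K x = K y →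
      (x ∈ Ioo t₀ t₁ ∧ y ∈ Ioo t₂ t₃) ∨ (y ∈ Ioo t₀ t₁ ∧ x ∈ Ioo t₂ t₃) := by
    intro x hx y hy hne hxy
    have noVert : ∀ x y, K x = K y → (x = t₀ ∨ x = t₁ ∨ x = t₂ ∨ x = t₃) →
        (y ∈ Ioo t₀ t₁ ∨ y ∈ Ioo t₁ t₂ ∨ y ∈ Ioo t₂ t₃ ∨ y ∈ Ioo t₃ (t₀ + 1)) → False := by
      intro x y h hx hy
      obtain ⟨e, he⟩ := opn y hy
      have := vcoord x hx
      rw [h] at this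
      exact this.elim (openSquare_coord he).1 (openSquare_coord he).2
    rcases cls x hx with vx | ox
    · rcases cls y hy with vy | oy
      · exact absurd (vinj x y vx vy hxy) hne
      · exact (noVert x y hxy vx oy).elim
    rcases cls y hy with vy | oy
    · exact (noVert y x hxy.symm vy ox).elim
    have dis : ∀ {e e' : Fin 3}, e ≠ e' → K x ∈ openSquare e → K y ∈ openSquare e' → False :=
      fun he h h' => he (eq_of_mem_openSquare h (hxy ▸ h'))
    rcases ox with hx | hx | hx | hx <;> rcases oy with hy | hy | hy | hy
    · exact absurd (j0 (Ioo_subset_Icc_self hx) (Ioo_subset_Icc_self hy) hxy) hne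
    · exact (dis (by decide) (o0 x hx) (o1 y hy)).elim
    · exact Or.inl ⟨hx, hy⟩
    · exact (dis (by decide) (o0 x hx) (o3 y hy)).elim
    · exact (dis (by decide) (o1 x hx) (o0 y hy)).elim
    · exact absurd (j1 (Ioo_subset_Icc_self hx) (Ioo_subset_Icc_self hy) hxy) hne
    · exact (dis (by decide) (o1 x hx) (o2 y hy)).elim
    · exact (dis (by decide) (o1 x hx) (o3 y hy)).elim
    · exact Or.inr ⟨hy, hx⟩
    · exact (dis (by decide) (o2 x hx) (o1 y hy)).elim
    · exact absurd (j2 (Ioo_subset_Icc_self hx) (Ioo_subset_Icc_self hy) hxy) hne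
    · exact (dis (by decide) (o2 x hx) (o3 y hy)).elim
    · exact (dis (by decide) (o3 x hx) (o0 y hy)).elim
    · exact (dis (by decide) (o3 x hx) (o1 y hy)).elim
    · exact (dis (by decide) (o3 x hx) (o2 y hy)).elim
    · exact absurd (j3 (Ioo_subset_Icc_self hx) (Ioo_subset_Icc_self hy) hxy) hne
  have m0 : MapsTo K (Icc t₀ t₁) (range (square 0)) := fun x hx => by
    rcases eq_endpoints_or_mem_Ioo_of_mem_Icc hx with rfl | rfl | h
    · rw [k0]; exact ptA_mem_range_square _ _
    · rw [k1]; exact ptB_mem_range_square _ _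
    · exact openSquare_subset _ (o0 x h)
  have m1 : MapsTo K (Icc t₁ t₂) (range (square 1)) := fun x hx => by
    rcases eq_endpoints_or_mem_Ioo_of_mem_Icc hx with rfl | rfl | h
    · rw [k1]; exact ptB_mem_range_square _ _
    · rw [k2]; exact ptA_mem_range_square _ _
    · exact openSquare_subset _ (o1 x h)
  have m2 : MapsTo K (Icc t₂ t₃) (range (square 0)) := fun x hx => by
    rcases eq_endpoints_or_mem_Ioo_of_mem_Icc hx with rfl | rfl | h
    · rw [k2]; exact ptA_mem_range_square _ _
    · rw [k3]; exact ptB_mem_range_square _ _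
    · exact openSquare_subset _ (o2 x h)
  have k4 : K (t₀ + 1) = ptA third := (K.periodic t₀).trans k0
  have m3 : MapsTo K (Icc t₃ (t₀ + 1)) (range (square 2)) := fun x hx => by
    rcases eq_endpoints_or_mem_Ioo_of_mem_Icc hx with rfl | rfl | h
    · rw [k3]; exact ptB_mem_range_square _ _
    · rw [k4]; exact ptA_mem_range_square _ _
    · exact openSquare_subset _ (o3 x h)
  have trip : ∀ s ∈ Ioo t₀ t₁, ∀ t ∈ Ioo t₂ t₃, K s = K t →
      IsRoundTrip K 1 s t ∧ IsRoundTrip K 2 t (s + 1) := by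
    intro s hs t ht hst
    refine ⟨⟨hst, t₁, t₂, twoThirds, hs.2.le, h12.le, ht.1.le, k1, k2,
      m0.mono_left (Icc_subset_Icc_left hs.1.le), m1, m2.mono_left (Icc_subset_Icc_right ht.2.le)⟩,
      ⟨by rw [K.periodic, hst], t₃, t₀ + 1, third, ht.2.le, h34.le, by linarith [hs.1], k3, k4,
      m2.mono_left (Icc_subset_Icc_left ht.1.le), m3, fun x hx => ?_⟩⟩
    -- The last leg of the second trip is the beginning of the first arc, one period later.
    have : K x = K (x - 1) := by rw [← K.periodic (x - 1), sub_add_cancel]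
    rw [this]
    exact m0 ⟨by linarith [hx.1], by linarith [hx.2, hs.2]⟩
  have red : ∀ x : ℝ, ∃ a : ℤ, x + a ∈ Ico t₀ (t₀ + 1) := fun x => by
    refine ⟨-toIcoDiv one_pos t₀ x, ?_⟩
    have := toIcoMod_mem_Ico one_pos t₀ x
    rw [toIcoMod, zsmul_eq_mul, mul_one] at this
    push_cast
    rwa [← sub_eq_add_neg]
  obtain ⟨a, ha⟩ := red c.1
  obtain ⟨b, hb⟩ := red c.2
  have hab : K (c.1 + a) = K (c.2 + b) := by
    rw [K.apply_add_int, K.apply_add_int, hc.2.2.2]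
  have c0 := hc.1
  have c1 := hc.2.1
  have c2 := hc.2.2.1
  have hne : c.1 + a ≠ c.2 + b := by
    intro e
    have h1 : ((b : ℤ) : ℝ) < a := by linarith
    have h2 : (a : ℝ) < b + 1 := by linarith
    have h1' : b < a := by exact_mod_cast h1
    have h2' : a < b + 1 := by exact_mod_cast h2
    omega
  -- Since 0 < c.2 − c.1 < 1, the translations into the period from t₀ agree if c.1 goes to the
  -- first arc over e₀, and otherwise differ by one.
  rcases main _ ha _ hb hne hab with ⟨hs, ht⟩ | ⟨hs, ht⟩
  · have e : a = b := by
      have h1 : (a : ℝ) < b + 1 := by linarith [hs.2, ht.1]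
      have h2 : (b : ℝ) < a + 1 := by linarith [hs.1, ht.2]
      have h1' : a < b + 1 := by exact_mod_cast h1
      have h2' : b < a + 1 := by exact_mod_cast h2
      omega
    subst e
    obtain ⟨r1, r2⟩ := trip _ hs _ ht hab
    exact ⟨_, _, a, r1, r2, Or.inl ⟨rfl, rfl⟩⟩
  · have e : a = b + 1 := by
      have h1 : (a : ℝ) < b + 2 := by linarith [hs.1, ht.2]
      have h2 : (b : ℝ) < a := by linarith [hs.2, ht.1]
      have h1' : a < b + 2 := by exact_mod_cast h1
      have h2' : b < a := by exact_mod_cast h2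
      omega
    obtain ⟨r1, r2⟩ := trip _ hs _ ht hab.symm
    refine ⟨_, _, b, r1, r2, Or.inr ⟨rfl, ?_⟩⟩
    rw [e]; push_cast; ring

theorem IsRoundTrip.freeClass_eq_of_shift {K : Knot ThetaCyl} {e : Fin 3} {s t : ℝ}
    (hK : IsRoundTrip K e s t) {u v : ℝ} {x : ThetaCyl} (γ : Path x x)
    (hγ : ∀ r : I, γ r = K (u + r * (v - u))) {m : ℤ} (hs : s = u + m) (ht : t = v + m) (h : I) :
    freeClass γ = freeClass (edgeLoop e h) := by
  rw [← hK.freeClass_eq h]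
  refine freeClass_congr fun r => ?_
  rw [hγ]
  change _ = K (s + r * (t - s))
  rw [← K.apply_add_int _ m, hs, ht]
  congr 1
  ring

theorem IsK.smooth_eq {n : ℕ} {K : Knot ThetaCyl} (hK : IsK n K) (c : K.crossings) (h : I) :
    K.smooth₁ c = freeClass (loopU h) ∧ K.smooth₂ c = freeClass (loopV h) ∨
      K.smooth₁ c = freeClass (loopV h) ∧ K.smooth₂ c = freeClass (loopU h) := by
  obtain ⟨s, t, m, r1, r2, ⟨hs, ht⟩ | ⟨hs, ht⟩⟩ := hK.exists_isRoundTrip c.2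
  · exact Or.inl ⟨r1.freeClass_eq_of_shift _ (fun _ => rfl) hs ht h,
      r2.freeClass_eq_of_shift _ (fun _ => rfl) ht (by rw [hs]; ring) h⟩
  · refine Or.inr ⟨r2.freeClass_eq_of_shift (m := m + 1) _ (fun _ => rfl) ?_ ?_ h,
      r1.freeClass_eq_of_shift _ (fun _ => rfl) hs ht h⟩
    · rw [ht]; push_cast; ring
    · rw [hs]; push_cast; ring

/-- The summand is symmetric in the two components, so it does not matter which of them is u. Thus
all 2n+1 summands are equal, with sign +1. -/
theorem IsK.co_eq {n : ℕ} {K : Knot ThetaCyl} (hK : IsK n K) (h : I) :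
    K.co = (2 * (n : ℤ) + 1) •
      (basisElt (freeClass (loopU h)) ⊗ₜ[ℤ] basisElt (freeClass (loopV h))
        + basisElt (freeClass (loopV h)) ⊗ₜ[ℤ] basisElt (freeClass (loopU h))
        - basisElt K.homotopyClass ⊗ₜ[ℤ] basisElt (trivialClass (ptA h))
        - basisElt (trivialClass (ptA h)) ⊗ₜ[ℤ] basisElt K.homotopyClass) := by
  have : Fintype K.crossings := K.crossings_finite.fintype
  have hcard : Fintype.card K.crossings = 2 * n + 1 := by
    rw [← Nat.card_eq_fintype_card]; exact hK.2.1
  rw [Knot.co, finsum_eq_sum_of_fintype, Finset.sum_congr rfl fun c _ => ?_, Finset.sum_const,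
    Finset.card_univ, hcard, ← natCast_zsmul]
  · push_cast; rfl
  · rw [hK.2.2 c.1 c.2, one_smul, trivialClass_eq (K 0) (ptA h)]
    rcases hK.smooth_eq c h with ⟨e1, e2⟩ | ⟨e1, e2⟩
    · rw [e1, e2]
    · rw [e1, e2, add_comm (basisElt (freeClass (loopV h)) ⊗ₜ[ℤ] basisElt (freeClass (loopU h)))]

/-- Both components of every smoothing are round trips, each of degree 1, so every crossing
contributes its sign +1. -/
theorem IsK.splitCount_eq {n : ℕ} {K : Knot ThetaCyl} (hK : IsK n K) :
    K.splitCount degreeMap = 2 * n + 1 := by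
  obtain ⟨L, hL⟩ := exists_isRealLift degreeMap K.continuous_toFun
  obtain ⟨d, hper⟩ : ∃ d, ∀ t, L (t + 1) = L t + d :=
    ⟨L (0 + 1) - L 0, fun t => by linarith [hL.add_one_sub K.periodic 0 t]⟩
  have hz := Knot.apply_add_int_of_apply_add_one hper
  have : ∀ c ∈ K.crossings, K.splitTerm L c = 1 := by
    intro c hc
    rw [Knot.splitTerm, if_pos, hK.2.2 c hc]
    obtain ⟨s, t, m, r1, r2, ⟨hs, ht⟩ | ⟨hs, ht⟩⟩ := hK.exists_isRoundTrip hc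
    · have e1 := r1.lift_sub (by decide) hL
      have e2 := r2.lift_sub (by decide) hL
      rw [hper] at e2
      rw [hs, ht, hz, hz] at e1 e2
      rw [hper, show L c.2 - L c.1 = 1 by linarith, one_mul]
      linarith
    · have e1 := r1.lift_sub (by decide) hL
      have e2 := r2.lift_sub (by decide) hL
      rw [hper] at e2
      rw [hs, ht, hz, hz, hper] at e1 e2
      rw [hper, show L c.2 - L c.1 = 1 by linarith, one_mul]
      linarith
  rw [Knot.splitCount_eq hL, finsum_mem_congr rfl this,
    finsum_mem_eq_finite_toFinset_sum _ K.crossings_finite, Finset.sum_const,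
    ← Set.ncard_eq_toFinset_card _ K.crossings_finite]
  have := hK.2.1
  rw [Knot.cro] at this
  rw [this]; simp

end ThetaCyl

/-! ### Coverings of `θ₃ × I` -/

namespace Theta

/-- The edge whose interior contains the given point. -/
def edgeIndex (p : (theta 3).Space) : Fin 3 :=
  -- The default value 2 at the vertices has no effect on the covering: the overlap of the two stars
  -- contains no vertex, and on a single star the change of coordinates cancels it.
  open Classical in if 0 < bump 0 p then 0 else if 0 < bump 1 p then 1 else 2

theorem edgeIndex_eq {e : Fin 3} {p : (theta 3).Space} (h : 0 < bump e p) : edgeIndex p = e := by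
  have hp := eq_edgeParam_of_bump_pos h
  have h' : ∀ e', e' ≠ e → ¬ 0 < bump e' p := fun e' he => by
    rw [hp, bump_edgeParam, if_neg he.symm]; exact lt_irrefl 0
  unfold edgeIndex
  fin_cases e
  · exact if_pos h
  · rw [if_neg (h' 0 (by decide))]; exact if_pos h
  · rw [if_neg (h' 0 (by decide)), if_neg (h' 1 (by decide))]; rfl

theorem exists_bump_pos {p : (theta 3).Space} (h0 : coord p ≠ 0) (h1 : coord p ≠ 1) :
    ∃ e, 0 < bump e p := by
  obtain ⟨e, x, rfl⟩ := exists_eq_edgeParam p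
  exact ⟨e, bump_edgeParam_pos e (unitInterval.pos_iff_ne_zero.2 h0)
    (unitInterval.lt_one_iff_ne_one.2 h1)⟩

theorem coord_ne_of_flip_lt_one {i j : Bool} (hij : i ≠ j) {p : (theta 3).Space}
    (hi : flip i (coord p) < 1) (hj : flip j (coord p) < 1) : coord p ≠ 0 ∧ coord p ≠ 1 := by
  have key : unitInterval.symm (coord p) < 1 → coord p ≠ 0 := fun h h0 => by
    rw [h0, unitInterval.symm_zero] at h
    exact h.ne rfl
  cases i <;> cases j
  · exact absurd rfl hij
  · exact ⟨key hj, hi.ne⟩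
  · exact ⟨key hi, hj.ne⟩
  · exact absurd rfl hij

end Theta

namespace ThetaCyl

open Theta (flip coord edgeIndex bump)

/-- The set over the open star of the vertex `a` (of the vertex `b`, if `i = true`). -/
def star (i : Bool) : Set ThetaCyl := {z | flip i (coord z.1) < 1}

theorem isOpen_star (i : Bool) : IsOpen (star i) :=
  isOpen_lt ((Theta.continuous_flip i).comp (Theta.continuous_coord.comp continuous_fst))
    continuous_const

theorem mem_star_false {z : ThetaCyl} : z ∈ star false ↔ coord z.1 < 1 := Iff.rfl

theorem mem_star_true {z : ThetaCyl} : z ∈ star true ↔ 0 < coord z.1 := by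
  change (1 - (coord z.1 : ℝ)) < 1 ↔ (0 : ℝ) < coord z.1
  constructor <;> intro <;> linarith

section Covering

variable {G : Type*} [Group G]

/-- The value of the cocycle of the covering at a point, in the chart over a star. -/
def chartShift (k : Fin 3 → G) (i : Bool) (z : ThetaCyl) : G := if i then k (edgeIndex z.1) else 1

variable [TopologicalSpace G]

theorem continuousAt_chartShift (k : Fin 3 → G) (i : Bool) {z : ThetaCyl} (h0 : coord z.1 ≠ 0)
    (h1 : coord z.1 ≠ 1) : ContinuousAt (chartShift k i) z := by
  obtain ⟨e, he⟩ := Theta.exists_bump_pos h0 h1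
  have hev : ∀ᶠ z' : ThetaCyl in 𝓝 z, 0 < bump e z'.1 :=
    (isOpen_lt continuous_const ((Theta.continuous_bump e).comp continuous_fst)).mem_nhds he
  refine (continuousAt_const (y := if i then k e else 1)).congr ?_
  filter_upwards [hev] with z' hz'
  rw [chartShift, Theta.edgeIndex_eq hz']

variable [DiscreteTopology G]

/-- The covering of `θ₃ × I` with fibre `G` such that the points of the fibre are multiplied by
`k e` in passing from the chart over the star of `a` to the chart over the star of `b` above the
edge `e`. -/
def coveringCore (k : Fin 3 → G) : FiberBundleCore Bool ThetaCyl G where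
  baseSet := star
  isOpen_baseSet := isOpen_star
  indexAt z := open Classical in if coord z.1 < 1 then false else true
  mem_baseSet_at z := by
    split_ifs with h
    · exact h
    · rw [mem_star_true]
      exact zero_lt_one.trans_le (not_lt.1 h)
  -- Written as a quotient of values of `chartShift`, the transition functions satisfy the cocycle
  -- identities formally. The covering can still be nontrivial, because the shift over the star of b
  -- need not be continuous at b.
  coordChange i j z v := chartShift k j z * (chartShift k i z)⁻¹ * v
  coordChange_self i z _ v := by simp
  continuousOn_coordChange i j := by
    rcases eq_or_ne i j with rfl | hij
    · simp only [mul_inv_cancel, one_mul]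
      exact continuous_snd.continuousOn
    · rintro ⟨z, v⟩ ⟨⟨hi, hj⟩, -⟩
      obtain ⟨h0, h1⟩ := Theta.coord_ne_of_flip_lt_one hij hi hj
      have c : ∀ i, ContinuousAt (fun p : ThetaCyl × G => chartShift k i p.1) (z, v) := fun i =>
        (continuousAt_chartShift k i h0 h1).comp (x := (z, v)) continuousAt_fst
      exact (((c j).mul (c i).inv).mul continuousAt_snd).continuousWithinAt
  coordChange_comp i j l z _ v := by group

/-- The coordinate in the fibre of a point of the covering. -/
def fibreCoord (k : Fin 3 → G) (i : Bool) (p : (coveringCore k).TotalSpace) : G :=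
  ((coveringCore k).localTriv i p).2

theorem continuousOn_fibreCoord (k : Fin 3 → G) (i : Bool) :
    ContinuousOn (fibreCoord k i) {p | p.1 ∈ star i} :=
  continuous_snd.comp_continuousOn ((coveringCore k).localTriv i).continuousOn_toFun

theorem fibreCoord_eq (k : Fin 3 → G) (i j : Bool) (p : (coveringCore k).TotalSpace) :
    fibreCoord k j p = chartShift k j p.1 * (chartShift k i p.1)⁻¹ * fibreCoord k i p := by
  obtain ⟨z, v⟩ := p
  let w : G := v
  change chartShift k j z * _ * w = _ * (chartShift k i z * _ * w)
  group

theorem fibreCoord_true {k : Fin 3 → G} {p : (coveringCore k).TotalSpace} {e : Fin 3}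
    (h : 0 < bump e p.1.1) : fibreCoord k true p = k e * fibreCoord k false p := by
  rw [fibreCoord_eq k false true]
  simp [chartShift, Theta.edgeIndex_eq h]

theorem isCoveringMap_coveringCore (k : Fin 3 → G) : IsCoveringMap (coveringCore k).proj :=
  FiberBundle.isCoveringMap

/-- While the lifted path stays over one star, its fibre coordinate is a continuous function with
values in a discrete space. -/
theorem fibreCoord_eq_of_lift {k : Fin 3 → G} {Γ : I → (coveringCore k).TotalSpace}
    (hΓ : Continuous Γ) {i : Bool} {S : Set I} (hS : IsPreconnected S)
    (h : ∀ t ∈ S, (Γ t).1 ∈ star i) {s t : I} (hs : s ∈ S) (ht : t ∈ S) :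
    fibreCoord k i (Γ s) = fibreCoord k i (Γ t) :=
  hS.constant ((continuousOn_fibreCoord k i).comp hΓ.continuousOn h) hs ht

theorem fibreCoord_lift_edgeLoop {k : Fin 3 → G} {Γ : I → (coveringCore k).TotalSpace}
    (hΓ : Continuous Γ) (e : Fin 3) (h : I) (hp : ∀ t, (Γ t).1 = edgeLoop e h t) :
    fibreCoord k false (Γ 1) = (k e)⁻¹ * k 0 * fibreCoord k false (Γ 0) := by
  -- The parameters 1/4 and 3/4 are the midpoints of the two edges. The loop is over the star of a
  -- before the first and after the second, and over the star of b between them. The changes of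
  -- chart there multiply by k 0 and by the inverse of k e.
  let q₁ : I := ⟨1 / 4, by norm_num, by norm_num⟩
  let q₃ : I := ⟨3 / 4, by norm_num, by norm_num⟩
  have v1 : ∀ (t : I) (ht : (t : ℝ) ≤ 1 / 2), (Γ t).1.1 =
      Theta.edgeParam 0 ⟨2 * t, by linarith [t.2.1], by linarith⟩ := fun t ht => by
    rw [hp, edgeLoop, Path.trans_apply, dif_pos ht]; rfl
  have v2 : ∀ (t : I) (ht : ¬ (t : ℝ) ≤ 1 / 2), (Γ t).1.1 =
      Theta.edgeParam e (unitInterval.symm ⟨2 * t - 1, by linarith, by linarith [t.2.2]⟩) :=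
      fun t ht => by
    rw [hp, edgeLoop, Path.trans_apply, dif_neg ht]; rfl
  have s1 : ∀ t ∈ Icc 0 q₁, (Γ t).1 ∈ star false := fun t ht => by
    have h1 : (t : ℝ) ≤ 1 / 4 := ht.2
    rw [mem_star_false, v1 t (by linarith), Theta.coord_edgeParam]
    change (2 * t : ℝ) < 1
    linarith
  have s2 : ∀ t ∈ Icc q₁ q₃, (Γ t).1 ∈ star true := fun t ht => by
    have h1 : (1 / 4 : ℝ) ≤ t := ht.1
    have h3 : (t : ℝ) ≤ 3 / 4 := ht.2
    rw [mem_star_true]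
    by_cases h2 : (t : ℝ) ≤ 1 / 2
    · rw [v1 t h2, Theta.coord_edgeParam]
      change (0 : ℝ) < 2 * t
      linarith
    · rw [v2 t h2, Theta.coord_edgeParam]
      change (0 : ℝ) < 1 - (2 * t - 1)
      linarith
  have s3 : ∀ t ∈ Icc q₃ 1, (Γ t).1 ∈ star false := fun t ht => by
    have h3 : (3 / 4 : ℝ) ≤ t := ht.1
    have h2 : ¬ (t : ℝ) ≤ 1 / 2 := by linarith
    rw [mem_star_false, v2 t h2, Theta.coord_edgeParam]
    change (1 - (2 * t - 1) : ℝ) < 1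
    linarith
  have le1 : (0 : I) ≤ q₁ := q₁.2.1
  have le2 : q₁ ≤ q₃ := show (1 / 4 : ℝ) ≤ 3 / 4 by norm_num
  have le3 : q₃ ≤ (1 : I) := q₃.2.2
  have c1 := fibreCoord_eq_of_lift hΓ isPreconnected_Icc s1 (left_mem_Icc.2 le1)
    (right_mem_Icc.2 le1)
  have c2 := fibreCoord_eq_of_lift hΓ isPreconnected_Icc s2 (left_mem_Icc.2 le2)
    (right_mem_Icc.2 le2)
  have c3 := fibreCoord_eq_of_lift hΓ isPreconnected_Icc s3 (left_mem_Icc.2 le3)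
    (right_mem_Icc.2 le3)
  have t1 : fibreCoord k true (Γ q₁) = k 0 * fibreCoord k false (Γ q₁) := by
    refine fibreCoord_true ?_
    rw [v1 q₁ (show (1 / 4 : ℝ) ≤ 1 / 2 by norm_num)]
    refine Theta.bump_edgeParam_pos _ ?_ ?_
    · change (0 : ℝ) < 2 * (1 / 4); norm_num
    · change (2 * (1 / 4) : ℝ) < 1; norm_num
  have t3 : fibreCoord k true (Γ q₃) = k e * fibreCoord k false (Γ q₃) := by
    refine fibreCoord_true ?_
    rw [v2 q₃ (show ¬ (3 / 4 : ℝ) ≤ 1 / 2 by norm_num)]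
    refine Theta.bump_edgeParam_pos _ ?_ ?_
    · change (0 : ℝ) < 1 - (2 * (3 / 4) - 1); norm_num
    · change (1 - (2 * (3 / 4) - 1) : ℝ) < 1; norm_num
  rw [← c3, c1, mul_assoc, ← t1, c2, t3, inv_mul_cancel_left]

theorem fibreCoord_mk_ptA (k : Fin 3 → G) (h : I) (g : G) :
    fibreCoord k false (⟨ptA h, g⟩ : (coveringCore k).TotalSpace) = g := by
  have hi : (coveringCore k).indexAt (ptA h) = false := if_pos (by rw [coord_ptA]; exact zero_lt_one)
  change chartShift k false (ptA h) * (chartShift k ((coveringCore k).indexAt (ptA h)) (ptA h))⁻¹ *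
    g = g
  rw [hi, mul_inv_cancel, one_mul]

/-- The points of the covering over a point of the line over the vertex `a`. -/
def fibreEquiv (k : Fin 3 → G) (h : I) : (coveringCore k).proj ⁻¹' {ptA h} ≃ G where
  toFun p := fibreCoord k false p.1
  invFun g := ⟨⟨ptA h, g⟩, rfl⟩
  left_inv := by
    rintro ⟨⟨z, g⟩, hz⟩
    obtain rfl : z = ptA h := hz
    exact Subtype.ext (congrArg (fun g => (⟨ptA h, g⟩ : (coveringCore k).TotalSpace))
      (fibreCoord_mk_ptA k h g))
  right_inv g := fibreCoord_mk_ptA k h g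

theorem exists_monodromy (k : Fin 3 → G) (h : I) :
    ∃ ρ : FundamentalGroup ThetaCyl (ptA h) →* Equiv.Perm G,
      ∀ e g, ρ (piClass (edgeLoop e h)) g = (k e)⁻¹ * k 0 * g := by
  let cov := isCoveringMap_coveringCore k
  refine ⟨(fibreEquiv k h).permCongrHom.toMonoidHom.comp (cov.monodromyPerm (ptA h)),
    fun e g => ?_⟩
  let p := (fibreEquiv k h).symm g
  have hp : edgeLoop e h 0 = (coveringCore k).proj p.1 := (edgeLoop e h).source.trans p.2.symm
  have := fibreCoord_lift_edgeLoop (cov.liftPath (edgeLoop e h) p.1 hp).continuous e h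
    (fun t => congrFun (cov.liftPath_lifts (edgeLoop e h) p.1 hp) t)
  rw [cov.liftPath_zero] at this
  refine Eq.trans this ?_
  congr 1
  exact (fibreEquiv k h).apply_symm_apply g

end Covering

/-- Take the covering whose fibre is the free group itself. The loops u and v act on the fibre by
left multiplication by the two generators, so the composition with the monodromy is the regular
action, and a word is recovered as the image of 1. -/
theorem freeGroup_lift_injective (h : I) : Function.Injective
    (FreeGroup.lift ![piClass (loopU h), piClass (loopV h)]) := by
  let _ : TopologicalSpace (FreeGroup (Fin 2)) := ⊥
  have : DiscreteTopology (FreeGroup (Fin 2)) := ⟨rfl⟩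
  -- The loop e₀e⁻¹ acts by (k e)⁻¹ · k 0. Inverse generators on e₁ and e₂, with 1 on e₀, make this
  -- the generators.
  obtain ⟨ρ, hρ⟩ := exists_monodromy
    ![1, (FreeGroup.of (0 : Fin 2))⁻¹, (FreeGroup.of (1 : Fin 2))⁻¹] h
  have key : ρ.comp (FreeGroup.lift ![piClass (loopU h), piClass (loopV h)]) =
      MulAction.toPermHom (FreeGroup (Fin 2)) (FreeGroup (Fin 2)) := by
    refine FreeGroup.ext_hom _ _ fun i => Equiv.ext fun g => ?_
    fin_cases i
    · simpa using! hρ 1 g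
    · simpa using! hρ 2 g
  rw [injective_iff_map_eq_one]
  intro w hw
  have := congrArg (fun f => f w 1) key
  simp only [MonoidHom.comp_apply] at this
  rw [hw, map_one ρ] at this
  simpa using this.symm

end ThetaCyl

/-! ### Generators of the fundamental group of `θ₃ × I` -/

namespace ThetaCyl

open Theta (coord)

theorem quotient_trans_loop {X : Type*} [TopologicalSpace X] {x y z : X}
    (s : Path.Homotopic.Quotient x x) (a b : Path.Homotopic.Quotient x y)
    (d : Path.Homotopic.Quotient y z) :
    (s.trans (a.trans b.symm)).trans (b.trans d) = (s.trans a).trans d := by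
  rw [← Path.Homotopic.Quotient.trans_assoc, Path.Homotopic.Quotient.trans_assoc s,
    Path.Homotopic.Quotient.trans_assoc a, Path.Homotopic.Quotient.symm_trans,
    Path.Homotopic.Quotient.trans_refl]

/-- The set over a star is the image of the contractible space `Tripod` × I. -/
theorem homotopic_of_mem_star {i : Bool} {x y : ThetaCyl} (γ γ' : Path x y)
    (h : ∀ t, γ t ∈ star i) (h' : ∀ t, γ' t ∈ star i) : γ.Homotopic γ' := by
  have hφ : IsEmbedding (Prod.map (Theta.starChart i) (id : I → I)) :=
    (Theta.isOpenEmbedding_starChart i).isEmbedding.prodMap IsEmbedding.id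
  have hr : range (Prod.map (Theta.starChart i) (id : I → I)) = star i := by
    rw [range_prodMap, Theta.range_starChart, range_id]
    ext z
    exact and_iff_left trivial
  rw [← hr] at h h'
  exact Path.homotopic_of_range_subset hφ γ γ' h h'

variable {h : I}

/-- The subgroup of the fundamental group generated by the two standard loops. -/
def loopSubgroup (h : I) : Subgroup (FundamentalGroup ThetaCyl (ptA h)) :=
  (FreeGroup.lift ![piClass (loopU h), piClass (loopV h)]).range

theorem piClass_edgeLoop_mem (e : Fin 3) : piClass (edgeLoop e h) ∈ loopSubgroup h := by
  have hi : ∀ i : Fin 2, ![piClass (loopU h), piClass (loopV h)] i ∈ loopSubgroup h := fun i =>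
    ⟨FreeGroup.of i, FreeGroup.lift_apply_of⟩
  fin_cases e
  · convert! (loopSubgroup h).one_mem
    exact Path.Homotopic.Quotient.eq.2 ⟨Path.Homotopy.reflTransSymm _⟩ |>.symm
  · exact hi 0
  · exact hi 1

/-- The homotopy classes of paths from `(a, h)` to `z` that are composed of a product of standard
loops, the edge `e₀` if `i = true`, and a path over the star of `a` (over the star of `b` if
`i = true`). -/
def tame (h : I) (i : Bool) (z : ThetaCyl) : Set (Path.Homotopic.Quotient (ptA h) z) :=
  if i then {q | ∃ s ∈ loopSubgroup h, ∃ β : Path (ptB h) z, (∀ t, β t ∈ star true) ∧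
      q = (Path.Homotopic.Quotient.trans s (.mk (edgePath 0 h))).trans (.mk β)}
  else {q | ∃ s ∈ loopSubgroup h, ∃ β : Path (ptA h) z, (∀ t, β t ∈ star false) ∧
      q = Path.Homotopic.Quotient.trans s (.mk β)}

theorem mem_star_of_mem_tame {i : Bool} {z : ThetaCyl} {q : Path.Homotopic.Quotient (ptA h) z}
    (hq : q ∈ tame h i z) : z ∈ star i := by
  cases i <;> obtain ⟨s, -, β, hβ, -⟩ := hq <;> simpa using hβ 1

theorem trans_mem_tame {i : Bool} {z w : ThetaCyl} {q : Path.Homotopic.Quotient (ptA h) z}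
    (hq : q ∈ tame h i z) (γ : Path z w) (hγ : ∀ t, γ t ∈ star i) :
    q.trans (.mk γ) ∈ tame h i w := by
  have key : ∀ {x : ThetaCyl} (β : Path x z), (∀ t, β t ∈ star i) → ∀ t, β.trans γ t ∈ star i := by
    intro x β hβ t
    rw [Path.trans_apply]
    split_ifs
    · exact hβ _
    · exact hγ _
  cases i <;> obtain ⟨s, hs, β, hβ, rfl⟩ := hq <;>
    exact ⟨s, hs, β.trans γ, key β hβ, by simp [Path.Homotopic.Quotient.trans_assoc]⟩

/-- On the overlap of the stars, z lies over an open edge e. The tail within one star may be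
replaced by the straight path ε from a, or δ from b, along e, and ε is homotopic to e · δ. Since e =
(e e₀⁻¹) e₀, passing between the two forms costs one factor e₀e⁻¹ or its inverse. This is where the
generators of the group enter. -/
theorem mem_tame_not {i : Bool} {z : ThetaCyl} {q : Path.Homotopic.Quotient (ptA h) z} (hq : q ∈ tame h i z)
    (hz : z ∈ star (!i)) : q ∈ tame h (!i) z := by
  have hz' := mem_star_of_mem_tame hq
  obtain ⟨h0, h1⟩ : 0 < coord z.1 ∧ coord z.1 < 1 := by
    cases i
    · exact ⟨mem_star_true.1 hz, hz'⟩
    · exact ⟨mem_star_true.1 hz', hz⟩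
  obtain ⟨e, x, hx⟩ := Theta.exists_eq_edgeParam z.1
  obtain ⟨p, k⟩ := z
  obtain rfl : p = Theta.edgeParam e x := hx
  rw [Theta.coord_edgeParam] at h0 h1
  -- The path τ brings the height from h to that of z while ε and δ move along the edge.
  let τ := PathConnectedSpace.somePath h k
  let ε : Path (ptA h) (Theta.edgeParam e x, k) :=
    { toFun := fun t => (Theta.edgeParam e (t * x), τ t)
      continuous_toFun := by
        exact ((Theta.continuous_edgeParam e).comp (by fun_prop)).prodMk τ.continuous
      source' := by simp [ptA, Theta.edgeParam_zero]
      target' := by simp }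
  let δ : Path (ptB h) (Theta.edgeParam e x, k) :=
    { toFun := fun t => (Theta.edgeParam e (σ (t * σ x)), τ t)
      continuous_toFun := by
        exact ((Theta.continuous_edgeParam e).comp (by fun_prop)).prodMk τ.continuous
      source' := by simp [ptB, Theta.edgeParam_one]
      target' := by simp }
  have hε : ∀ t, ε t ∈ star false := fun t =>
    lt_of_le_of_lt (show (t : ℝ) * x ≤ x from mul_le_of_le_one_left x.2.1 t.2.2) h1
  have hδ : ∀ t, δ t ∈ star true := fun t => by
    have h0' : (0 : ℝ) < x := h0
    have : (t : ℝ) * (1 - x) ≤ 1 - x := mul_le_of_le_one_left (by linarith [x.2.2]) t.2.2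
    exact mem_star_true.2 (show (0 : ℝ) < 1 - t * (1 - x) by linarith)
  have hεδ : ε.Homotopic ((edgePath e h).trans δ) := by
    refine Path.homotopic_of_range_subset (isClosedEmbedding_square e).isEmbedding _ _
      (fun t => mem_range_square.2 ⟨_, rfl⟩) fun t => ?_
    rw [Path.trans_apply]
    split_ifs <;> exact mem_range_square.2 ⟨_, rfl⟩
  have hq' := Path.Homotopic.Quotient.eq.2 hεδ
  rw [Path.Homotopic.Quotient.mk_trans] at hq'
  have hmem := piClass_edgeLoop_mem (h := h) e
  cases i <;> obtain ⟨s, hs, β, hβ, rfl⟩ := hq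
  -- In the fundamental group x * y is y followed by x, so the loop inserted after s is the left
  -- factor.
  · refine ⟨(piClass (edgeLoop e h))⁻¹ * s, mul_mem (inv_mem hmem) hs, δ, hδ, ?_⟩
    rw [Path.Homotopic.Quotient.eq.2 (homotopic_of_mem_star β ε hβ hε), hq',
      FundamentalGroup.mul_def, FundamentalGroup.inv_def]
    have hsymm : (piClass (edgeLoop e h)).symm = (Path.Homotopic.Quotient.mk (edgePath e h)).trans
        (Path.Homotopic.Quotient.mk (edgePath 0 h)).symm := by
      refine congrArg Path.Homotopic.Quotient.mk (Path.trans_symm _ _) |>.trans ?_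
      rw [Path.symm_symm]; rfl
    rw [hsymm, Path.Homotopic.Quotient.trans_assoc _ _ (Path.Homotopic.Quotient.mk δ)]
    exact (Path.Homotopic.Quotient.trans_assoc _ _ _).symm.trans
      (quotient_trans_loop s _ (Path.Homotopic.Quotient.mk (edgePath 0 h)) _).symm
  · refine ⟨piClass (edgeLoop e h) * s, mul_mem hmem hs, ε, hε, ?_⟩
    rw [Path.Homotopic.Quotient.eq.2 (homotopic_of_mem_star β δ hβ hδ), hq',
      FundamentalGroup.mul_def]
    exact (quotient_trans_loop s _ _ _).symm

/-- A Lebesgue subdivision splits γ into pieces each lying over one star. Induction over the pieces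
extends the tame form, with a change of star before a piece when necessary. -/
theorem exists_mem_tame (γ : Path (ptA h) (ptA h)) :
    ∃ i, Path.Homotopic.Quotient.mk γ ∈ tame h i (ptA h) := by
  have hcov : univ ⊆ ⋃ i, γ ⁻¹' star i := fun t _ => by
    by_cases ht : coord (γ t).1 < 1
    · exact mem_iUnion.2 ⟨false, ht⟩
    · exact mem_iUnion.2 ⟨true, mem_star_true.2 (zero_lt_one.trans_le (not_lt.1 ht))⟩
  obtain ⟨t, ht0, htm, ⟨n, hn⟩, ht⟩ := exists_monotone_Icc_subset_open_cover_unitInterval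
    (fun i => (isOpen_star i).preimage γ.continuous) hcov
  -- The initial part of γ is described by its values as an affine reparametrization from 0, the
  -- form needed to split off the next piece with `Path.homotopic_trans_of_real`.
  have step : ∀ m (p : Path (ptA h) (γ (t m))), (∀ r : I, p r = γ.extend (0 + r * (t m - 0))) →
      ∃ i, Path.Homotopic.Quotient.mk p ∈ tame h i (γ (t m)) := by
    intro m
    induction m with
    | zero =>
      intro p hp
      refine ⟨false, 1, one_mem _, p, fun r => ?_, ?_⟩
      · rw [hp]
        simp only [ht0, Icc.coe_zero, sub_zero, mul_zero, add_zero, Path.extend_zero]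
        exact (zero_lt_one : (0 : I) < 1)
      · exact (Path.Homotopic.Quotient.refl_trans _).symm
    | succ m ih =>
      intro p hp
      have hle : (t m : ℝ) ≤ t (m + 1) := htm m.le_succ
      let p₁ : Path (ptA h) (γ (t m)) :=
        { toFun := fun r => γ.extend (0 + r * (t m - 0))
          continuous_toFun := γ.continuous_extend.comp (by fun_prop)
          source' := by simp
          target' := by simp }
      let p₂ : Path (γ (t m)) (γ (t (m + 1))) :=
        { toFun := fun r => γ.extend (t m + r * (t (m + 1) - t m))
          continuous_toFun := γ.continuous_extend.comp (by fun_prop)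
          source' := by simp
          target' := by simp }
      obtain ⟨j, hj⟩ := ht m
      have hp₂ : ∀ r, p₂ r ∈ star j := fun r => by
        have hr := affine_mem_Icc hle r
        have hI : (t m : ℝ) + r * (t (m + 1) - t m) ∈ I :=
          ⟨(t m).2.1.trans hr.1, hr.2.trans (t (m + 1)).2.2⟩
        change γ.extend _ ∈ star j
        rw [Path.extend_apply _ hI]
        exact hj hr
      have hpp : Path.Homotopic.Quotient.mk p = (Path.Homotopic.Quotient.mk p₁).trans (Path.Homotopic.Quotient.mk p₂) :=
        Path.Homotopic.Quotient.eq.2 (Path.homotopic_trans_of_real γ.continuous_extend p₁ p₂ p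
          (fun _ => rfl) (fun _ => rfl) hp)
      obtain ⟨i, hi⟩ := ih p₁ fun _ => rfl
      have hz : γ (t m) ∈ star j := by simpa using hp₂ 0
      have hjm : Path.Homotopic.Quotient.mk p₁ ∈ tame h j (γ (t m)) := by
        rcases eq_or_ne j i with rfl | hji
        · exact hi
        · obtain rfl : j = !i := by revert hji; cases i <;> cases j <;> simp
          exact mem_tame_not hi hz
      exact ⟨j, hpp ▸ trans_mem_tame hjm p₂ hp₂⟩
  have h1 : γ (t n) = ptA h := by rw [hn n le_rfl]; exact γ.target
  obtain ⟨i, hi⟩ := step n (γ.cast rfl h1) fun r => by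
    have hr : (r : ℝ) = 0 + r * ((t n : ℝ) - 0) := by rw [hn n le_rfl]; simp
    rw [← hr]; exact (Path.extend_apply _ r.2).symm
  refine ⟨i, ?_⟩
  revert hi
  generalize γ (t n) = z at h1
  subst h1
  exact id

/-- A closed path ends over a, which is not in the star of b. Its tame form is therefore a product
of standard loops followed by a loop over the star of a, and the latter is null-homotopic. -/
theorem freeGroup_lift_surjective (h : I) : Function.Surjective
    (FreeGroup.lift ![piClass (loopU h), piClass (loopV h)]) := by
  intro q
  obtain ⟨γ, rfl⟩ := Path.Homotopic.Quotient.mk_surjective q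
  obtain ⟨i, hi⟩ := exists_mem_tame γ
  cases i
  · obtain ⟨s, hs, β, hβ, hγ⟩ := hi
    have : Path.Homotopic.Quotient.mk β = .refl _ := Path.Homotopic.Quotient.eq.2
      (homotopic_of_mem_star β (Path.refl _) hβ fun _ => (zero_lt_one : (0 : I) < 1))
    rw [this, Path.Homotopic.Quotient.trans_refl] at hγ
    rw [hγ]
    exact hs
  · exact absurd (mem_star_true.1 (mem_star_of_mem_tame hi)) (lt_irrefl (0 : I))

end ThetaCyl

/-! ### Local coordinates in `θ₃ × I` -/

/-- Invariance of domain on the line: an injective continuous function is strictly monotone, and the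
intermediate value theorem makes its range open. -/
theorem isOpenEmbedding_of_continuous_injective {g : ℝ → ℝ} (hc : Continuous g)
    (hi : Function.Injective g) : IsOpenEmbedding g := by
  have mono : ∀ {g : ℝ → ℝ}, Continuous g → StrictMono g → IsOpenEmbedding g := by
    intro g hc hg
    have hr : IsOpen (range g) := by
      refine isOpen_iff_mem_nhds.2 ?_
      rintro _ ⟨x, rfl⟩
      refine mem_of_superset (Ioo_mem_nhds (hg (sub_one_lt x)) (hg (lt_add_one x))) ?_
      exact (intermediate_value_Ioo (by linarith) hc.continuousOn).trans (image_subset_range _ _)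
    exact ⟨hg.isEmbedding_of_ordConnected (isPreconnected_range hc).ordConnected, hr⟩
  rcases hc.strictMono_of_inj hi with hg | hg
  · exact mono hc hg
  · have := (Homeomorph.neg ℝ).isOpenEmbedding.comp (mono hc.neg hg.neg)
    convert! this using 1
    funext x
    simp

theorem IsOpenEmbedding.projIcc {g : ℝ → ℝ} (hg : IsOpenEmbedding g)
    (hr : ∀ r, g r ∈ Icc (0 : ℝ) 1) :
    IsOpenEmbedding fun r => Set.projIcc (0 : ℝ) 1 zero_le_one (g r) := by
  have hpr : Continuous (Set.projIcc (0 : ℝ) 1 zero_le_one) := continuous_projIcc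
  have hval : ∀ r, (Set.projIcc (0 : ℝ) 1 zero_le_one (g r) : ℝ) = g r := fun r => by
    rw [projIcc_of_mem _ (hr r)]
  refine ⟨IsEmbedding.of_comp (hpr.comp hg.continuous) continuous_subtype_val ?_, ?_⟩
  · convert! hg.isEmbedding using 1
    exact funext hval
  · convert! hg.isOpen_range.preimage (continuous_subtype_val (p := (· ∈ I))) using 1
    ext x
    constructor
    · rintro ⟨r, rfl⟩; exact ⟨r, (hval r).symm⟩
    · rintro ⟨r, hx⟩; exact ⟨r, Subtype.ext ((hval r).trans hx)⟩

theorem isOpenEmbedding_sigmoid : IsOpenEmbedding unitInterval.sigmoid :=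
  ⟨isEmbedding_sigmoid, by rw [unitInterval.range_sigmoid]; exact isOpen_Ioo⟩

namespace Theta

theorem isOpenEmbedding_edgeParam_comp {Y : Type*} [TopologicalSpace Y] {f : Y → I}
    (hf : IsOpenEmbedding f) (h : ∀ y, f y ∈ Ioo 0 1) (e : Fin 3) :
    IsOpenEmbedding fun y => edgeParam e (f y) := by
  refine ⟨(isClosedEmbedding_edgeParam e).isEmbedding.comp hf.isEmbedding, ?_⟩
  have : range (fun y => edgeParam e (f y)) =
      edgeChart e '' (unitInterval.sigmoid ⁻¹' range f) := by
    ext p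
    constructor
    · rintro ⟨y, rfl⟩
      obtain ⟨s, hs⟩ : f y ∈ range unitInterval.sigmoid := by
        rw [unitInterval.range_sigmoid]; exact h y
      exact ⟨s, ⟨y, hs.symm⟩, congrArg (edgeParam e) hs⟩
    · rintro ⟨s, ⟨y, hy⟩, rfl⟩
      exact ⟨y, congrArg (edgeParam e) hy⟩
  rw [this]
  exact (isOpenEmbedding_edgeChart e).isOpenMap _
    (hf.isOpen_range.preimage isOpenEmbedding_sigmoid.continuous)

end Theta

namespace ThetaCyl

open Theta (coord edgeParam)

theorem isGenericPt_of_mem_openSquare {e : Fin 3} {z : ThetaCyl} (hz : z ∈ openSquare e)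
    (h : z.2 ∈ Ioo 0 1) : IsGenericPt z := by
  obtain ⟨x, h0, h1, hx⟩ := hz
  rw [← unitInterval.range_sigmoid] at h
  obtain ⟨s, hs⟩ : x ∈ range unitInterval.sigmoid := by
    rw [unitInterval.range_sigmoid]; exact ⟨h0, h1⟩
  obtain ⟨t, ht⟩ := h
  refine ⟨fun p => (Theta.edgeChart e (p.1 + s), unitInterval.sigmoid (p.2 + t)), ?_, ?_⟩
  · exact (((Theta.isOpenEmbedding_edgeChart e).comp
      (Homeomorph.addRight s).isOpenEmbedding).prodMap
      (isOpenEmbedding_sigmoid.comp (Homeomorph.addRight t).isOpenEmbedding))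
  · refine Prod.ext ?_ ?_
    · change Theta.edgeChart e (0 + s) = z.1
      rw [zero_add, hx, Theta.edgeChart, hs]; rfl
    · change unitInterval.sigmoid (0 + t) = z.2
      rw [zero_add, ht]

/-- The union of three half-planes as a product. -/
def bookHomeomorph : Book 3 ≃ₜ Theta.Tripod × ℝ where
  toFun p := (⟨p.1.2, p.2⟩, p.1.1)
  invFun q := ⟨(q.2, q.1.1), q.1.2⟩
  left_inv _ := rfl
  right_inv _ := rfl
  continuous_toFun := by
    exact ((continuous_snd.comp continuous_subtype_val).subtype_mk _).prodMk
      (continuous_fst.comp continuous_subtype_val)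
  continuous_invFun := by
    exact (continuous_snd.prodMk (continuous_subtype_val.comp continuous_fst)).subtype_mk _

/-- The chart of the star of the vertex times the sigmoid coordinate of the height is a book chart.
It is translated so that its origin goes to γ t, and its pages contain the points of the open
squares at inner heights. The Boolean b selects the vertex over which γ t lies. -/
theorem crossesRidgeAt {γ : ℝ → ThetaCyl} {t : ℝ} (b : Bool) {i j : Fin 3} (hij : i ≠ j)
    (hγ : ∀ r, (γ r).2 ∈ Ioo 0 1) (ht : Theta.flip b (coord (γ t).1) = 0)
    (hi : ∀ᶠ r in 𝓝[<] t, γ r ∈ openSquare i) (hj : ∀ᶠ r in 𝓝[>] t, γ r ∈ openSquare j) :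
    CrossesRidgeAt γ t := by
  obtain ⟨y₀, hy₀⟩ : (γ t).2 ∈ range unitInterval.sigmoid := by
    rw [unitInterval.range_sigmoid]; exact hγ t
  let φ : Book 3 → ThetaCyl := Prod.map (Theta.starChart b)
    (fun y => unitInterval.sigmoid (y + y₀)) ∘ bookHomeomorph
  have hpage : ∀ {r : ℝ} {e : Fin 3}, γ r ∈ openSquare e → γ r ∈ φ '' Book.page e := by
    rintro r e ⟨x, h0, h1, hx⟩
    change (γ r).1 = edgeParam e x at hx
    obtain ⟨y, hy⟩ : (γ r).2 ∈ range unitInterval.sigmoid := by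
      rw [unitInterval.range_sigmoid]; exact hγ r
    have hflip : Theta.flip b (coord (γ r).1) < 1 := by
      rw [hx, Theta.coord_edgeParam]
      cases b
      · exact h1
      · change (1 - x : ℝ) < 1
        have : (0 : ℝ) < x := h0
        linarith
    refine ⟨bookHomeomorph.symm (Theta.starCoord b (γ r).1, y - y₀), ?_, ?_⟩
    · change 0 < (Theta.starCoord b (γ r).1).1 e
      rw [Theta.starCoord_apply]
      have hpos : (0 : ℝ) < 1 - Theta.flip b (coord (γ r).1) := sub_pos.2 hflip
      have hb : 0 < Theta.bump e (γ r).1 := by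
        rw [hx]; exact Theta.bump_edgeParam_pos e h0 h1
      positivity
    · change Prod.map _ _ (bookHomeomorph (bookHomeomorph.symm _)) = _
      rw [Homeomorph.apply_symm_apply]
      refine Prod.ext (Theta.starChart_starCoord hflip) ?_
      change unitInterval.sigmoid (y - y₀ + y₀) = _
      rw [sub_add_cancel, hy]
  refine ⟨3, le_rfl, φ, ?_, ?_, i, j, hij, hi.mono fun r hr => hpage hr,
    hj.mono fun r hr => hpage hr⟩
  · exact ((Theta.isOpenEmbedding_starChart b).prodMap (isOpenEmbedding_sigmoid.comp
      (Homeomorph.addRight y₀).isOpenEmbedding)).comp bookHomeomorph.isOpenEmbedding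
  · refine Prod.ext ?_ ?_
    · change Theta.starChart b ⟨0, _⟩ = _
      refine (Theta.starChart_eq (i := 0) fun _ _ => rfl).trans ?_
      obtain ⟨e, x, hx⟩ := Theta.exists_eq_edgeParam (γ t).1
      rw [hx, Theta.coord_edgeParam] at ht
      rw [hx]
      change edgeParam 0 (Theta.flip b (Theta.squash 0)) = _
      rw [Theta.squash_zero, ← Theta.flip_flip b x, ht]
      exact Theta.edgeParam_flip_zero b 0 e
    · change unitInterval.sigmoid (0 + y₀) = (γ t).2
      rw [zero_add, hy₀]

/-- The point of the square over the edge `e` with given coordinates in `[0, 1]`. -/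
def pt (e : Fin 3) (x y : ℝ) : ThetaCyl :=
  (edgeParam e (projIcc 0 1 zero_le_one x), projIcc 0 1 zero_le_one y)

theorem continuous_pt (e : Fin 3) : Continuous fun p : ℝ × ℝ => pt e p.1 p.2 := by
  have hpr : Continuous (projIcc (0 : ℝ) 1 zero_le_one) := continuous_projIcc
  exact ((Theta.continuous_edgeParam e).comp (hpr.comp continuous_fst)).prodMk
    (hpr.comp continuous_snd)

theorem pt_eq_pt_iff {e e' : Fin 3} {x y x' y' : ℝ} (hx : x ∈ Icc (0 : ℝ) 1)
    (hy : y ∈ Icc (0 : ℝ) 1) (hx' : x' ∈ Icc (0 : ℝ) 1) (hy' : y' ∈ Icc (0 : ℝ) 1) :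
    pt e x y = pt e' x' y' ↔ x = x' ∧ y = y' ∧ (e = e' ∨ x = 0 ∨ x = 1) := by
  rw [pt, pt, Prod.ext_iff, Theta.edgeParam_eq_edgeParam_iff, projIcc_of_mem _ hx,
    projIcc_of_mem _ hx', projIcc_of_mem _ hy, projIcc_of_mem _ hy']
  simp only [Subtype.ext_iff, Icc.coe_zero, Icc.coe_one]
  tauto

theorem isOpenEmbedding_pt (e : Fin 3) {f g : ℝ → ℝ} (hf : Continuous f)
    (hf' : Function.Injective f) (hf01 : ∀ r, f r ∈ Ioo (0 : ℝ) 1) (hg : Continuous g)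
    (hg' : Function.Injective g) (hg01 : ∀ r, g r ∈ Icc (0 : ℝ) 1) :
    IsOpenEmbedding fun p : ℝ × ℝ => pt e (f p.1) (g p.2) := by
  refine (Theta.isOpenEmbedding_edgeParam_comp (IsOpenEmbedding.projIcc
    (isOpenEmbedding_of_continuous_injective hf hf') fun r => Ioo_subset_Icc_self (hf01 r))
    (fun r => ?_) e).prodMap
    (IsOpenEmbedding.projIcc (isOpenEmbedding_of_continuous_injective hg hg') hg01)
  rw [projIcc_of_mem _ (Ioo_subset_Icc_self (hf01 r))]
  exact hf01 r

end ThetaCyl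

/-! ### Transversality of the two arcs over e₀ -/

theorem TransverseAt.symm {X : Type*} [TopologicalSpace X] {γ : ℝ → X} {s t : ℝ}
    (h : TransverseAt γ s t) : TransverseAt γ t s := by
  obtain ⟨φ, hφ, h1, h2, h3, h4⟩ := h
  refine ⟨φ ∘ Prod.swap, hφ.comp (Homeomorph.prodComm ℝ ℝ).isOpenEmbedding, h2, h1, ?_, ?_⟩
  · filter_upwards [h4] with r
    rintro ⟨p, hp, hr⟩
    exact ⟨p.swap, hp, hr⟩
  · filter_upwards [h3] with r
    rintro ⟨p, hp, hr⟩
    exact ⟨p.swap, hp, hr⟩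

/-- The homeomorphism of the plane that takes the coordinate axes to the diagonals. -/
def diagonalHomeomorph : ℝ × ℝ ≃ₜ ℝ × ℝ where
  toFun p := (p.2 - p.1, p.1 + p.2)
  invFun p := ((p.2 - p.1) / 2, (p.1 + p.2) / 2)
  left_inv p := by ext <;> simp <;> ring
  right_inv p := by ext <;> simp <;> ring
  continuous_toFun := by fun_prop
  continuous_invFun := by fun_prop

namespace ThetaCyl

/-- Near a zero x₀ of cos(ωx) the graphs of 1/2 ∓ cos(ωx)/6 become the two diagonals after separate
changes of the coordinates x and y. A linear map then takes the diagonals to the axes. The bounds on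
ωx₀ keep a half-wave around x₀ within (0, 1). -/
theorem transverseAt_of_cos {γ : ℝ → ThetaCyl} {e : Fin 3} {ω x₀ s t : ℝ} (hω : 0 < ω)
    (h0 : Real.cos (ω * x₀) = 0) (h1 : Real.pi / 2 ≤ ω * x₀) (h2 : ω * x₀ + Real.pi / 2 ≤ ω)
    {f g : ℝ → ℝ} (hf : ContinuousAt f s) (hg : ContinuousAt g t) (hfs : f s = x₀) (hgt : g t = x₀)
    (hs : ∀ᶠ r in 𝓝 s, γ r = pt e (f r) (1 / 2 - Real.cos (ω * f r) / 6))
    (ht : ∀ᶠ r in 𝓝 t, γ r = pt e (g r) (1 / 2 + Real.cos (ω * g r) / 6)) :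
    TransverseAt γ s t := by
  set ε := Real.sin (ω * x₀) with hε
  have hε1 : ε ^ 2 = 1 := by
    have := Real.sin_sq_add_cos_sq (ω * x₀)
    rw [h0] at this; simpa using this
  have hε0 : ε ≠ 0 := fun h => by rw [h] at hε1; norm_num at hε1
  -- The function A runs over the half-wave around x₀, and B over the corresponding heights. The
  -- sign ε = sin(ωx₀) = ±1 records whether the cosine decreases or increases at x₀. With these
  -- choices 1/2 + cos(ω A q)/6 = B q and 1/2 − cos(ω A q)/6 = B (−q).
  let A : ℝ → ℝ := fun r => x₀ + Real.arctan r / ω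
  let B : ℝ → ℝ := fun r => 1 / 2 - ε * Real.sin (Real.arctan r) / 6
  have hA : ∀ r, ω * A r = ω * x₀ + Real.arctan r := fun r => by simp only [A]; field_simp
  have hcos : ∀ r, Real.cos (ω * A r) = - (ε * Real.sin (Real.arctan r)) := fun r => by
    rw [hA, Real.cos_add, h0]; ring
  have hφ : IsOpenEmbedding fun p : ℝ × ℝ => pt e (A p.1) (B p.2) := by
    refine isOpenEmbedding_pt e (by fun_prop) (fun a b hab => ?_) (fun r => ?_) (by fun_prop)
      (fun a b hab => ?_) fun r => ?_
    · simp only [A, add_right_inj] at hab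
      exact Real.arctan_injective ((div_left_inj' hω.ne').1 hab)
    · have l := Real.neg_pi_div_two_lt_arctan r
      have u := Real.arctan_lt_pi_div_two r
      have := hA r
      constructor
      · refine pos_of_mul_pos_right (a := ω) ?_ hω.le
        linarith
      · refine lt_of_mul_lt_mul_left (a := ω) ?_ hω.le
        linarith
    · have hab' : Real.sin (Real.arctan a) = Real.sin (Real.arctan b) := by
        refine mul_left_cancel₀ hε0 ?_
        simp only [B] at hab
        linarith
      exact Real.arctan_injective (Real.injOn_sin ⟨(Real.neg_pi_div_two_lt_arctan a).le,
        (Real.arctan_lt_pi_div_two a).le⟩ ⟨(Real.neg_pi_div_two_lt_arctan b).le,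
        (Real.arctan_lt_pi_div_two b).le⟩ hab')
    · have h3 : |ε * Real.sin (Real.arctan r)| ≤ 1 := by
        rw [abs_mul]
        exact mul_le_one₀ (Real.abs_sin_le_one _) (abs_nonneg _) (Real.abs_sin_le_one _)
      obtain ⟨h3, h4⟩ := abs_le.1 h3
      constructor <;> simp only [B] <;> linarith
  have hφ0 : pt e (A 0) (B 0) = pt e x₀ (1 / 2) := by simp [A, B]
  have near : ∀ {f : ℝ → ℝ} {s : ℝ}, ContinuousAt f s → f s = x₀ →
      ∀ᶠ r in 𝓝 s, ∃ q, f r = A q := by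
    intro f s hf hfs
    have hc : ContinuousAt (fun r => ω * f r - ω * x₀) s := by fun_prop
    have hm : Ioo (-(Real.pi / 2)) (Real.pi / 2) ∈ 𝓝 (ω * f s - ω * x₀) := by
      rw [hfs, sub_self]
      exact Ioo_mem_nhds (by linarith [Real.pi_pos]) (by linarith [Real.pi_pos])
    filter_upwards [hc hm] with r hr
    refine ⟨Real.tan (ω * f r - ω * x₀), ?_⟩
    simp only [A]
    rw [Real.arctan_tan hr.1 hr.2]
    field_simp
    ring
  refine ⟨_, hφ.comp diagonalHomeomorph.isOpenEmbedding, ?_, ?_, ?_, ?_⟩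
  · rw [hs.self_of_nhds, hfs, h0]
    simpa [diagonalHomeomorph] using hφ0
  · rw [ht.self_of_nhds, hgt, h0]
    simpa [diagonalHomeomorph] using hφ0
  · filter_upwards [hs, near hf hfs] with r hr hq
    obtain ⟨q, hq⟩ := hq
    refine ⟨(-q, 0), rfl, ?_⟩
    change pt e (A (0 - -q)) (B (-q + 0)) = γ r
    rw [hr, hq, hcos]
    simp only [zero_sub, neg_neg, add_zero, B, Real.arctan_neg, Real.sin_neg]
    congr 1
    ring
  · filter_upwards [ht, near hg hgt] with r hr hq
    obtain ⟨q, hq⟩ := hq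
    refine ⟨(0, q), rfl, ?_⟩
    change pt e (A (q - 0)) (B (0 + q)) = γ r
    rw [hr, hq, hcos]
    simp only [sub_zero, zero_add, B]
    congr 1
    ring

end ThetaCyl

/-! ### The knots `K_n` -/

namespace ThetaCyl

/-- The height of the arc of `K_n` in the square over `e₀` from `(a, 1/3)` to `(b, 2/3)`. -/
def low (n : ℕ) (x : ℝ) : ℝ := 1 / 2 - Real.cos ((2 * n + 1) * Real.pi * x) / 6

/-- The height of the arc of `K_n` in the square over `e₀` from `(a, 2/3)` to `(b, 1/3)`. -/
def high (n : ℕ) (x : ℝ) : ℝ := 1 / 2 + Real.cos ((2 * n + 1) * Real.pi * x) / 6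

theorem cos_mul_pi (n : ℕ) : Real.cos ((2 * n + 1) * Real.pi * 1) = -1 := by
  rw [← Real.cos_nat_mul_two_pi_add_pi n]; ring_nf

theorem low_zero (n : ℕ) : low n 0 = 1 / 3 := by norm_num [low]

theorem low_one (n : ℕ) : low n 1 = 2 / 3 := by rw [low, cos_mul_pi]; norm_num

theorem high_zero (n : ℕ) : high n 0 = 2 / 3 := by norm_num [high]

theorem high_one (n : ℕ) : high n 1 = 1 / 3 := by rw [high, cos_mul_pi]; norm_num

theorem low_mem (n : ℕ) (x : ℝ) : low n x ∈ Ioo (0 : ℝ) 1 := by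
  have h1 := Real.neg_one_le_cos ((2 * n + 1) * Real.pi * x)
  have h2 := Real.cos_le_one ((2 * n + 1) * Real.pi * x)
  constructor <;> rw [low] <;> linarith

theorem high_mem (n : ℕ) (x : ℝ) : high n x ∈ Ioo (0 : ℝ) 1 := by
  have h1 := Real.neg_one_le_cos ((2 * n + 1) * Real.pi * x)
  have h2 := Real.cos_le_one ((2 * n + 1) * Real.pi * x)
  constructor <;> rw [high] <;> linarith

/-- One period of the curve underlying `K_n`. -/
def period (n : ℕ) (t : ℝ) : ThetaCyl :=
  if t ≤ 1 / 4 then pt 0 (4 * t) (low n (4 * t))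
  else if t ≤ 1 / 2 then pt 1 (2 - 4 * t) (2 / 3)
  else if t ≤ 3 / 4 then pt 0 (4 * t - 2) (high n (4 * t - 2))
  else pt 2 (4 - 4 * t) (1 / 3)

theorem pt_zero (e e' : Fin 3) (y : ℝ) : pt e 0 y = pt e' 0 y := by
  simp only [pt, projIcc_left]
  exact congrArg (Prod.mk · _) ((Theta.edgeParam_zero e).trans (Theta.edgeParam_zero e').symm)

theorem pt_one (e e' : Fin 3) (y : ℝ) : pt e 1 y = pt e' 1 y := by
  simp only [pt, projIcc_right]
  exact congrArg (Prod.mk · _) ((Theta.edgeParam_one e).trans (Theta.edgeParam_one e').symm)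

theorem period_quarter (n : ℕ) {t : ℝ} (ht : t = 1 / 4) :
    pt 0 (4 * t) (low n (4 * t)) = pt 1 (2 - 4 * t) (2 / 3) := by
  rw [ht, show (4 * (1 / 4) : ℝ) = 1 by norm_num, show (2 - 1 : ℝ) = 1 by norm_num, low_one]
  exact pt_one _ _ _

theorem period_half (n : ℕ) {t : ℝ} (ht : t = 1 / 2) :
    pt 1 (2 - 4 * t) (2 / 3) = pt 0 (4 * t - 2) (high n (4 * t - 2)) := by
  rw [ht, show (2 - 4 * (1 / 2) : ℝ) = 0 by norm_num, show (4 * (1 / 2) - 2 : ℝ) = 0 by norm_num,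
    high_zero]
  exact pt_zero _ _ _

theorem period_threeQuarters (n : ℕ) {t : ℝ} (ht : t = 3 / 4) :
    pt 0 (4 * t - 2) (high n (4 * t - 2)) = pt 2 (4 - 4 * t) (1 / 3) := by
  rw [ht, show (4 - 4 * (3 / 4) : ℝ) = 1 by norm_num, show (4 * (3 / 4) - 2 : ℝ) = 1 by norm_num,
    high_one]
  exact pt_one _ _ _

theorem continuous_period (n : ℕ) : Continuous (period n) := by
  have hp : ∀ (e : Fin 3) {f g : ℝ → ℝ}, Continuous f → Continuous g →
      Continuous fun t => pt e (f t) (g t) := fun e _ _ hf hg =>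
    (continuous_pt e).comp (hf.prodMk hg)
  have hl : Continuous (low n) := by unfold low; fun_prop
  have hh : Continuous (high n) := by unfold high; fun_prop
  refine Continuous.if_le (hp 0 (by fun_prop) (by fun_prop)) (Continuous.if_le
    (hp 1 (by fun_prop) (by fun_prop)) (Continuous.if_le (hp 0 (by fun_prop) (by fun_prop))
    (hp 2 (by fun_prop) (by fun_prop)) continuous_id continuous_const fun t ht => ?_)
    continuous_id continuous_const fun t ht => ?_) continuous_id continuous_const fun t ht => ?_
  · exact period_threeQuarters n ht
  · rw [if_pos (by linarith : t ≤ 3 / 4)]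
    exact period_half n ht
  · rw [if_pos (by linarith : t ≤ 1 / 2)]
    exact period_quarter n ht

/-- The curve underlying `K_n`. -/
def curve (n : ℕ) (t : ℝ) : ThetaCyl := period n (Int.fract t)

theorem period_of_mem₀ (n : ℕ) {t : ℝ} (ht : t ∈ Icc (0 : ℝ) (1 / 4)) :
    period n t = pt 0 (4 * t) (low n (4 * t)) := if_pos ht.2

theorem period_of_mem₁ (n : ℕ) {t : ℝ} (ht : t ∈ Icc (1 / 4 : ℝ) (1 / 2)) :
    period n t = pt 1 (2 - 4 * t) (2 / 3) := by
  rw [period, if_pos ht.2]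
  split_ifs with h
  · exact period_quarter n (le_antisymm h ht.1)
  · rfl

theorem period_of_mem₂ (n : ℕ) {t : ℝ} (ht : t ∈ Icc (1 / 2 : ℝ) (3 / 4)) :
    period n t = pt 0 (4 * t - 2) (high n (4 * t - 2)) := by
  rw [period, if_neg (by linarith [ht.1])]
  split_ifs with h h'
  · exact period_half n (le_antisymm h ht.1)
  · rfl
  · exact absurd ht.2 h'

theorem period_of_mem₃ (n : ℕ) {t : ℝ} (ht : t ∈ Icc (3 / 4 : ℝ) 1) :
    period n t = pt 2 (4 - 4 * t) (1 / 3) := by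
  rw [period, if_neg (by linarith [ht.1]), if_neg (by linarith [ht.1])]
  split_ifs with h
  · exact period_threeQuarters n (le_antisymm h ht.1)
  · rfl

theorem period_zero_eq_one (n : ℕ) : period n 0 = period n 1 := by
  rw [period_of_mem₀ n ⟨le_rfl, by norm_num⟩, period_of_mem₃ n ⟨by norm_num, le_rfl⟩, mul_zero,
    low_zero, mul_one, sub_self]
  exact pt_zero _ _ _

theorem curve_sub_int (n : ℕ) (t : ℝ) (m : ℤ) : curve n (t - m) = curve n t := by
  rw [curve, Int.fract_sub_intCast]; rfl

theorem curve_eq_period (n : ℕ) {t : ℝ} (ht : t ∈ Icc (0 : ℝ) 1) : curve n t = period n t := by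
  rcases ht.2.lt_or_eq with h | rfl
  · rw [curve, Int.fract_eq_self.2 ⟨ht.1, h⟩]
  · rw [curve, Int.fract_one, period_zero_eq_one]

theorem continuous_curve (n : ℕ) : Continuous (curve n) :=
  (continuous_period n).continuousOn.comp_fract'' (period_zero_eq_one n)

theorem curve_of_mem₀ (n : ℕ) {t : ℝ} (ht : t ∈ Icc (0 : ℝ) (1 / 4)) :
    curve n t = pt 0 (4 * t) (low n (4 * t)) := by
  rw [curve_eq_period n ⟨ht.1, by linarith [ht.2]⟩, period_of_mem₀ n ht]

theorem curve_of_mem₁ (n : ℕ) {t : ℝ} (ht : t ∈ Icc (1 / 4 : ℝ) (1 / 2)) :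
    curve n t = pt 1 (2 - 4 * t) (2 / 3) := by
  rw [curve_eq_period n ⟨by linarith [ht.1], by linarith [ht.2]⟩, period_of_mem₁ n ht]

theorem curve_of_mem₂ (n : ℕ) {t : ℝ} (ht : t ∈ Icc (1 / 2 : ℝ) (3 / 4)) :
    curve n t = pt 0 (4 * t - 2) (high n (4 * t - 2)) := by
  rw [curve_eq_period n ⟨by linarith [ht.1], by linarith [ht.2]⟩, period_of_mem₂ n ht]

theorem curve_of_mem₃ (n : ℕ) {t : ℝ} (ht : t ∈ Icc (3 / 4 : ℝ) 1) :
    curve n t = pt 2 (4 - 4 * t) (1 / 3) := by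
  rw [curve_eq_period n ⟨by linarith [ht.1], ht.2⟩, period_of_mem₃ n ht]

theorem pt_mem_openSquare {e : Fin 3} {x : ℝ} (hx : x ∈ Ioo (0 : ℝ) 1) (y : ℝ) :
    pt e x y ∈ openSquare e := by
  refine ⟨projIcc 0 1 zero_le_one x, ?_, ?_, rfl⟩ <;>
    rw [projIcc_of_mem _ (Ioo_subset_Icc_self hx)]
  · exact hx.1
  · exact hx.2

theorem curve_mem_openSquare₀ {n : ℕ} {t : ℝ} (m : ℤ) (ht : t - m ∈ Ioo (0 : ℝ) (1 / 4)) :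
    curve n t ∈ openSquare 0 := by
  rw [← curve_sub_int n t m, curve_of_mem₀ n (Ioo_subset_Icc_self ht)]
  exact pt_mem_openSquare ⟨by linarith [ht.1], by linarith [ht.2]⟩ _

theorem curve_mem_openSquare₁ {n : ℕ} {t : ℝ} (m : ℤ) (ht : t - m ∈ Ioo (1 / 4 : ℝ) (1 / 2)) :
    curve n t ∈ openSquare 1 := by
  rw [← curve_sub_int n t m, curve_of_mem₁ n (Ioo_subset_Icc_self ht)]
  exact pt_mem_openSquare ⟨by linarith [ht.2], by linarith [ht.1]⟩ _

theorem curve_mem_openSquare₂ {n : ℕ} {t : ℝ} (m : ℤ) (ht : t - m ∈ Ioo (1 / 2 : ℝ) (3 / 4)) :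
    curve n t ∈ openSquare 0 := by
  rw [← curve_sub_int n t m, curve_of_mem₂ n (Ioo_subset_Icc_self ht)]
  exact pt_mem_openSquare ⟨by linarith [ht.1], by linarith [ht.2]⟩ _

theorem curve_mem_openSquare₃ {n : ℕ} {t : ℝ} (m : ℤ) (ht : t - m ∈ Ioo (3 / 4 : ℝ) 1) :
    curve n t ∈ openSquare 2 := by
  rw [← curve_sub_int n t m, curve_of_mem₃ n (Ioo_subset_Icc_self ht)]
  exact pt_mem_openSquare ⟨by linarith [ht.2], by linarith [ht.1]⟩ _

/-- Half-open quarters assign each parameter to exactly one arc, so coincidences of the curve reduce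
to arithmetic of coordinates. -/
theorem exists_curve_eq_pt (n : ℕ) {t : ℝ} (ht : t ∈ Ico (0 : ℝ) 1) : ∃ (e : Fin 3) (x y : ℝ),
    curve n t = pt e x y ∧ x ∈ Icc (0 : ℝ) 1 ∧ y ∈ Ioo (0 : ℝ) 1 ∧
    ((t < 1 / 4 ∧ e = 0 ∧ x = 4 * t ∧ y = low n x) ∨
      (1 / 4 ≤ t ∧ t < 1 / 2 ∧ e = 1 ∧ x = 2 - 4 * t ∧ y = 2 / 3) ∨
      (1 / 2 ≤ t ∧ t < 3 / 4 ∧ e = 0 ∧ x = 4 * t - 2 ∧ y = high n x) ∨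
      (3 / 4 ≤ t ∧ e = 2 ∧ x = 4 - 4 * t ∧ y = 1 / 3)) := by
  have h0 := ht.1
  have h1 := ht.2
  rcases lt_or_ge t (1 / 4) with h | h
  · exact ⟨_, _, _, curve_of_mem₀ n ⟨ht.1, h.le⟩, ⟨by linarith, by linarith⟩, low_mem _ _,
      .inl ⟨h, rfl, rfl, rfl⟩⟩
  rcases lt_or_ge t (1 / 2) with h' | h'
  · exact ⟨_, _, _, curve_of_mem₁ n ⟨h, h'.le⟩, ⟨by linarith, by linarith⟩, by norm_num,
      .inr (.inl ⟨h, h', rfl, rfl, rfl⟩)⟩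
  rcases lt_or_ge t (3 / 4) with h'' | h''
  · exact ⟨_, _, _, curve_of_mem₂ n ⟨h', h''.le⟩, ⟨by linarith, by linarith⟩, high_mem _ _,
      .inr (.inr (.inl ⟨h', h'', rfl, rfl, rfl⟩))⟩
  · exact ⟨_, _, _, curve_of_mem₃ n ⟨h'', h1.le⟩, ⟨by linarith, by linarith⟩, by norm_num,
      .inr (.inr (.inr ⟨h'', rfl, rfl, rfl⟩))⟩

theorem curve_height_mem (n : ℕ) (t : ℝ) : (curve n t).2 ∈ Ioo 0 1 := by
  rw [← curve_sub_int n t ⌊t⌋]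
  obtain ⟨e, x, y, h, -, hy, -⟩ := exists_curve_eq_pt n ⟨Int.fract_nonneg t, Int.fract_lt_one t⟩
  change (curve n (Int.fract t)).2 ∈ _
  rw [h]
  change projIcc 0 1 zero_le_one y ∈ _
  rw [projIcc_of_mem _ (Ioo_subset_Icc_self hy)]
  exact hy

/-- Equal points have equal coordinates and, away from the vertices, equal edges. Only the first and
third quarters can share points; equal x-coordinates then give t = s + 1/2, and the arcs of opposite
deviation from the height 1/2 meet only where the cosine vanishes. -/
theorem curve_eq_curve {n : ℕ} {s t : ℝ} (hs : s ∈ Ico (0 : ℝ) 1) (ht : t ∈ Ico (0 : ℝ) 1)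
    (hst : s < t) (h : curve n s = curve n t) :
    t = s + 1 / 2 ∧ s < 1 / 4 ∧ Real.cos ((2 * n + 1) * Real.pi * (4 * s)) = 0 := by
  obtain ⟨e, x, y, he, hx, hy, hc⟩ := exists_curve_eq_pt n hs
  obtain ⟨e', x', y', he', hx', hy', hc'⟩ := exists_curve_eq_pt n ht
  rw [he, he', pt_eq_pt_iff hx (Ioo_subset_Icc_self hy) hx' (Ioo_subset_Icc_self hy')] at h
  obtain ⟨h1, h2, h3⟩ := h
  obtain ⟨h4, h5⟩ := hs
  obtain ⟨h6, h7⟩ := ht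
  have h8 : t = s + 1 / 2 ∧ s < 1 / 4 ∧ y = low n x ∧ y' = high n x' ∧ x = 4 * s := by
    rcases hc with ⟨a1, rfl, a2, a3⟩ | ⟨a1, a2, rfl, a3, a4⟩ | ⟨a1, a2, rfl, a3, a4⟩ |
      ⟨a1, rfl, a2, a3⟩ <;>
    rcases hc' with ⟨b1, rfl, b2, b3⟩ | ⟨b1, b2, rfl, b3, b4⟩ | ⟨b1, b2, rfl, b3, b4⟩ |
      ⟨b1, rfl, b2, b3⟩ <;>
    first
    | (exfalso; linarith)
    | exact ⟨by linarith, by linarith, by assumption, by assumption, by assumption⟩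
    | (exfalso; rcases h3 with h3 | h3 | h3
       · revert h3; decide
       · linarith
       · linarith)
  obtain ⟨h9, h10, h11, h12, h13⟩ := h8
  refine ⟨h9, h10, ?_⟩
  rw [h11, h12, ← h1, low, high, h13] at h2
  linarith

theorem curve_eq_curve_add_half {n : ℕ} {s : ℝ} (h0 : 0 ≤ s) (hs : s < 1 / 4)
    (h : Real.cos ((2 * n + 1) * Real.pi * (4 * s)) = 0) : curve n s = curve n (s + 1 / 2) := by
  rw [curve_of_mem₀ n ⟨h0, hs.le⟩, curve_of_mem₂ n ⟨by linarith, by linarith⟩,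
    show 4 * (s + 1 / 2) - 2 = 4 * s by ring, low, high, h]
  norm_num

/-- The parameter of the first passage of `K_n` through its crossing number `k`. -/
def crossingParam (n k : ℕ) : ℝ := (2 * k + 1) / (8 * (2 * n + 1))

/-- The zeros are given by 4(2n+1)s = k + 1/2 with an integer k, and 0 ≤ s < 1/4 leaves exactly k =
0, …, 2n. -/
theorem cos_eq_zero_iff_crossingParam {n : ℕ} {s : ℝ} :
    0 ≤ s ∧ s < 1 / 4 ∧ Real.cos ((2 * n + 1) * Real.pi * (4 * s)) = 0 ↔
      ∃ k < 2 * n + 1, crossingParam n k = s := by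
  have hpi := Real.pi_pos
  have hn : (0 : ℝ) < 2 * n + 1 := by positivity
  have key : ∀ k : ℝ, (2 * n + 1) * Real.pi * (4 * s) = (2 * k + 1) * Real.pi / 2 ↔
      (2 * k + 1) / (8 * (2 * n + 1)) = s := fun k => by
    rw [div_eq_iff (by positivity)]
    constructor <;> intro h
    · refine mul_right_cancel₀ hpi.ne' ?_
      linarith
    · rw [h]; ring
  constructor
  · rintro ⟨h0, h1, h2⟩
    obtain ⟨k, hk⟩ := Real.cos_eq_zero_iff.1 h2
    rw [key, div_eq_iff (by positivity)] at hk
    have hk0 : (-1 : ℝ) < k := by nlinarith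
    have hk1 : (k : ℝ) < 2 * n + 1 := by nlinarith
    lift k to ℕ using by have : (-1 : ℤ) < k := by exact_mod_cast hk0
                         omega
    refine ⟨k, by exact_mod_cast hk1, ?_⟩
    rw [crossingParam, div_eq_iff (by positivity)]
    exact_mod_cast hk
  · rintro ⟨k, hk, rfl⟩
    have hk' : (k : ℝ) + 1 ≤ 2 * n + 1 := by exact_mod_cast hk
    refine ⟨by unfold crossingParam; positivity, ?_, Real.cos_eq_zero_iff.2 ⟨k, ?_⟩⟩
    · rw [crossingParam, div_lt_iff₀ (by positivity)]
      linarith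
    · exact_mod_cast (key k).2 rfl

theorem crossings_curve (n : ℕ) :
    {p : ℝ × ℝ | 0 ≤ p.1 ∧ p.1 < p.2 ∧ p.2 < 1 ∧ curve n p.1 = curve n p.2} =
      (fun k => (crossingParam n k, crossingParam n k + 1 / 2)) '' (Finset.range (2 * n + 1)) := by
  ext ⟨s, t⟩
  simp only [mem_ofPred_eq, mem_image, Finset.coe_range, mem_Iio, Prod.mk.injEq]
  constructor
  · rintro ⟨h0, h1, h2, h3⟩
    obtain ⟨rfl, h4, h5⟩ := curve_eq_curve ⟨h0, h1.trans h2⟩ ⟨h0.trans h1.le, h2⟩ h1 h3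
    obtain ⟨k, hk, rfl⟩ := cos_eq_zero_iff_crossingParam.1 ⟨h0, h4, h5⟩
    exact ⟨k, hk, rfl, rfl⟩
  · rintro ⟨k, hk, rfl, rfl⟩
    obtain ⟨h0, h1, h2⟩ := cos_eq_zero_iff_crossingParam.2 ⟨k, hk, rfl⟩
    exact ⟨h0, by linarith, by linarith, curve_eq_curve_add_half h0 h1 h2⟩

theorem transverseAt_curve {n : ℕ} {s t : ℝ} (hs : s ∈ Ico (0 : ℝ) 1) (ht : t ∈ Ico (0 : ℝ) 1)
    (hst : s < t) (h : curve n s = curve n t) : TransverseAt (curve n) s t := by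
  obtain ⟨rfl, h1, h2⟩ := curve_eq_curve hs ht hst h
  obtain ⟨k, hk, rfl⟩ := cos_eq_zero_iff_crossingParam.1 ⟨hs.1, h1, h2⟩
  have hpi := Real.pi_pos
  have hk' : (k : ℝ) + 1 ≤ 2 * n + 1 := by exact_mod_cast hk
  have hpos : 0 < crossingParam n k := by unfold crossingParam; positivity
  have hval : (2 * n + 1) * Real.pi * (4 * crossingParam n k) = (2 * k + 1) * (Real.pi / 2) := by
    rw [crossingParam]; field_simp; ring
  refine transverseAt_of_cos (e := 0) (ω := (2 * n + 1) * Real.pi) (x₀ := 4 * crossingParam n k)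
    (f := fun r => 4 * r) (g := fun r => 4 * r - 2) (by positivity) h2 ?_ ?_ (by fun_prop)
    (by fun_prop) rfl (by ring) ?_ ?_
  -- At the crossing number k the phase is (2k+1)π/2. Because 0 ≤ k ≤ 2n, it is at least π/2 away
  -- from 0 and from (2n+1)π.
  · rw [hval]
    have : (0 : ℝ) ≤ k * Real.pi := by positivity
    linarith
  · rw [hval]
    nlinarith
  · filter_upwards [Icc_mem_nhds hpos h1] with r hr
    exact curve_of_mem₀ n hr
  · filter_upwards [Icc_mem_nhds (show (1 / 2 : ℝ) < crossingParam n k + 1 / 2 by linarith)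
      (show crossingParam n k + 1 / 2 < (3 / 4 : ℝ) by linarith)] with r hr
    exact curve_of_mem₂ n hr

/-- At multiples of 1/4 the curve is over a vertex and passes between squares of different edges. At
all other parameters it is in an open square, and its height is always strictly between 0 and 1. -/
theorem curve_generic_or_ridge (n : ℕ) (t : ℝ) :
    IsGenericPt (curve n t) ∨ CrossesRidgeAt (curve n) t := by
  have hh := curve_height_mem n
  have hf : curve n t = curve n (t - ⌊t⌋) := (curve_sub_int n t ⌊t⌋).symm
  have gen : ∀ {e : Fin 3}, curve n t ∈ openSquare e →
      IsGenericPt (curve n t) ∨ CrossesRidgeAt (curve n) t := fun h =>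
    .inl (isGenericPt_of_mem_openSquare h (hh t))
  have h0 : 0 ≤ t - ⌊t⌋ := Int.fract_nonneg t
  have h1 : t - ⌊t⌋ < 1 := Int.fract_lt_one t
  have left : ∀ᶠ r in 𝓝[<] t, r ∈ Ioo (t - 1 / 4) t := Ioo_mem_nhdsLT (by linarith)
  have right : ∀ᶠ r in 𝓝[>] t, r ∈ Ioo t (t + 1 / 4) := Ioo_mem_nhdsGT (by linarith)
  have hA : ∀ {e : Fin 3} {x y : ℝ}, x = 0 → curve n t = pt e x y →
      Theta.flip false (Theta.coord (curve n t).1) = 0 := by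
    rintro e x y rfl h
    rw [h]
    change projIcc (0 : ℝ) 1 zero_le_one 0 = 0
    rw [projIcc_left]; rfl
  have hB : ∀ {e : Fin 3} {x y : ℝ}, x = 1 → curve n t = pt e x y →
      Theta.flip true (Theta.coord (curve n t).1) = 0 := by
    rintro e x y rfl h
    rw [h]
    change unitInterval.symm (projIcc (0 : ℝ) 1 zero_le_one 1) = 0
    rw [projIcc_right]; exact unitInterval.symm_one
  rcases h0.eq_or_lt with g0 | g0
  · refine .inr (crossesRidgeAt false (i := 2) (j := 0) (by decide) hh
      (hA (by linarith) (hf.trans (curve_of_mem₀ n ⟨h0, by linarith⟩))) ?_ ?_)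
    · filter_upwards [left] with r hr
      -- Just before an integer the curve is in the last quarter of the preceding period.
      refine curve_mem_openSquare₃ (⌊t⌋ - 1) ?_
      push_cast
      constructor <;> linarith [hr.1, hr.2]
    · filter_upwards [right] with r hr
      exact curve_mem_openSquare₀ ⌊t⌋ ⟨by linarith [hr.1], by linarith [hr.2]⟩
  rcases lt_trichotomy (t - ⌊t⌋) (1 / 4) with g1 | g1 | g1
  · exact gen (curve_mem_openSquare₀ ⌊t⌋ ⟨g0, g1⟩)
  · refine .inr (crossesRidgeAt true (i := 0) (j := 1) (by decide) hh
      (hB (by linarith) (hf.trans (curve_of_mem₁ n ⟨g1.ge, by linarith⟩))) ?_ ?_)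
    · filter_upwards [left] with r hr
      exact curve_mem_openSquare₀ ⌊t⌋ ⟨by linarith [hr.1], by linarith [hr.2]⟩
    · filter_upwards [right] with r hr
      exact curve_mem_openSquare₁ ⌊t⌋ ⟨by linarith [hr.1], by linarith [hr.2]⟩
  rcases lt_trichotomy (t - ⌊t⌋) (1 / 2) with g2 | g2 | g2
  · exact gen (curve_mem_openSquare₁ ⌊t⌋ ⟨g1, g2⟩)
  · refine .inr (crossesRidgeAt false (i := 1) (j := 0) (by decide) hh
      (hA (by linarith) (hf.trans (curve_of_mem₂ n ⟨g2.ge, by linarith⟩))) ?_ ?_)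
    · filter_upwards [left] with r hr
      exact curve_mem_openSquare₁ ⌊t⌋ ⟨by linarith [hr.1], by linarith [hr.2]⟩
    · filter_upwards [right] with r hr
      exact curve_mem_openSquare₂ ⌊t⌋ ⟨by linarith [hr.1], by linarith [hr.2]⟩
  rcases lt_trichotomy (t - ⌊t⌋) (3 / 4) with g3 | g3 | g3
  · exact gen (curve_mem_openSquare₂ ⌊t⌋ ⟨g2, g3⟩)
  · refine .inr (crossesRidgeAt true (i := 0) (j := 2) (by decide) hh
      (hB (by linarith) (hf.trans (curve_of_mem₃ n ⟨g3.ge, by linarith⟩))) ?_ ?_)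
    · filter_upwards [left] with r hr
      exact curve_mem_openSquare₂ ⌊t⌋ ⟨by linarith [hr.1], by linarith [hr.2]⟩
    · filter_upwards [right] with r hr
      exact curve_mem_openSquare₃ ⌊t⌋ ⟨by linarith [hr.1], by linarith [hr.2]⟩
  · exact gen (curve_mem_openSquare₃ ⌊t⌋ ⟨g3, h1⟩)

/-- The knot `K_n`. -/
def standardKnot (n : ℕ) : Knot ThetaCyl where
  toFun := curve n
  continuous_toFun := continuous_curve n
  periodic t := by rw [curve, Int.fract_add_one]; rfl
  finite_crossings := by
    rw [crossings_curve]
    exact (Finset.finite_toSet _).image _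
  double r hr s hs t ht h1 h2 := by
    have half : ∀ {s t : ℝ}, s ∈ Ico (0 : ℝ) 1 → t ∈ Ico (0 : ℝ) 1 → curve n s = curve n t →
        s = t ∨ t = s + 1 / 2 ∨ s = t + 1 / 2 := by
      intro s t hs ht h
      rcases lt_trichotomy s t with hst | hst | hst
      · exact .inr (.inl (curve_eq_curve hs ht hst h).1)
      · exact .inl hst
      · exact .inr (.inr (curve_eq_curve ht hs hst h.symm).1)
    have h3 := half hr hs h1
    have h4 := half hs ht h2
    have h5 := half hr ht (h1.trans h2)
    -- Three distinct parameters on one point would differ pairwise by 1/2, which is impossible.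
    by_contra! hne
    rcases h3.resolve_left hne.1 with h3 | h3 <;> rcases h4.resolve_left hne.2.1 with h4 | h4 <;>
      rcases h5.resolve_left hne.2.2 with h5 | h5 <;> linarith
  transverse s hs t ht hst h := by
    rcases hst.lt_or_gt with hlt | hlt
    · exact transverseAt_curve hs ht hlt h
    · exact (transverseAt_curve ht hs hlt h.symm).symm
  generic_or_ridge := curve_generic_or_ridge n
  dots _ := DotPair.along

theorem isK_standardKnot (n : ℕ) : IsK n (standardKnot n) := by
  have e13 : projIcc (0 : ℝ) 1 zero_le_one (1 / 3) = third := projIcc_of_mem _ _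
  have e23 : projIcc (0 : ℝ) 1 zero_le_one (2 / 3) = twoThirds := projIcc_of_mem _ _
  have hA : ∀ (e : Fin 3) (y : ℝ), pt e 0 y = ptA (projIcc 0 1 zero_le_one y) := fun e y => by
    rw [pt, projIcc_left]; exact congrArg (Prod.mk · _) (Theta.edgeParam_zero e)
  have hB : ∀ (e : Fin 3) (y : ℝ), pt e 1 y = ptB (projIcc 0 1 zero_le_one y) := fun e y => by
    rw [pt, projIcc_right]; exact congrArg (Prod.mk · _) (Theta.edgeParam_one e)
  -- On each quarter the coordinate along the edge is already an injective function of the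
  -- parameter.
  have inj : ∀ {S : Set ℝ} {e : Fin 3} {f g : ℝ → ℝ}, (∀ t ∈ S, curve n t = pt e (f t) (g t)) →
      (∀ t ∈ S, f t ∈ Icc (0 : ℝ) 1) → InjOn f S → InjOn (curve n) S := by
    intro S e f g h h01 hf s hs t ht hst
    have hc := congrArg (fun z : ThetaCyl => Theta.coord z.1) hst
    simp only [h s hs, h t ht] at hc
    change projIcc (0 : ℝ) 1 zero_le_one (f s) = projIcc 0 1 zero_le_one (f t) at hc
    rw [projIcc_of_mem _ (h01 s hs), projIcc_of_mem _ (h01 t ht)] at hc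
    exact hf hs ht (congrArg Subtype.val hc)
  refine ⟨⟨0, 1 / 4, 1 / 2, 3 / 4, by norm_num, by norm_num, by norm_num, by norm_num,
    ?_, ?_, ?_, ?_, ?_, ?_, ?_, ?_, ?_, ?_, ?_, ?_⟩, ?_, fun _ _ => rfl⟩
  · refine (curve_of_mem₀ n ⟨le_rfl, by norm_num⟩).trans ?_
    rw [mul_zero, low_zero, hA, e13]
  · refine (curve_of_mem₁ n ⟨le_rfl, by norm_num⟩).trans ?_
    rw [show (2 - 4 * (1 / 4) : ℝ) = 1 by norm_num, hB, e23]
  · refine (curve_of_mem₁ n ⟨by norm_num, le_rfl⟩).trans ?_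
    rw [show (2 - 4 * (1 / 2) : ℝ) = 0 by norm_num, hA, e23]
  · refine (curve_of_mem₃ n ⟨le_rfl, by norm_num⟩).trans ?_
    rw [show (4 - 4 * (3 / 4) : ℝ) = 1 by norm_num, hB, e13]
  · exact fun t ht => curve_mem_openSquare₀ 0 (by simpa using ht)
  · exact fun t ht => curve_mem_openSquare₁ 0 (by simpa using ht)
  · exact fun t ht => curve_mem_openSquare₂ 0 (by simpa using ht)
  · exact fun t ht => curve_mem_openSquare₃ 0 (by simpa using ht)
  · exact inj (fun t => curve_of_mem₀ n)
      (fun t ht => ⟨by linarith [ht.1], by linarith [ht.2]⟩) fun s _ t _ h => by linarith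
  · exact inj (fun t => curve_of_mem₁ n)
      (fun t ht => ⟨by linarith [ht.2], by linarith [ht.1]⟩) fun s _ t _ h => by linarith
  · exact inj (fun t => curve_of_mem₂ n)
      (fun t ht => ⟨by linarith [ht.1], by linarith [ht.2]⟩) fun s _ t _ h => by linarith
  · rw [zero_add]
    exact inj (fun t => curve_of_mem₃ n)
      (fun t ht => ⟨by linarith [ht.2], by linarith [ht.1]⟩) fun s _ t _ h => by linarith
  · change Set.ncard {p : ℝ × ℝ | 0 ≤ p.1 ∧ p.1 < p.2 ∧ p.2 < 1 ∧ curve n p.1 = curve n p.2} = _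
    rw [crossings_curve, ncard_image_of_injective, ncard_coe_finset, Finset.card_range]
    intro j k hjk
    have h : (2 * (j : ℝ) + 1) / (8 * (2 * n + 1)) = (2 * k + 1) / (8 * (2 * n + 1)) :=
      congrArg Prod.fst hjk
    have h' := (div_left_inj' (show (8 * (2 * n + 1) : ℝ) ≠ 0 by positivity)).1 h
    exact_mod_cast (show (j : ℝ) = k by linarith)

end ThetaCyl

end

theorem mainTheorem7 (h : unitInterval) :
    -- the fundamental group is free on the generators `u`, `v`
    Function.Bijective
      (FreeGroup.lift ![ThetaCyl.piClass (ThetaCyl.loopU h), ThetaCyl.piClass (ThetaCyl.loopV h)]) ∧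
    -- the knots `K_n` exist
    (∀ n : ℕ, ∃ K : Knot ThetaCyl, ThetaCyl.IsK n K) ∧
    -- their colinking class
    (∀ (n : ℕ) (K : Knot ThetaCyl), ThetaCyl.IsK n K →
      K.co = (2 * (n : ℤ) + 1) •
        (basisElt (freeClass (ThetaCyl.loopU h)) ⊗ₜ[ℤ] basisElt (freeClass (ThetaCyl.loopV h))
          + basisElt (freeClass (ThetaCyl.loopV h)) ⊗ₜ[ℤ] basisElt (freeClass (ThetaCyl.loopU h))
          - basisElt K.homotopyClass ⊗ₜ[ℤ] basisElt (trivialClass (ThetaCyl.ptA h))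
          - basisElt (trivialClass (ThetaCyl.ptA h)) ⊗ₜ[ℤ] basisElt K.homotopyClass)) ∧
    -- `K_n` is not isotopic to a knot with fewer than `2n+1` crossings, even as unoriented knots
    (∀ (n : ℕ) (K : Knot ThetaCyl), ThetaCyl.IsK n K →
      ∀ K' : Knot ThetaCyl, K'.cro < 2 * n + 1 →
        ¬ Knot.OrientedIsotopic K K' ∧ ¬ Knot.Isotopic K K') ∧
    -- the knots `K_n` are pairwise non-isotopic, even as unoriented knots
    (∀ (m n : ℕ) (K K' : Knot ThetaCyl), ThetaCyl.IsK m K → ThetaCyl.IsK n K' → m ≠ n →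
        ¬ Knot.OrientedIsotopic K K' ∧ ¬ Knot.Isotopic K K') := by
  refine ⟨⟨ThetaCyl.freeGroup_lift_injective h, ThetaCyl.freeGroup_lift_surjective h⟩,
    fun n => ⟨_, ThetaCyl.isK_standardKnot n⟩, fun n K hK => hK.co_eq h,
    fun n K hK K' hK' => ?_, fun m n K K' hK hK' hmn => ?_⟩
  -- It suffices to treat unoriented isotopy, since oriented isotopy implies it. The invariant of K'
  -- would be 2n+1, more than its number of crossings.
  · have key : ¬ Knot.Isotopic K K' := fun hi => by
      have h1 := hi.splitCount_eq (f := ThetaCyl.degreeMap)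
      have h2 := Knot.abs_splitCount_le ThetaCyl.degreeMap K'
      rw [h1, hK.splitCount_eq] at h2
      have h3 := (le_abs_self _).trans h2
      omega
    exact ⟨fun hi => key hi.isotopic, key⟩
  · have key : ¬ Knot.Isotopic K K' := fun hi => by
      have h1 := hi.splitCount_eq (f := ThetaCyl.degreeMap)
      rw [hK.splitCount_eq, hK'.splitCount_eq] at h1
      omega
    exact ⟨fun hi => key hi.isotopic, key⟩
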